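/- Let $N\ge 0$, let $A_1,\dots,A_N$ be finite cyclic groups with chosen generators $\gamma_1,\dots,\gamma_N$, and let $\Gamma=A_1*\cdots*A_N$ be their free product. **The surface $\Sigma$.** Let $\Sigma$ be the planar thickening of the Bass–Serre tree of $\Gamma$ (for the path of $N$ vertex groups $A_1,\dots,A_N$ with trivial edge groups), built from a fundamental domain as follows. Let $F$ be a closed disk, realized as the rectangle $[0,N+1]\times[0,1]\subset\mathbb{C}$, with the boundary points $c_\nu=\nu+i$ for $1\le\nu\le N$. Put $$\Sigma=(\Gamma\times F)/\!\sim ,$$ with $\Gamma$ discrete and the quotient topology, where $\sim$ is the equivalence relation generated by $(\gamma,c_\nu+s)\sim(\gamma\gamma_\nu,c_\nu-s)$ for $\gamma\in\Gamma$, $1\le\nu\le N$, $0\le s\le\frac14$. The group $\Gamma$ acts on $\Sigma$ by left multiplication on the first factor, and $F$ is identified with the image of $\{1\}\times F$. Thus the two arcs of $\partial F$ adjacent to $c_\nu$ are exchanged by $\gamma_\nu$. **Punctures.** Let $n\ge1$ and $L\ge0$ be integers, let $q_1,\dots,q_{n-1+L}$ be pairwise distinct points in the interior of $F$, put $$\Sigma(n-1+L)=\Sigma\setminus\Gamma(\{q_1,\dots,q_{n-1+L}\}),$$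 and let $\Sigma_\Gamma(n-1+L)$ be the orbifold given by $\Sigma(n-1+L)$ with its $\Gamma$-action. **Orbifold fundamental group.** Let a group $G$ act on a space $M$ by homeomorphisms. A $G$-path from $x$ to $y$ over a subdivision $a=t_0\le\dots\le t_p=b$ is a sequence $(g_0,c_1,g_1,\dots,c_p,g_p)$ of elements $g_i\in G$ and continuous maps $c_i:[t_{i-1},t_i]\to M$ such that $g_0(c_1(t_0))=x$, $g_i(c_{i+1}(t_i))=c_i(t_i)$ for $1\le i<p$, and $g_p(y)=c_p(t_p)$. Two $G$-paths are homotopic if they are related by a finite sequence of the following operations and their inverses: subdivisions, which replace $c_i$ by $(c_i|_{[t_{i-1},t']},1,c_i|_{[t',t_i]})$; shifts, which replace $(g_{i-1},c_i,g_i)$ by $(g_{i-1}h^{-1},h\cdot c_i,hg_i)$ for some $h\in G$; and elementary homotopies, i.e. families $(g_0,c_1^s,g_1,\dots,c_p^s,g_p)$ of $G$-paths from $x$ to $y$ over a fixed subdivision, with fixed $g_i$ and with $c_i^s$ depending continuously on $s$. The orbifold fundamental group $\pi_1^{orb}(M_G,x_0)$ is the group of homotopy classes of $G$-paths over $[0,1]$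 from $x_0$ to $x_0$, with concatenation as product. **Claim.** For every base point $x_0\in\Sigma(n-1+L)$, $$\pi_1^{orb}\bigl(\Sigma_\Gamma(n-1+L),x_0\bigr)\;\cong\;F_{n-1+L}*\Gamma,$$ where $F_{n-1+L}$ is the free group of rank $n-1+L$. -/

import Mathlib

universe u v

/-! ### `G`-paths and the orbifold fundamental group -/

section GPaths

open Set Topology
open scoped unitInterval

/-- `GPath G b y a x` is the type of `G`-paths `(g₀, c₁, g₁, …, c_p, g_p)` over subdivisions
`a = t₀ ≤ t₁ ≤ … ≤ t_p = b` with initial point `x` and terminal point `y`.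

Such a `G`-path is either `(g₀)` alone (then `p = 0`, `a = b` and `g₀ • y = x`), or it consists of
`g₀`, of a continuous map `c₁` on `[a, t₁]` with `g₀ • c₁ a = x`, and of the remaining `G`-path
`(g₁, c₂, …, g_p)` over `t₁ ≤ … ≤ t_p = b` from `c₁ t₁` to `y`.

A map on `[t_{i-1}, t_i]` is given by a function on `ℝ` of which only the values on the interval
matter (elementary homotopies identify functions that agree on the interval). -/
inductive GPath (G : Type u) {M : Type v} [Group G] [TopologicalSpace M] [MulAction G M]
    (b : ℝ) (y : M) : ℝ → M → Type (max u v)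
  | last {a : ℝ} {x : M} (g : G) (hab : a = b) (hx : g • y = x) : GPath G b y a x
  | cons {a : ℝ} {x : M} (g : G) (t : ℝ) (hat : a ≤ t) (c : ℝ → M)
      (hc : ContinuousOn c (Icc a t)) (hx : g • c a = x) (tail : GPath G b y t (c t)) :
      GPath G b y a x

namespace GPath

variable {G : Type u} {M : Type v} [Group G] [TopologicalSpace M] [MulAction G M]
variable {a b d : ℝ} {x y z : M}

/-- Replace the first group element `g₀` of a `G`-path by `h * g₀`; this moves the initial point
`x` to `h • x`. -/
def leapMul (h : G) {a' : ℝ} {x' : M} (ha : a = a') (hx' : h • x = x') :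
    GPath G b y a x → GPath G b y a' x'
  | last g hab hx => last (h * g) (ha ▸ hab) (by rw [mul_smul, hx, hx'])
  | cons g t hat c hc hx tail =>
      cons (h * g) t (ha ▸ hat) c (ha ▸ hc) (by subst ha; rw [mul_smul, hx, hx']) tail

/-- One subdivision or one shift, at an arbitrary place of a `G`-path.
* `subdivide` replaces `c` by `(c|[a,t'], 1, c|[t',t])`.
* `shift h` replaces `(g, c, k)` by `(g h⁻¹, h • c, h k)`.
* `tail` applies a subdivision or a shift further to the right. -/
inductive EquivStep : {a : ℝ} → {x : M} → GPath G b y a x → GPath G b y a x → Prop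
  | subdivide {a : ℝ} {x : M} (g : G) (t : ℝ) (hat : a ≤ t) (c : ℝ → M)
      (hc : ContinuousOn c (Icc a t)) (hx : g • c a = x) (tail : GPath G b y t (c t))
      (t' : ℝ) (hat' : a ≤ t') (ht't : t' ≤ t) :
      EquivStep (cons g t hat c hc hx tail)
        (cons g t' hat' c (hc.mono (Icc_subset_Icc_right ht't)) hx
          (cons 1 t ht't c (hc.mono (Icc_subset_Icc_left hat')) (one_smul G _) tail))
  | shift {a : ℝ} {x : M} (g : G) (t : ℝ) (hat : a ≤ t) (c : ℝ → M)
      (hc : ContinuousOn c (Icc a t)) (hx : g • c a = x) (tail : GPath G b y t (c t))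
      (h : G) (hc' : ContinuousOn (fun s => h • c s) (Icc a t))
      (hx' : (g * h⁻¹) • h • c a = x) :
      EquivStep (cons g t hat c hc hx tail)
        (cons (g * h⁻¹) t hat (fun s => h • c s) hc' hx' (tail.leapMul h rfl rfl))
  | tail {a : ℝ} {x : M} (g : G) (t : ℝ) (hat : a ≤ t) (c : ℝ → M)
      (hc : ContinuousOn c (Icc a t)) (hx : g • c a = x) {T T' : GPath G b y t (c t)}
      (hT : EquivStep T T') :
      EquivStep (cons g t hat c hc hx T) (cons g t hat c hc hx T')

/-- `IsHomotopyFamily ξ` says that the `G`-paths `ξ s = (g₀, c₁ˢ, g₁, …, c_pˢ, g_p)`, for `s` in the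
unit interval, have the same group elements and the same subdivision, and that every `c_iˢ(t)`
depends continuously on `(s, t)`. -/
inductive IsHomotopyFamily :
    {a : ℝ} → {x : I → M} → (∀ s : I, GPath G b y a (x s)) → Prop
  | last {a : ℝ} {x : I → M} (g : G) (hab : a = b) (hx : ∀ s, g • y = x s) :
      IsHomotopyFamily (fun s => last g hab (hx s))
  | cons {a : ℝ} {x : I → M} (g : G) (t : ℝ) (hat : a ≤ t) (c : I → ℝ → M)
      (hc : ∀ s, ContinuousOn (c s) (Icc a t)) (hx : ∀ s, g • c s a = x s)
      (tail : ∀ s, GPath G b y t (c s t))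
      (hcont : ContinuousOn (fun q : I × ℝ => c q.1 q.2) (univ ×ˢ Icc a t))
      (htail : IsHomotopyFamily tail) :
      IsHomotopyFamily (fun s => cons g t hat (c s) (hc s) (hx s) (tail s))

/-- An elementary homotopy (relative to the endpoints) from `p` to `q`. -/
def ElementaryHomotopic (p q : GPath G b y a x) : Prop :=
  ∃ ξ : I → GPath G b y a x, IsHomotopyFamily (x := fun _ => x) ξ ∧ ξ 0 = p ∧ ξ 1 = q

/-- Homotopy of `G`-paths relative to their endpoints: the equivalence relation generated by
subdivisions, shifts and elementary homotopies. -/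
def Homotopic : GPath G b y a x → GPath G b y a x → Prop :=
  Relation.EqvGen fun p q => EquivStep p q ∨ ElementaryHomotopic p q

/-- Concatenation `(g₀, c₁, …, c_p, g_p g'₀, c'₁, …, g'_p')` of two `G`-paths over adjacent
intervals. -/
def concat : {a : ℝ} → {x : M} → GPath G b y a x → GPath G d z b y → GPath G d z a x
  | _, _, last g hab hx, q => q.leapMul g hab.symm hx
  | _, _, cons g t hat c hc hx tail, q => cons g t hat c hc hx (tail.concat q)

/-- Reparametrization of a `G`-path by `t ↦ (t + e) / 2`. -/
noncomputable def halve (e : ℝ) {b' : ℝ} (hb : (b + e) / 2 = b') : {a : ℝ} → {x : M} → GPath G b y a x →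
    (a' : ℝ) → (x' : M) → (a + e) / 2 = a' → x = x' → GPath G b' y a' x'
  | _, _, last g hab hx, _, _, ha, hxx => last g (by rw [← ha, ← hb, hab]) (hx.trans hxx)
  | a, _, cons g t hat c hc hx tail, a', _, ha, hxx =>
      cons g ((t + e) / 2) (by rw [← ha]; linarith) (fun s => c (2 * s - e))
        (hc.comp (by fun_prop) (fun s hs => by
          obtain ⟨h1, h2⟩ := hs
          constructor <;> linarith))
        (by rw [← hxx, ← hx, ← ha]; congr 2; ring)
        (tail.halve e hb _ _ rfl (by congr 1; ring))

/-! #### Basic facts -/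

theorem Homotopic.refl (p : GPath G b y a x) : Homotopic p p := Relation.EqvGen.refl p

theorem Homotopic.symm {p q : GPath G b y a x} (h : Homotopic p q) : Homotopic q p :=
  Relation.EqvGen.symm _ _ h

theorem Homotopic.trans {p q r : GPath G b y a x} (h : Homotopic p q) (h' : Homotopic q r) :
    Homotopic p r := Relation.EqvGen.trans _ _ _ h h'

theorem EquivStep.homotopic {p q : GPath G b y a x} (h : EquivStep p q) : Homotopic p q :=
  Relation.EqvGen.rel _ _ (Or.inl h)

theorem ElementaryHomotopic.homotopic {p q : GPath G b y a x} (h : ElementaryHomotopic p q) :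
    Homotopic p q :=
  Relation.EqvGen.rel _ _ (Or.inr h)

/-- A map that preserves steps and elementary homotopies preserves homotopy. -/
theorem Homotopic.map {b' a' : ℝ} {y' x' : M} (f : GPath G b y a x → GPath G b' y' a' x')
    (h1 : ∀ p q, EquivStep p q → EquivStep (f p) (f q))
    (h2 : ∀ ξ : I → GPath G b y a x, IsHomotopyFamily (x := fun _ => x) ξ →
      IsHomotopyFamily (x := fun _ => x') (fun s => f (ξ s)))
    {p q : GPath G b y a x} (h : Homotopic p q) : Homotopic (f p) (f q) := by
  induction h with
  | rel p q h =>
    rcases h with h | ⟨ξ, hξ, rfl, rfl⟩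
    · exact (h1 _ _ h).homotopic
    · exact ElementaryHomotopic.homotopic ⟨_, h2 ξ hξ, rfl, rfl⟩
  | refl p => exact .refl _
  | symm p q _ ih => exact ih.symm
  | trans p q r _ _ ih ih' => exact ih.trans ih'

theorem leapMul_leapMul (h k : G) {a' a'' : ℝ} {x' x'' : M} (ha : a = a') (hx : h • x = x')
    (ha' : a' = a'') (hx' : k • x' = x'') (p : GPath G b y a x) :
    (p.leapMul h ha hx).leapMul k ha' hx' =
      p.leapMul (k * h) (ha.trans ha') (by rw [mul_smul, hx, hx']) := by
  cases p <;> simp [leapMul, mul_assoc]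

theorem leapMul_concat (h : G) {a' : ℝ} {x' : M} (ha : a = a') (hx : h • x = x')
    (p : GPath G b y a x) (q : GPath G d z b y) :
    (p.concat q).leapMul h ha hx = (p.leapMul h ha hx).concat q := by
  cases p with
  | last g hab hx =>
    change (q.leapMul g _ _).leapMul h _ _ = q.leapMul (h * g) _ _
    rw [leapMul_leapMul]
  | cons => rfl

theorem EquivStep.leapMul (h : G) {a' : ℝ} {x' : M} (ha : a = a') (hx : h • x = x')
    {p q : GPath G b y a x} (hpq : EquivStep p q) :
    EquivStep (p.leapMul h ha hx) (q.leapMul h ha hx) := by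
  subst ha
  cases hpq with
  | subdivide g t hat c hc hx tail t' hat' ht't => exact .subdivide ..
  | shift g t hat c hc hx' tail k hc' hx'' =>
    have := EquivStep.shift (h * g) t hat c hc (by rw [mul_smul, hx', hx]) tail k hc'
      (by rw [← hx, ← hx'']; simp [mul_smul])
    simpa only [GPath.leapMul, mul_assoc] using this
  | tail g t hat c hc hx hT => exact .tail _ _ _ _ _ _ hT

theorem IsHomotopyFamily.leapMul (h : G) {a' : ℝ} {x x' : I → M} (ha : a = a')
    (hx : ∀ s, h • x s = x' s) {ξ : ∀ s : I, GPath G b y a (x s)} (hξ : IsHomotopyFamily ξ) :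
    IsHomotopyFamily (fun s => (ξ s).leapMul h ha (hx s)) := by
  subst ha
  cases hξ with
  | last g hab hx' => exact .last (h * g) hab _
  | cons g t hat c hc hx' tail hcont htail => exact .cons (h * g) t hat c hc _ tail hcont htail

theorem isHomotopyFamily_const (p : GPath G b y a x) :
    IsHomotopyFamily (x := fun _ => x) (fun _ => p) := by
  induction p with
  | last g hab hx => exact .last g hab _
  | cons g t hat c hc hx tail ih =>
    exact .cons g t hat (fun _ => c) _ _ (fun _ => tail)
      (hc.comp continuousOn_snd (fun q hq => hq.2)) ih

theorem EquivStep.concat {p p' : GPath G b y a x} (h : EquivStep p p') (q : GPath G d z b y) :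
    EquivStep (p.concat q) (p'.concat q) := by
  induction h with
  | subdivide => exact .subdivide ..
  | shift g t hat c hc hx' tail k hc' hx'' =>
    simp only [GPath.concat, ← leapMul_concat]
    exact .shift ..
  | tail g t hat c hc hx hT ih => exact .tail _ _ _ _ _ _ ih

theorem EquivStep.concat_left (p : GPath G b y a x) {q q' : GPath G d z b y}
    (h : EquivStep q q') : EquivStep (p.concat q) (p.concat q') := by
  induction p with
  | last g hab hx => exact h.leapMul ..
  | cons g t hat c hc hx tail ih => exact .tail _ _ _ _ _ _ ih

theorem IsHomotopyFamily.concat {x : I → M} {ξ : ∀ s : I, GPath G b y a (x s)}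
    (h : IsHomotopyFamily ξ) (q : GPath G d z b y) :
    IsHomotopyFamily (fun s => (ξ s).concat q) := by
  induction h with
  | last g hab hx => exact (isHomotopyFamily_const q).leapMul g hab.symm hx
  | cons g t hat c hc hx' tail hcont htail ih =>
    exact .cons g t hat c hc hx' (fun s => (tail s).concat q) hcont ih

theorem IsHomotopyFamily.concat_left (p : GPath G b y a x) {ξ : I → GPath G d z b y}
    (h : IsHomotopyFamily (x := fun _ => y) ξ) :
    IsHomotopyFamily (x := fun _ => x) (fun s => p.concat (ξ s)) := by
  induction p with
  | last g hab hx => exact h.leapMul g hab.symm (fun _ => hx)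
  | cons g t hat c hc hx tail ih =>
    exact .cons g t hat (fun _ => c) (fun _ => hc) (fun _ => hx) (fun s => tail.concat (ξ s))
      (hc.comp continuousOn_snd (fun q hq => hq.2)) ih

theorem halve_leapMul (e : ℝ) {b' : ℝ} (hb : (b + e) / 2 = b') (h : G) {a₁ : ℝ} {x₁ : M}
    (ha : a = a₁) (hx : h • x = x₁) (p : GPath G b y a x) (a' : ℝ) (x' x₁' : M)
    (ha' : (a + e) / 2 = a') (ha₁ : (a₁ + e) / 2 = a')
    (hx' : x = x') (hx₁ : x₁ = x₁') (hh : h • x' = x₁') :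
    (p.leapMul h ha hx).halve e hb a' x₁' ha₁ hx₁ =
      (p.halve e hb a' x' ha' hx').leapMul h rfl hh := by
  subst ha hx' hx₁
  cases p <;> simp [GPath.leapMul, GPath.halve]

theorem EquivStep.halve (e : ℝ) {b' : ℝ} (hb : (b + e) / 2 = b') {p q : GPath G b y a x}
    (h : EquivStep p q) : ∀ (a' : ℝ) (x' : M) (ha : (a + e) / 2 = a') (hx : x = x'),
    EquivStep (p.halve e hb a' x' ha hx) (q.halve e hb a' x' ha hx) := by
  induction h with
  | subdivide g t hat c hc hx tail t' hat' ht't =>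
    intro a' x' ha hxx
    exact .subdivide _ _ _ _ _ _ _ ((t' + e) / 2) (by rw [← ha]; linarith) (by linarith)
  | @shift a x g t hat c hc hx' tail k hc' hx'' =>
    intro a' x' ha hxx
    simp only [GPath.halve]
    rw [halve_leapMul e hb k rfl rfl tail _ (c (2 * ((t + e) / 2) - e)) _ rfl rfl
      (by congr 1; ring) _ rfl]
    refine .shift _ _ _ _ _ _ _ k (hc'.comp (by fun_prop) (fun s hs => ?_)) _
    obtain ⟨h1, h2⟩ := hs
    constructor <;> linarith
  | tail g t hat c hc hx hT ih =>
    intro a' x' ha hxx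
    exact .tail _ _ _ _ _ _ (ih _ _ _ _)

theorem IsHomotopyFamily.halve (e : ℝ) {b' : ℝ} (hb : (b + e) / 2 = b') {x : I → M}
    {ξ : ∀ s : I, GPath G b y a (x s)} (h : IsHomotopyFamily ξ) :
    ∀ (a' : ℝ) (x' : I → M) (ha : (a + e) / 2 = a') (hx : ∀ s, x s = x' s),
    IsHomotopyFamily (fun s => (ξ s).halve e hb a' (x' s) ha (hx s)) := by
  induction h with
  | last g hab hx => intro a' x' ha hxx; exact .last g _ _
  | @cons a x g t hat c hc hx' tail hcont htail ih =>
    intro a' x' ha hxx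
    refine .cons g _ _ (fun s r => c s (2 * r - e)) _ _
      (fun s => (tail s).halve e hb _ _ rfl (by congr 1; ring)) ?_
      (ih _ (fun s => c s (2 * ((t + e) / 2) - e)) rfl (fun s => by simp only; congr 1; ring))
    refine hcont.comp (f := fun q : I × ℝ => (q.1, 2 * q.2 - e)) (by fun_prop) ?_
    rintro ⟨s, r⟩ ⟨-, h1, h2⟩
    refine ⟨trivial, ?_, ?_⟩ <;> simp only at h1 h2 ⊢ <;> linarith

theorem Homotopic.cons (g : G) (t : ℝ) (hat : a ≤ t) (c : ℝ → M)
    (hc : ContinuousOn c (Icc a t)) (hx : g • c a = x) {T T' : GPath G b y t (c t)}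
    (h : Homotopic T T') :
    Homotopic (GPath.cons g t hat c hc hx T) (GPath.cons g t hat c hc hx T') :=
  Homotopic.map (GPath.cons g t hat c hc hx) (fun _ _ => .tail _ _ _ _ _ _)
    (fun ξ hξ => .cons g t hat (fun _ => c) (fun _ => hc) (fun _ => hx) ξ
      (hc.comp continuousOn_snd (fun _ hq => hq.2)) hξ) h

theorem cons_heq {g g' : G} {t : ℝ} {hat hat' : a ≤ t} {c c' : ℝ → M} {x x' : M}
    {hc : ContinuousOn c (Icc a t)} {hc' : ContinuousOn c' (Icc a t)}
    {hx : g • c a = x} {hx' : g' • c' a = x'}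
    {T : GPath G b y t (c t)} {T' : GPath G b y t (c' t)}
    (hxx : x = x') (hg : g = g') (hcc : c = c') (hT : T ≍ T') :
    GPath.cons g t hat c hc hx T ≍ GPath.cons g' t hat' c' hc' hx' T' := by
  subst hxx hg hcc
  cases hT
  rfl

theorem last_heq {g : G} {hab : a = b} {x x' : M} {hx : g • y = x} {hx' : g • y = x'} :
    (GPath.last g hab hx) ≍ (GPath.last g hab hx') := by
  subst hx hx'
  rfl

/-- `G`-paths whose first pieces agree on the interval on which they are used are homotopic. -/
theorem Homotopic.cons_congr (g : G) (t : ℝ) (hat : a ≤ t) {c c' : ℝ → M}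
    (hc : ContinuousOn c (Icc a t)) (hc' : ContinuousOn c' (Icc a t)) (h : EqOn c c' (Icc a t))
    (hx : g • c a = x) (hx' : g • c' a = x)
    (T : GPath G b y t (c t)) (T' : GPath G b y t (c' t)) (hT : T ≍ T') :
    Homotopic (GPath.cons g t hat c hc hx T) (GPath.cons g t hat c' hc' hx' T') := by
  classical
  let C : I → ℝ → M := fun s => if s = 0 then c else c'
  have hC : ∀ s, EqOn (C s) c (Icc a t) := by
    intro s r hr
    by_cases hs : s = 0 <;> simp [C, hs, h hr]
  have e : ∀ s, c t = C s t := fun s => (hC s (right_mem_Icc.2 hat)).symm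
  have key : ∀ (X : I → M) (eX : ∀ s, c t = X s),
      IsHomotopyFamily (x := X) (fun s => (eX s ▸ T : GPath G b y t (X s))) := by
    intro X eX
    obtain rfl : X = fun _ => c t := funext fun s => (eX s).symm
    exact isHomotopyFamily_const T
  have fam : IsHomotopyFamily (x := fun _ => x) (fun s => GPath.cons g t hat (C s)
      (hc.congr (hC s)) (by rw [hC s (left_mem_Icc.2 hat), hx]) (e s ▸ T)) := by
    refine .cons g t hat C _ _ _ ?_ (key _ e)
    refine (hc.comp continuousOn_snd (fun q hq => hq.2)).congr ?_
    rintro ⟨s, r⟩ hq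
    exact hC s hq.2
  refine ElementaryHomotopic.homotopic ⟨_, fam, ?_, ?_⟩
  · exact eq_of_heq (cons_heq rfl rfl (by simp [C]) (eqRec_heq _ _))
  · exact eq_of_heq (cons_heq rfl rfl (by simp [C]) ((eqRec_heq _ _).trans hT))

section Continuous

variable [ContinuousConstSMul G M]

/-- Two consecutive pieces can be merged into one. -/
theorem homotopic_merge {g g' k : G} {t : ℝ} (hat : a ≤ t) (htb : t ≤ b) {c c' e : ℝ → M}
    (hc : ContinuousOn c (Icc a t)) (hc' : ContinuousOn c' (Icc t b))
    (he : ContinuousOn e (Icc a b))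
    (hx : g • c a = x) (hx' : g' • c' t = c t) (hy : (1 : G) • y = c' b) (hy' : (1 : G) • y = e b)
    (hk : k = g * g') (hk' : k • e a = x)
    (h1 : EqOn (fun s => g'⁻¹ • c s) e (Icc a t)) (h2 : EqOn c' e (Icc t b)) :
    Homotopic (cons g t hat c hc hx (cons g' b htb c' hc' hx' (last 1 rfl hy)))
      (cons k b (hat.trans htb) e he hk' (last 1 rfl hy')) := by
  have het : g'⁻¹ • c t = e t := h1 (right_mem_Icc.2 hat)
  have hc't : (1 : G) • c' t = e t := by rw [one_smul]; exact h2 (left_mem_Icc.2 htb)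
  refine (EquivStep.shift g t hat c hc hx _ g'⁻¹ (hc.const_smul _)
    (by rw [mul_smul, inv_inv, smul_inv_smul, hx])).homotopic.trans ?_
  have hxe : (g * g'⁻¹⁻¹) • e a = x := by rw [inv_inv, ← hk, hk']
  refine (Homotopic.cons_congr (g * g'⁻¹⁻¹) t hat _ (he.mono (Icc_subset_Icc_right htb)) h1 _ hxe _
    (cons 1 b htb c' hc' hc't (last 1 rfl hy)) ?_).trans ?_
  · exact cons_heq het (inv_mul_cancel _) rfl HEq.rfl
  refine (Homotopic.cons _ _ _ _ _ _ (Homotopic.cons_congr 1 b htb hc'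
    (he.mono (Icc_subset_Icc_left hat)) h2 hc't (one_smul G _) _ (last 1 rfl hy')
      last_heq)).trans ?_
  refine Homotopic.symm ?_
  have := (EquivStep.subdivide k b (hat.trans htb) e he hk' (last 1 rfl hy') t hat htb).homotopic
  convert this using 2
  simp [hk]

theorem exists_single (p : GPath G b y a x) : (∃ g hab hx, p = last g hab hx) ∨
    ∃ g c hab hc hx hy, Homotopic p (cons g b hab c hc hx (last 1 rfl hy)) := by
  induction p with
  | last g hab hx => exact Or.inl ⟨g, hab, hx, rfl⟩
  | @cons a x g t hat c hc hx tail ih =>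
    right
    rcases ih with ⟨k, rfl, hk, rfl⟩ | ⟨k, c', htb, hc', hx', hy, hh⟩
    · refine ⟨g * k⁻¹⁻¹, fun s => k⁻¹ • c s, hat, hc.const_smul _, ?_, ?_,
        (EquivStep.shift g t hat c hc hx _ k⁻¹ (hc.const_smul _) ?_).homotopic.trans ?_⟩
      · simp [mul_smul, hx]
      · simp [← hk]
      · simp [mul_smul, hx]
      · have : (last k rfl hk : GPath G t y t (c t)).leapMul k⁻¹ rfl rfl =
          last 1 rfl (by simp [← hk]) := by simp [leapMul]
        rw [this]
        exact .refl _
    · classical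
      let e : ℝ → M := fun s => if s ≤ t then k⁻¹ • c s else c' s
      have hct : k⁻¹ • c t = c' t := by rw [← hx', inv_smul_smul]
      have h1 : EqOn (fun s => k⁻¹ • c s) e (Icc a t) := fun s hs => by simp [e, hs.2]
      have h2 : EqOn c' e (Icc t b) := fun s hs => by
        rcases hs.1.eq_or_lt with rfl | h
        · simp [e, hct]
        · simp [e, not_le.2 h]
      have he : ContinuousOn e (Icc a b) := by
        rw [← Icc_union_Icc_eq_Icc hat htb]
        exact ((hc.const_smul _).congr h1.symm).union_of_isClosed (hc'.congr h2.symm)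
          isClosed_Icc isClosed_Icc
      have hxe : (g * k) • e a = x := by
        rw [← h1 (left_mem_Icc.2 hat)]; simp [mul_smul, hx]
      have hye : (1 : G) • y = e b := by rw [← h2 (right_mem_Icc.2 htb), hy]
      exact ⟨g * k, e, hat.trans htb, he, hxe, hye, (Homotopic.cons _ _ _ _ _ _ hh).trans
        (homotopic_merge hat htb hc hc' he hx hx' hy hye rfl hxe h1 h2)⟩

end Continuous

end GPath

/-- `G`-loops based at `x₀`, over subdivisions of `[0, 1]`. -/
abbrev GLoop (G : Type u) {M : Type v} [Group G] [TopologicalSpace M] [MulAction G M] (x₀ : M) :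
    Type (max u v) :=
  GPath G 1 x₀ 0 x₀

namespace GLoop

open GPath

variable {G : Type u} {M : Type v} [Group G] [TopologicalSpace M] [MulAction G M] {x₀ : M}

/-- The composition of two `G`-loops: the first one on `[0, 1/2]`, the second one on `[1/2, 1]`. -/
noncomputable def comp (p q : GLoop G x₀) : GLoop G x₀ :=
  (p.halve 0 (b' := 1 / 2) (by norm_num) 0 x₀ (by norm_num) rfl).concat
    (q.halve 1 (b' := 1) (by norm_num) (1 / 2) x₀ (by norm_num) rfl)

/-- The constant `G`-loop at `x₀`. -/
noncomputable def const : GLoop G x₀ :=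
  GPath.cons 1 1 zero_le_one (fun _ => x₀) continuousOn_const (one_smul G x₀)
    (GPath.last 1 rfl (one_smul G x₀))

theorem comp_congr {p p' q q' : GLoop G x₀} (hp : Homotopic p p') (hq : Homotopic q q') :
    Homotopic (comp p q) (comp p' q') := by
  refine Homotopic.trans (q := comp p' q)
    (Homotopic.map (fun p => comp p q) ?_ ?_ hp) (Homotopic.map (fun q => comp p' q) ?_ ?_ hq)
  · exact fun p p' h => (h.halve 0 _ _ _ _ _).concat _
  · exact fun ξ h => (h.halve 0 _ _ _ _ (fun _ => rfl)).concat _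
  · exact fun q q' h => EquivStep.concat_left _ (h.halve 1 _ _ _ _ _)
  · exact fun ξ h => IsHomotopyFamily.concat_left _ (h.halve 1 _ _ _ _ (fun _ => rfl))

/-- The continuous `G`-loop `(g, c)` given by a path `c` from `g⁻¹ • x₀` to `x₀`. -/
noncomputable def ofPath (g : G) (γ : Path (g⁻¹ • x₀) x₀) : GLoop G x₀ :=
  GPath.cons g 1 zero_le_one γ.extend γ.continuous_extend.continuousOn (by simp)
    (GPath.last 1 rfl (by simp))

theorem ofPath_congr (g : G) {γ γ' : Path (g⁻¹ • x₀) x₀} (h : γ.Homotopic γ') :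
    Homotopic (ofPath g γ) (ofPath g γ') := by
  obtain ⟨F⟩ := h
  have hl : ∀ s : I, (1 : G) • x₀ = (F.eval s).extend 1 := fun s => by simp
  refine ElementaryHomotopic.homotopic ⟨fun s => ofPath g (F.eval s), ?_, by simp, by simp⟩
  refine IsHomotopyFamily.cons g 1 zero_le_one (fun s => (F.eval s).extend) _ _
    (fun s => GPath.last 1 rfl (hl s)) ?_ (IsHomotopyFamily.last _ _ _)
  refine Continuous.continuousOn ?_
  have : Continuous fun q : I × ℝ => F (q.1, projIcc 0 1 zero_le_one q.2) := by fun_prop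
  exact this

theorem const_homotopic :
    Homotopic (const : GLoop G x₀) (ofPath 1 ((Path.refl x₀).cast (by simp) rfl)) := by
  have : (const : GLoop G x₀) = ofPath 1 ((Path.refl x₀).cast (by simp) rfl) := by
    refine eq_of_heq (cons_heq rfl rfl ?_ last_heq)
    rw [Path.extend_cast, Path.refl_extend]
    rfl
  rw [this]
  exact .refl _

section Continuous

variable [ContinuousConstSMul G M]

theorem exists_ofPath (p : GLoop G x₀) : ∃ g γ, Homotopic p (ofPath g γ) := by
  rcases exists_single p with ⟨_, h, _⟩ | ⟨g, c, hab, hc, hx, hy, hh⟩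
  · norm_num at h
  · have hx' : c 0 = g⁻¹ • x₀ := by rw [← hx, inv_smul_smul]
    have hy' : c 1 = x₀ := by rw [← hy, one_smul]
    let γ : Path (g⁻¹ • x₀) x₀ :=
      { toFun := fun s => c s
        continuous_toFun := hc.comp_continuous continuous_subtype_val (fun s => s.2)
        source' := by simpa using hx'
        target' := by simpa using hy' }
    refine ⟨g, γ, hh.trans (Homotopic.cons_congr _ _ _ _ _ ?_ _ _ _ _ last_heq)⟩
    intro s hs
    rw [Path.extend_apply _ hs]
    rfl

/-- The composition of two continuous `G`-loops as a continuous `G`-loop. -/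
theorem comp_ofPath (g g' k : G) (hk : k = g * g') (γ : Path (g⁻¹ • x₀) x₀)
    (γ' : Path (g'⁻¹ • x₀) x₀) (η : Path (k⁻¹ • x₀) (g'⁻¹ • x₀))
    (hη : ∀ s, η s = g'⁻¹ • γ s) :
    Homotopic (comp (ofPath g γ) (ofPath g' γ')) (ofPath k (η.trans γ')) := by
  have h0 : ∀ s, η.extend s = g'⁻¹ • γ.extend s := fun s => hη _
  simp only [comp, ofPath, GPath.halve, GPath.concat, GPath.leapMul]
  have hg : (k⁻¹ : G) • x₀ = (g * g')⁻¹ • x₀ := by rw [hk]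
  refine Homotopic.trans (q := GPath.cons g ((1 + 0) / 2) (by norm_num)
    (fun s => γ.extend (2 * s - 0)) (by fun_prop) (by norm_num)
    (GPath.cons g' 1 (by norm_num) (fun s => γ'.extend (2 * s - 1)) (by fun_prop) (by norm_num)
      (GPath.last 1 rfl (by norm_num)))) ?_ ?_
  · have key : ∀ (t : ℝ) (ht : t = 1) (h1 : (1 + 0) / 2 ≤ t) h2 h3 h4 h5 h6,
      (GPath.cons (1 * g') t h1 (fun s => γ'.extend (2 * s - 1)) h2 h3
        (GPath.last 1 h4 h5) : GPath G 1 x₀ ((1 + 0) / 2) (γ.extend (2 * ((1 + 0) / 2) - 0))) =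
      GPath.cons g' 1 (by norm_num) (fun s => γ'.extend (2 * s - 1)) (by fun_prop) h6
        (GPath.last 1 rfl (by norm_num)) := by
      intro t ht
      subst ht
      intros
      exact eq_of_heq (cons_heq rfl (one_mul _) rfl HEq.rfl)
    rw [key _ (by norm_num)]
    exact .refl _
  · refine homotopic_merge _ _ _ _ (Path.continuous_extend _).continuousOn _ _ _ _ hk
      (by simp) ?_ ?_
    · intro s hs
      rw [Path.extend_trans_of_le_half _ _ (by linarith [hs.2]), h0]
      simp only [sub_zero]
    · intro s hs
      rw [Path.extend_trans_of_half_le _ _ (by linarith [hs.1])]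

theorem comp_assoc (p q r : GLoop G x₀) :
    Homotopic (comp (comp p q) r) (comp p (comp q r)) := by
  obtain ⟨g, γ, hp⟩ := exists_ofPath p
  obtain ⟨g', γ', hq⟩ := exists_ofPath q
  obtain ⟨g'', γ'', hr⟩ := exists_ofPath r
  refine (comp_congr (comp_congr hp hq) hr).trans
    (Homotopic.trans ?_ (comp_congr hp (comp_congr hq hr)).symm)
  let η : Path ((g * g')⁻¹ • x₀) (g'⁻¹ • x₀) :=
    (γ.map (continuous_const_smul g'⁻¹)).cast (by simp [mul_smul]) rfl
  let ζ : Path ((g' * g'')⁻¹ • x₀) (g''⁻¹ • x₀) :=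
    (γ'.map (continuous_const_smul g''⁻¹)).cast (by simp [mul_smul]) rfl
  let ξ : Path ((g * g' * g'')⁻¹ • x₀) ((g' * g'')⁻¹ • x₀) :=
    (γ.map (continuous_const_smul (g' * g'')⁻¹)).cast (by simp [mul_smul]) rfl
  refine (comp_congr (comp_ofPath g g' _ rfl γ γ' η fun s => rfl) (.refl _)).trans ?_
  refine (comp_ofPath (g * g') g'' _ rfl (η.trans γ') γ'' (ξ.trans ζ) fun s => ?_).trans ?_
  · simp only [Path.trans_apply]
    split_ifs
    · simp [ξ, η, mul_smul]
    · rfl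
  refine Homotopic.trans ?_
    (comp_congr (.refl _) (comp_ofPath g' g'' _ rfl γ' γ'' ζ fun s => rfl)).symm
  refine Homotopic.trans ?_
    (comp_ofPath g (g' * g'') _ (mul_assoc _ _ _) γ (ζ.trans γ'') ξ fun s => rfl).symm
  exact ofPath_congr _ ⟨Path.Homotopy.transAssoc ξ ζ γ''⟩

theorem const_comp (p : GLoop G x₀) : Homotopic (comp const p) p := by
  obtain ⟨g, γ, hp⟩ := exists_ofPath p
  refine (comp_congr const_homotopic hp).trans (Homotopic.trans ?_ hp.symm)
  refine (comp_ofPath 1 g g (by simp) _ γ (Path.refl _) fun s => rfl).trans ?_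
  exact ofPath_congr _ ⟨Path.Homotopy.reflTrans γ⟩

theorem exists_comp_const (p : GLoop G x₀) : ∃ q, Homotopic (comp q p) const := by
  obtain ⟨g, γ, hp⟩ := exists_ofPath p
  let δ : Path (g⁻¹⁻¹ • x₀) x₀ :=
    (γ.symm.map (continuous_const_smul g)).cast (by simp) (by simp)
  refine ⟨ofPath g⁻¹ δ, (comp_congr (.refl _) hp).trans (Homotopic.trans ?_ const_homotopic.symm)⟩
  refine (comp_ofPath g⁻¹ g 1 (by simp) δ γ (γ.symm.cast (by simp) rfl) fun s => ?_).trans ?_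
  · simp [δ]
  · refine ofPath_congr _ ?_
    have key : ∀ z (hz : z = x₀),
        ((γ.symm.cast hz rfl).trans γ).Homotopic ((Path.refl x₀).cast hz rfl) := by
      rintro _ rfl
      exact ⟨(Path.Homotopy.reflSymmTrans γ).symm⟩
    exact key _ _

end Continuous

end GLoop

/-- The orbifold fundamental group `π₁ᵒʳᵇ(M_G, x₀)`: homotopy classes of `G`-loops based at `x₀`. -/
def OrbifoldFundamentalGroup (G : Type u) {M : Type v} [Group G] [TopologicalSpace M]
    [MulAction G M] (x₀ : M) : Type (max u v) :=
  Quot (GPath.Homotopic : GLoop G x₀ → GLoop G x₀ → Prop)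

namespace OrbifoldFundamentalGroup

variable {G : Type u} {M : Type v} [Group G] [TopologicalSpace M] [MulAction G M] {x₀ : M}

/-- The product of homotopy classes of `G`-loops, induced by composition of `G`-loops. -/
noncomputable instance : Mul (OrbifoldFundamentalGroup G x₀) where
  mul := Quot.map₂ GLoop.comp (fun _ _ _ h => GLoop.comp_congr (.refl _) h)
    (fun _ _ _ h => GLoop.comp_congr h (.refl _))

/-- The class of the constant `G`-loop. -/
noncomputable instance : One (OrbifoldFundamentalGroup G x₀) where
  one := Quot.mk _ GLoop.const

theorem exists_mul_eq_one [ContinuousConstSMul G M] (α : OrbifoldFundamentalGroup G x₀) :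
    ∃ β : OrbifoldFundamentalGroup G x₀, β * α = 1 := by
  induction α using Quot.ind with
  | mk p =>
    obtain ⟨q, hq⟩ := GLoop.exists_comp_const p
    exact ⟨Quot.mk _ q, Quot.sound hq⟩

noncomputable instance [ContinuousConstSMul G M] : Inv (OrbifoldFundamentalGroup G x₀) where
  inv α := (exists_mul_eq_one α).choose

noncomputable instance [ContinuousConstSMul G M] : Group (OrbifoldFundamentalGroup G x₀) :=
  Group.ofLeftAxioms
    (fun α β γ => by
      induction α using Quot.ind
      induction β using Quot.ind
      induction γ using Quot.ind
      exact Quot.sound (GLoop.comp_assoc _ _ _))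
    (fun α => by
      induction α using Quot.ind
      exact Quot.sound (GLoop.const_comp _))
    (fun α => (exists_mul_eq_one α).choose_spec)

end OrbifoldFundamentalGroup

end GPaths

/-! ### The orbifold `Σ_Γ` of a free product of finite cyclic groups

Here `Γ` is the free product `Monoid.CoprodI A` of finite cyclic groups `A ν` with chosen
generators `g ν`. The surface `Σ` is a thickening of the Bass-Serre tree of `Γ`, assembled from
the translates `γ F` of a fundamental domain `F`, which is a disk with `N` cone points
on its boundary, each of them having two adjacent boundary arcs that are exchanged by the generator
of its stabilizer. -/

section Surface

open Monoid Set

/-- The shape of the fundamental domain `F`: the rectangle `[0, N+1] × [0, 1]` in `ℂ`. -/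
def domainDisk (N : ℕ) : Set ℂ := Icc (0 : ℝ) (N + 1) ×ℂ Icc (0 : ℝ) 1

/-- The cone points of `F` are the points `(ν + 1) + i` of its upper side (`ν = 0, …, N - 1`), and
the two arcs adjacent to the `ν`-th one consist of the points `(ν + 1 + s) + i` with
`0 ≤ s ≤ 1/4` and with `-1/4 ≤ s ≤ 0`. For different `ν` these arcs are disjoint. -/
noncomputable def arcPoint {N : ℕ} (ν : Fin N) (s : ℝ) (hs : |s| ≤ 1 / 4) : domainDisk N :=
  ⟨⟨(ν : ℕ) + 1 + s, 1⟩, by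
    have h1 : ((ν : ℕ) : ℝ) + 1 ≤ N := by exact_mod_cast ν.2
    have h2 : (0 : ℝ) ≤ ((ν : ℕ) : ℝ) := Nat.cast_nonneg _
    obtain ⟨h3, h4⟩ := abs_le.1 hs
    rw [domainDisk, Complex.mem_reProdIm]
    refine ⟨⟨?_, ?_⟩, ?_, ?_⟩ <;> simp only <;> linarith⟩

variable {N : ℕ} (A : Fin N → Type u) [∀ ν, Group (A ν)] (g : ∀ ν, A ν)

/-- The gluing of the copies `γ F`, `γ ∈ Γ`, of `F`: the right-hand arc at the `ν`-th cone point of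
`γ F` is glued to the left-hand arc at the `ν`-th cone point of `γ γ_ν F`, where `γ_ν` is the
generator of the `ν`-th free factor. In particular the `ν`-th cone points of the `γ γ_ν ^ l F` are
all identified. -/
inductive Glue : (_ : CoprodI A) × domainDisk N → (_ : CoprodI A) × domainDisk N → Prop
  | arc (γ : CoprodI A) (ν : Fin N) (s : ℝ) (hs₀ : 0 ≤ s) (hs : s ≤ 1 / 4) :
      Glue ⟨γ, arcPoint ν s (abs_le.2 ⟨by linarith, hs⟩)⟩
        ⟨γ * CoprodI.of (g ν), arcPoint ν (-s) (abs_le.2 ⟨by linarith, by linarith⟩)⟩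

/-- The surface `Σ`, with the quotient topology of the disjoint union of the copies `γ F`. -/
def ThickTree : Type u := Quot (Glue A g)

namespace ThickTree

instance : TopologicalSpace (ThickTree A g) :=
  inferInstanceAs (TopologicalSpace (Quot (Glue A g)))

/-- The point `x` of the copy `γ F`. -/
def mk (γ : CoprodI A) (x : domainDisk N) : ThickTree A g := Quot.mk _ ⟨γ, x⟩

/-- The action of `Γ` on `Σ`, permuting the copies of `F` by left multiplication. -/
instance : MulAction (CoprodI A) (ThickTree A g) where
  smul γ := Quot.map (fun p => ⟨γ * p.1, p.2⟩) (by
    rintro _ _ ⟨γ', ν, s, hs₀, hs⟩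
    rw [← mul_assoc]
    exact .arc (γ * γ') ν s hs₀ hs)
  one_smul := by
    rintro ⟨γ, x⟩
    exact congrArg (fun δ => mk A g δ x) (one_mul γ)
  mul_smul := by
    rintro γ γ' ⟨γ'', x⟩
    exact congrArg (fun δ => mk A g δ x) (mul_assoc γ γ' γ'')

instance : ContinuousConstSMul (CoprodI A) (ThickTree A g) where
  continuous_const_smul γ := by
    have h : Continuous fun p : (_ : CoprodI A) × domainDisk N =>
        (⟨γ * p.1, p.2⟩ : (_ : CoprodI A) × domainDisk N) :=
      continuous_sigma fun γ' =>
        continuous_sigmaMk (σ := fun _ : CoprodI A => domainDisk N) (i := γ * γ') 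
    exact continuous_quot_lift _ (continuous_quot_mk.comp h)

end ThickTree

/-- The surface `Σ(k) = Σ ∖ Γ({q₁, …, q_k})` with its action of `Γ`, for `k` points `q_j` of the
fundamental domain `F`. -/
def PuncturedThickTree {k : ℕ} (q : Fin k → domainDisk N) :
    SubMulAction (CoprodI A) (ThickTree A g) where
  carrier := {z | ∀ j, z ∉ MulAction.orbit (CoprodI A) (ThickTree.mk A g 1 (q j))}
  smul_mem' γ z hz j h := hz j (by
    obtain ⟨δ, hδ⟩ := h
    exact ⟨γ⁻¹ * δ, by simp only at hδ ⊢; rw [mul_smul, hδ, inv_smul_smul]⟩)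

instance {k : ℕ} (q : Fin k → domainDisk N) :
    ContinuousConstSMul (CoprodI A) (PuncturedThickTree A g q) where
  continuous_const_smul γ :=
    ((continuous_const_smul γ).comp continuous_subtype_val).subtype_mk _

end Surface

-- The fundamental domain `F` is cut along rays that leave a common point `o`, each starting at its
-- puncture. What remains of `F`, without the glued arcs, is star-shaped about `o`: the disk. A
-- convex wedge around the part of each ray beyond its puncture meets the disk in two sides. The
-- copies of `F` around the `ν`-th cone point give a contractible neighbourhood of it that is stable
-- under `A ν` and meets the disk in one connected set. Outside the translates of the disk, two
-- translates of these pieces share points only if they are equal or are translates of the same cone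
-- by elements of one coset of `A ν`. Van Kampen's theorem would thus give one free generator per
-- wedge and one free factor `A ν` per cone point.
--
-- Instead of van Kampen's theorem, the proof writes down a homomorphism `hom` from `H = F * Γ` to
-- the orbifold fundamental group and shows it bijective. Loops are handled through frames, path
-- classes from a point to a translate of the base point: the difference of two frames at one point
-- is a group element, unchanged when both frames are transported or translated together. Comparing
-- the frame of a wedge with that of the disk on the far side gives `cutLoop`; comparing the frame
-- of a cone with its translate by `A ν` gives `coneHom`.
--
-- Surjectivity (`hom_surjective`): a path is subdivided so that every part lies in one translate of
-- a piece; along such a part the frame of the piece is transported to itself, and at a division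
-- point any two standard frames differ by an element of the range of `hom`.
--
-- Injectivity (`hom_injective`): locally constant transition functions with values in `H` glue the
-- charts to a covering with fibre `H`, on which `Γ` acts compatibly. The end of a lifted `G`-path
-- depends only on the homotopy class (`Homotopic.lifts_iff`), and the monodromy of `hom h` is right
-- multiplication by `h`, so `hom h = 1` forces `h = 1`.
--
-- The remaining work is planar geometry: the pieces are convex or star-shaped in `F`, and the
-- segment contractions respect the gluing (`isSimplyConnected_image`).

universe t w

/-! ### Lifting `G`-paths along equivariant coverings -/

section GPathLifts

open Set Topology
open scoped unitInterval

variable {G : Type u} {M : Type v} {E : Type w} [Group G] [TopologicalSpace M] [MulAction G M]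
  [TopologicalSpace E] [MulAction G E]

namespace GPath

variable {a b d : ℝ} {x y z : M}

/-- `ξ.Lifts pr e e'` says that the `G`-path `ξ` has a lift along `pr` with initial point `e` and
terminal point `e'`. -/
def Lifts (pr : E → M) : {a : ℝ} → {x : M} → GPath G b y a x → E → E → Prop
  | _, _, last g _ _, e, e' => e = g • e'
  | a, _, cons g t _ c _ _ tail, e, e' => ∃ l : ℝ → E, ContinuousOn l (Icc a t) ∧
      EqOn (pr ∘ l) c (Icc a t) ∧ g • l a = e ∧ tail.Lifts pr (l t) e'

theorem Lifts.leapMul {pr : E → M} (h : G) {a' : ℝ} {x' : M} (ha : a = a') (hx : h • x = x')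
    {ξ : GPath G b y a x} {e e' : E} (hξ : ξ.Lifts pr e e') :
    (ξ.leapMul h ha hx).Lifts pr (h • e) e' := by
  subst ha
  cases ξ with
  | last g hab hx' =>
    have : e = g • e' := hξ
    change h • e = (h * g) • e'
    rw [this, mul_smul]
  | cons g t hat c hc hx' tail =>
    obtain ⟨l, hl, hlc, rfl, ht⟩ := hξ
    exact ⟨l, hl, hlc, mul_smul _ _ _, ht⟩

theorem Lifts.concat {pr : E → M} {ξ : GPath G b y a x} {η : GPath G d z b y} {e e' e'' : E}
    (hξ : ξ.Lifts pr e e') (hη : η.Lifts pr e' e'') : (ξ.concat η).Lifts pr e e'' := by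
  induction ξ generalizing e with
  | last g hab hx =>
    obtain rfl : e = g • e' := hξ
    exact hη.leapMul g _ _
  | cons g t hat c hc hx tail ih =>
    obtain ⟨l, hl, hlc, rfl, ht⟩ := hξ
    exact ⟨l, hl, hlc, rfl, ih ht⟩

theorem Lifts.halve {pr : E → M} (r : ℝ) {b' : ℝ} (hb : (b + r) / 2 = b') {ξ : GPath G b y a x}
    {e e' : E} (hξ : ξ.Lifts pr e e') : ∀ (a' : ℝ) (x' : M) (ha : (a + r) / 2 = a') (hx : x = x'),
    (ξ.halve r hb a' x' ha hx).Lifts pr e e' := by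
  induction ξ generalizing e with
  | last g hab hx => intro a' x' ha hxx; exact hξ
  | @cons a x g t hat c hc hx tail ih =>
    intro a' x' ha hxx
    obtain ⟨l, hl, hlc, rfl, ht⟩ := hξ
    have hmaps : MapsTo (fun s : ℝ => 2 * s - r) (Icc a' ((t + r) / 2)) (Icc a t) := by
      rintro s ⟨h1, h2⟩
      constructor <;> linarith
    refine ⟨fun s => l (2 * s - r), hl.comp (by fun_prop) hmaps, fun s hs => hlc (hmaps hs), ?_, ?_⟩
    · have : 2 * a' - r = a := by rw [← ha]; ring
      simp only [this]
    · have : 2 * ((t + r) / 2) - r = t := by ring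
      simp only [this]
      exact ih ht _ _ _ _

/-- Each continuous piece has a unique lift with given initial point, and the jumps by group
elements are invertible. -/
theorem Lifts.unique {pr : E → M} (cov : IsCoveringMap pr) {ξ : GPath G b y a x} {e e₁ e₂ : E}
    (h₁ : ξ.Lifts pr e e₁) (h₂ : ξ.Lifts pr e e₂) : e₁ = e₂ := by
  induction ξ generalizing e with
  | last g hab hx =>
    have h₁' : e = g • e₁ := h₁
    have h₂' : e = g • e₂ := h₂
    exact smul_left_cancel g (h₁'.symm.trans h₂')
  | @cons a x g t hat c hc hx tail ih =>
    obtain ⟨l, hl, hlc, hle, ht⟩ := h₁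
    obtain ⟨l', hl', hlc', hle', ht'⟩ := h₂
    have : EqOn l l' (Icc a t) := cov.eqOn_of_comp_eqOn isPreconnected_Icc hl hl'
      (hlc.trans hlc'.symm) (left_mem_Icc.2 hat) (smul_left_cancel g (hle.trans hle'.symm))
    rw [this (right_mem_Icc.2 hat)] at ht
    exact ih ht ht'

theorem Lifts.of_equivStep {pr : E → M} [ContinuousConstSMul G E]
    (hpr : ∀ (g : G) (e : E), pr (g • e) = g • pr e) {ξ ξ' : GPath G b y a x}
    (h : EquivStep ξ ξ') {e e' : E} (hξ : ξ.Lifts pr e e') : ξ'.Lifts pr e e' := by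
  induction h generalizing e with
  | subdivide g t hat c hc hx tail t' hat' ht't =>
    obtain ⟨l, hl, hlc, rfl, ht⟩ := hξ
    exact ⟨l, hl.mono (Icc_subset_Icc_right ht't), hlc.mono (Icc_subset_Icc_right ht't), rfl,
      l, hl.mono (Icc_subset_Icc_left hat'), hlc.mono (Icc_subset_Icc_left hat'), one_smul _ _, ht⟩
  | shift g t hat c hc hx tail h hc' hx' =>
    obtain ⟨l, hl, hlc, rfl, ht⟩ := hξ
    refine ⟨fun s => h • l s, hl.const_smul h, fun s hs => ?_, ?_, ht.leapMul h rfl rfl⟩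
    · simp only [Function.comp_apply, hpr]
      rw [← hlc hs, Function.comp_apply]
    · simp [mul_smul]
  | tail g t hat c hc hx hT ih =>
    obtain ⟨l, hl, hlc, rfl, ht⟩ := hξ
    exact ⟨l, hl, hlc, rfl, ih ht⟩

/-- The homotopy lifting property is applied piece by piece. The continuity of the terminal points
in `s` is carried along because they are the initial points for the next piece. -/
theorem IsHomotopyFamily.exists_lifts {pr : E → M} (cov : IsCoveringMap pr)
    [ContinuousConstSMul G E] (hpr : ∀ (g : G) (e : E), pr (g • e) = g • pr e) {x : I → M}
    {ξ : ∀ s : I, GPath G b y a (x s)} (h : IsHomotopyFamily ξ) {e : I → E} (he : Continuous e)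
    (hex : ∀ s, pr (e s) = x s) :
    ∃ e' : I → E, Continuous e' ∧ (∀ s, pr (e' s) = y) ∧ ∀ s, (ξ s).Lifts pr (e s) (e' s) := by
  induction h generalizing e with
  | @last a x g hab hx =>
    refine ⟨fun s => g⁻¹ • e s, he.const_smul _, fun s => ?_, fun s => (smul_inv_smul g _).symm⟩
    rw [hpr, hex, ← hx, inv_smul_smul]
  | @cons a x g t hat c hc hx tail hcont htail ih =>
    -- `r` parametrizes `[a, t]` by the unit interval and `j` below is its inverse. For `a = t` the
    -- division by zero makes `j` zero, which is harmless since `r` is then constant.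
    let r : I → ℝ := fun u => a + u * (t - a)
    have hr : ∀ u, r u ∈ Icc a t := fun u => by
      have h1 := mul_nonneg u.2.1 (sub_nonneg.2 hat)
      have h2 := mul_le_mul_of_nonneg_right u.2.2 (sub_nonneg.2 hat)
      constructor <;> simp only [r] <;> linarith
    let H : C(I × I, M) := ⟨fun q => c q.2 (r q.1), hcont.comp_continuous
      (f := fun q : I × I => (q.2, r q.1)) (by fun_prop) fun q => ⟨trivial, hr _⟩⟩
    let f : C(I, E) := ⟨fun s => g⁻¹ • e s, he.const_smul _⟩
    have H0 : ∀ s, H (0, s) = pr (f s) := fun s => by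
      simp [H, f, r, hpr, hex, ← hx]
    let L := cov.liftHomotopy H f H0
    have hL : ∀ q, pr (L q) = H q := congr_fun (cov.liftHomotopy_lifts H f H0)
    have hL0 : ∀ s, L (0, s) = g⁻¹ • e s := cov.liftHomotopy_zero H f H0
    let j : ℝ → I := fun v => projIcc 0 1 zero_le_one ((v - a) / (t - a))
    have hj : ∀ v ∈ Icc a t, r (j v) = v := by
      rintro v ⟨h1, h2⟩
      rcases hat.eq_or_lt with rfl | hlt
      · simp only [r, sub_self, mul_zero, add_zero]
        linarith
      · have hmem : (v - a) / (t - a) ∈ Icc (0 : ℝ) 1 :=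
          ⟨div_nonneg (by linarith) (by linarith), by rw [div_le_one] <;> linarith⟩
        simp only [r, j, projIcc_of_mem zero_le_one hmem]
        rw [div_mul_cancel₀ _ (by linarith)]
        ring
    have hj0 : j a = 0 := by simp [j]
    let l : I → ℝ → E := fun s v => L (j v, s)
    have hjc : Continuous j := continuous_projIcc.comp (by fun_prop)
    obtain ⟨e', he', hye', hl'⟩ := ih (e := fun s => l s t)
      (L.continuous.comp (by fun_prop)) (fun s => by
        simp only [l, hL]
        change c s (r (j t)) = _
        rw [hj t (right_mem_Icc.2 hat)])
    refine ⟨e', he', hye', fun s => ⟨l s, ?_, fun v hv => ?_, ?_, hl' s⟩⟩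
    · exact (L.continuous.comp (by fun_prop)).continuousOn
    · simp only [Function.comp_apply, l, hL]
      change c s (r (j v)) = _
      rw [hj v hv]
    · simp only [l, hj0, hL0, smul_inv_smul]

theorem exists_lifts {pr : E → M} (cov : IsCoveringMap pr) [ContinuousConstSMul G E]
    (hpr : ∀ (g : G) (e : E), pr (g • e) = g • pr e) (ξ : GPath G b y a x) {e : E} (he : pr e = x) :
    ∃ e', ξ.Lifts pr e e' := by
  obtain ⟨e', -, -, h⟩ := (isHomotopyFamily_const ξ).exists_lifts cov hpr
    (continuous_const (y := e)) (fun _ => he)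
  exact ⟨e' 0, h 0⟩

/-- Along an elementary homotopy the terminal point of the lift moves continuously inside the fibre
over `y`. Fibres of a covering are discrete, so it stands still. Subdivisions and shifts can be
copied on the lift. -/
theorem Homotopic.lifts_iff {pr : E → M} (cov : IsCoveringMap pr) [ContinuousConstSMul G E]
    (hpr : ∀ (g : G) (e : E), pr (g • e) = g • pr e) {ξ ξ' : GPath G b y a x}
    (h : Homotopic ξ ξ') {e e' : E} (he : pr e = x) : ξ.Lifts pr e e' ↔ ξ'.Lifts pr e e' := by
  induction h with
  | rel ξ ξ' h =>
    -- One implication is enough: lifts exist for both `G`-paths and their terminal points are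
    -- unique.
    suffices key : ∀ e', ξ.Lifts pr e e' → ξ'.Lifts pr e e' by
      refine ⟨key e', fun h' => ?_⟩
      obtain ⟨e'', h''⟩ := exists_lifts cov hpr ξ he
      rwa [h'.unique cov (key _ h'')]
    intro e' hξ
    rcases h with h | ⟨η, hη, rfl, rfl⟩
    · exact hξ.of_equivStep hpr h
    · obtain ⟨f, hf, hfy, hl⟩ := hη.exists_lifts cov hpr (continuous_const (y := e)) (fun _ => he)
      rw [hξ.unique cov (hl 0),
        cov.const_of_comp hf (fun s s' => (hfy s).trans (hfy s').symm) 0 1]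
      exact hl 1
  | refl ξ => exact Iff.rfl
  | symm ξ ξ' _ ih => exact ih.symm
  | trans ξ ξ' ξ'' _ _ ih ih' => exact ih.trans ih'

end GPath

namespace OrbifoldFundamentalGroup

variable {x₀ : M}

/-- A class of `G`-loops lifts to a path from `e` to `e'`. -/
def Lifts (pr : E → M) (α : OrbifoldFundamentalGroup G x₀) (e e' : E) : Prop :=
  ∃ ξ : GLoop G x₀, Quot.mk _ ξ = α ∧ ξ.Lifts pr e e'

theorem Lifts.unique {pr : E → M} (cov : IsCoveringMap pr) [ContinuousConstSMul G E]
    (hpr : ∀ (g : G) (e : E), pr (g • e) = g • pr e) {α : OrbifoldFundamentalGroup G x₀}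
    {e e₁ e₂ : E} (he : pr e = x₀) (h₁ : α.Lifts pr e e₁) (h₂ : α.Lifts pr e e₂) : e₁ = e₂ := by
  obtain ⟨ξ, rfl, hξ⟩ := h₁
  obtain ⟨η, hη, hη'⟩ := h₂
  have hh : GPath.Homotopic η ξ := by
    have := Quot.eqvGen_exact hη
    refine (Equivalence.eqvGen_iff (r := (GPath.Homotopic : GLoop G x₀ → _ → _)) ?_).1 this
    exact ⟨.refl, .symm, .trans⟩
  exact hξ.unique cov ((hh.lifts_iff cov hpr he).1 hη')

theorem Lifts.mul [ContinuousConstSMul G M] {pr : E → M} {α β : OrbifoldFundamentalGroup G x₀}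
    {e e' e'' : E} (hα : α.Lifts pr e e') (hβ : β.Lifts pr e' e'') :
    (α * β).Lifts pr e e'' := by
  obtain ⟨ξ, rfl, hξ⟩ := hα
  obtain ⟨η, rfl, hη⟩ := hβ
  exact ⟨GLoop.comp ξ η, rfl, (hξ.halve 0 _ _ _ _ _).concat (hη.halve 1 _ _ _ _ _)⟩

theorem lifts_one [ContinuousConstSMul G M] {pr : E → M} {e : E} (he : pr e = x₀) :
    (1 : OrbifoldFundamentalGroup G x₀).Lifts pr e e :=
  ⟨GLoop.const, rfl, fun _ => e, continuousOn_const, fun _ _ => he, one_smul _ _,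
    (one_smul _ _).symm⟩

/-- Inverses in the group were chosen, not constructed, so no lift can be written down. Some lift of
`α⁻¹` from `e'` exists; after that of `α` it is a lift of `1`, which must close up at `e`. -/
theorem Lifts.inv [ContinuousConstSMul G M] {pr : E → M} (cov : IsCoveringMap pr)
    [ContinuousConstSMul G E] (hpr : ∀ (g : G) (e : E), pr (g • e) = g • pr e)
    {α : OrbifoldFundamentalGroup G x₀} {e e' : E} (he : pr e = x₀) (he' : pr e' = x₀)
    (h : α.Lifts pr e e') : α⁻¹.Lifts pr e' e := by
  obtain ⟨e'', h'⟩ : ∃ e'', α⁻¹.Lifts pr e' e'' := by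
    generalize α⁻¹ = β
    induction β using Quot.ind with
    | mk ξ =>
      obtain ⟨e'', h'⟩ := ξ.exists_lifts cov hpr he'
      exact ⟨e'', ξ, rfl, h'⟩
  have h1 := h.mul h'
  rw [mul_inv_cancel] at h1
  rwa [(lifts_one he).unique cov hpr he h1]

end OrbifoldFundamentalGroup

end GPathLifts

/-! ### Frames and path classes -/

section Frames

open Set Topology
open scoped unitInterval

/-- A property of homotopy classes of paths that is closed under concatenation and holds for all
paths that stay inside one member of an open cover holds for all classes. -/
theorem Path.Homotopic.Quotient.induction_of_openCover {X : Type*} [TopologicalSpace X] {ι : Type*}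
    {U : ι → Set X} (hU : ∀ i, IsOpen (U i)) (hcov : ∀ x, ∃ i, x ∈ U i)
    {P : ∀ {x y : X}, Path.Homotopic.Quotient x y → Prop}
    (hmem : ∀ i {x y : X} (p : Path x y), (∀ t, p t ∈ U i) → P (.mk p))
    (htrans : ∀ {x y z : X} (p : Path.Homotopic.Quotient x y) (q : Path.Homotopic.Quotient y z),
      P p → P q → P (p.trans q))
    {x y : X} (p : Path.Homotopic.Quotient x y) : P p := by
  induction p using Path.Homotopic.Quotient.ind with
  | mk γ =>
    obtain ⟨t, ht0, htm, ⟨n, hn⟩, ht⟩ := exists_monotone_Icc_subset_open_cover_unitInterval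
      (c := fun i => γ ⁻¹' U i) (fun i => (hU i).preimage γ.continuous)
      (fun s _ => mem_iUnion.2 (hcov (γ s)))
    have key : ∀ n, P (.mk (γ.subpath 0 (t n))) := by
      intro n
      induction n with
      | zero =>
        obtain ⟨i, hi⟩ := hcov (γ 0)
        refine hmem i _ fun s => ?_
        change γ (Icc.convexComb 0 (t 0) s) ∈ U i
        rw [ht0]
        simpa using hi
      | succ n ih =>
        obtain ⟨i, hi⟩ := ht n
        have h1 : P (.mk (γ.subpath (t n) (t (n + 1)))) := by
          refine hmem i _ fun s => ?_
          have : γ.subpath (t n) (t (n + 1)) s ∈ γ '' Icc (t n) (t (n + 1)) := by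
            rw [← Path.range_subpath_of_le _ _ _ (htm n.le_succ)]
            exact mem_range_self s
          obtain ⟨s', hs', hss⟩ := this
          rw [← hss]
          exact hi hs'
        have h2 := htrans _ _ ih h1
        rwa [← Path.Homotopic.Quotient.mk_trans, Path.Homotopic.Quotient.eq.2
          ⟨Path.Homotopy.subpathTransSubpath γ _ _ _⟩] at h2
    have h := key n
    rw [hn n le_rfl, Path.subpath_zero_one] at h
    -- The subpath runs between `γ 0` and `γ 1`, which equal the given endpoints only
    -- propositionally.
    have hcast : ∀ (x' y' : X) (hx : x' = x) (hy : y' = y), P (.mk (γ.cast hx hy)) → P (.mk γ) := by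
      rintro _ _ rfl rfl h
      exact h
    exact hcast _ _ _ _ h

namespace Path.Homotopic.Quotient

variable {X Y : Type*} [TopologicalSpace X] [TopologicalSpace Y]

theorem map_trans {x y z : X} (p : Path.Homotopic.Quotient x y) (q : Path.Homotopic.Quotient y z)
    (f : C(X, Y)) : (p.trans q).map f = (p.map f).trans (q.map f) := by
  induction p using Path.Homotopic.Quotient.ind
  induction q using Path.Homotopic.Quotient.ind
  rw [← mk_trans, ← mk_map, ← mk_map, ← mk_map, ← mk_trans, Path.map_trans]

theorem map_symm {x y : X} (p : Path.Homotopic.Quotient x y)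
    (f : C(X, Y)) : p.symm.map f = (p.map f).symm := by
  induction p using Path.Homotopic.Quotient.ind
  rw [← mk_symm, ← mk_map, ← mk_map, ← mk_symm, Path.map_symm]

/-- The class `p` contains a path that lifts along `pr` to a path from `e` to `e'`. -/
def Lifts (pr : Y → X) {x y : X} (p : Path.Homotopic.Quotient x y) (e e' : Y) : Prop :=
  ∃ ρ : Path x y, mk ρ = p ∧ ∃ c : Path e e', ∀ t, pr (c t) = ρ t

theorem Lifts.trans {pr : Y → X} {x y z : X} {p : Path.Homotopic.Quotient x y}
    {q : Path.Homotopic.Quotient y z} {e e' e'' : Y} (hp : p.Lifts pr e e') (hq : q.Lifts pr e' e'') :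
    (p.trans q).Lifts pr e e'' := by
  obtain ⟨ρ, rfl, c, hc⟩ := hp
  obtain ⟨τ, rfl, d, hd⟩ := hq
  refine ⟨ρ.trans τ, mk_trans _ _, c.trans d, fun t => ?_⟩
  simp only [Path.trans_apply]
  split_ifs
  · exact hc _
  · exact hd _

theorem Lifts.symm {pr : Y → X} {x y : X} {p : Path.Homotopic.Quotient x y} {e e' : Y}
    (hp : p.Lifts pr e e') : p.symm.Lifts pr e' e := by
  obtain ⟨ρ, rfl, c, hc⟩ := hp
  exact ⟨ρ.symm, mk_symm _, c.symm, fun t => hc _⟩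

end Path.Homotopic.Quotient

variable {G : Type u} {M : Type v} [Group G] [TopologicalSpace M] [MulAction G M]

namespace GLoop

open GPath

variable {x₀ : M}

/-- The `G`-loop `(g⁻¹, γ, g')` given by a path `γ` from `g • x₀` to `g' • x₀`. -/
noncomputable def between (g g' : G) (γ : Path (g • x₀) (g' • x₀)) : GLoop G x₀ :=
  GPath.cons g⁻¹ 1 zero_le_one γ.extend γ.continuous_extend.continuousOn (by simp)
    (GPath.last g' rfl (by simp))

theorem between_congr (g g' : G) {γ γ' : Path (g • x₀) (g' • x₀)} (h : γ.Homotopic γ') :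
    Homotopic (between g g' γ) (between g g' γ') := by
  obtain ⟨F⟩ := h
  have hl : ∀ s : I, g' • x₀ = (F.eval s).extend 1 := fun s => by simp
  refine ElementaryHomotopic.homotopic ⟨fun s => between g g' (F.eval s), ?_, by simp, by simp⟩
  refine IsHomotopyFamily.cons g⁻¹ 1 zero_le_one (fun s => (F.eval s).extend) _ _
    (fun s => GPath.last g' rfl (hl s)) ?_ (IsHomotopyFamily.last _ _ _)
  refine Continuous.continuousOn ?_
  have : Continuous fun q : I × ℝ => F (q.1, projIcc 0 1 zero_le_one q.2) := by fun_prop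
  exact this

variable [ContinuousConstSMul G M]

/-- A shift by `g'⁻¹` turns `(g⁻¹, γ, g')` into `(g⁻¹ g', g'⁻¹ γ, 1)`. This normal form reduces
composition and translation of such loops to `comp_ofPath`. -/
theorem between_homotopic_ofPath (g g' k : G) (hk : k = g⁻¹ * g') (γ : Path (g • x₀) (g' • x₀))
    (η : Path (k⁻¹ • x₀) x₀) (hη : ∀ s, η s = g'⁻¹ • γ s) :
    Homotopic (between g g' γ) (ofPath k η) := by
  subst hk
  refine (EquivStep.shift g⁻¹ 1 zero_le_one γ.extend _ _ _ g'⁻¹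
    (γ.continuous_extend.const_smul _).continuousOn (by simp [mul_smul])).homotopic.trans ?_
  have hg : g⁻¹ * g'⁻¹⁻¹ = g⁻¹ * g' := by rw [inv_inv]
  have key : ∀ (k : G) (hk : k = g⁻¹ * g') (h1 : k • g'⁻¹ • γ.extend 0 = x₀) h2 h3 h4 h5,
      Homotopic (GPath.cons k 1 zero_le_one (fun s => g'⁻¹ • γ.extend s) h2 h1
        (GPath.last (g'⁻¹ * g') h3 h4) : GLoop G x₀)
        (GPath.cons (g⁻¹ * g') 1 zero_le_one η.extend η.continuous_extend.continuousOn h5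
          (GPath.last 1 rfl (by simp))) := by
    intro k hk
    subst hk
    intro h1 h2 h3 h4 h5
    refine Homotopic.cons_congr _ _ _ _ _ (fun s hs => ?_) _ _ _ _ ?_
    · simp only [Path.extend_apply _ hs, hη]
    · have : ∀ (k : G) (hk : k = 1) h1 h2,
          (GPath.last k h1 h2 : GPath G 1 x₀ 1 (g'⁻¹ • γ.extend 1)) ≍
            (GPath.last 1 rfl (by simp) : GPath G 1 x₀ 1 (η.extend 1)) := by
        intro k hk
        subst hk
        intro h1 h2
        have h3 : g'⁻¹ • γ.extend 1 = η.extend 1 := by simp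
        rw! [h3]
        rfl
      exact this _ (inv_mul_cancel g') _ _
  exact key _ hg _ _ _ _ _

/-- Every `G`-loop is homotopic to one of the form `(1, γ, g)`. -/
theorem exists_between (p : GLoop G x₀) : ∃ g γ, Homotopic p (between 1 g γ) := by
  obtain ⟨g, γ, hp⟩ := exists_ofPath p
  refine ⟨g, (γ.map (continuous_const_smul g)).cast (by simp) rfl, hp.trans ?_⟩
  exact (between_homotopic_ofPath 1 g g (by simp) _ γ (by simp)).symm

theorem comp_between (g g' g'' : G) (γ : Path (g • x₀) (g' • x₀)) (γ' : Path (g' • x₀) (g'' • x₀)) :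
    Homotopic (comp (between g g' γ) (between g' g'' γ')) (between g g'' (γ.trans γ')) := by
  let α : Path ((g⁻¹ * g')⁻¹ • x₀) x₀ :=
    (γ.map (continuous_const_smul g'⁻¹)).cast (by simp [mul_smul]) (by simp)
  let β : Path ((g'⁻¹ * g'')⁻¹ • x₀) x₀ :=
    (γ'.map (continuous_const_smul g''⁻¹)).cast (by simp [mul_smul]) (by simp)
  let η : Path ((g⁻¹ * g'')⁻¹ • x₀) ((g'⁻¹ * g'')⁻¹ • x₀) :=
    (γ.map (continuous_const_smul g''⁻¹)).cast (by simp [mul_smul]) (by simp [mul_smul])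
  refine (comp_congr (between_homotopic_ofPath g g' _ rfl γ α fun s => rfl)
    (between_homotopic_ofPath g' g'' _ rfl γ' β fun s => rfl)).trans ?_
  refine (comp_ofPath _ _ (g⁻¹ * g'') (by group) α β η fun s => ?_).trans ?_
  · simp [η, α, mul_smul]
  · refine (between_homotopic_ofPath g g'' _ rfl _ (η.trans β) fun s => ?_).symm
    simp only [Path.trans_apply]
    split_ifs <;> rfl

theorem between_refl (g : G) : Homotopic (between g g (Path.refl (g • x₀))) const :=
  (between_homotopic_ofPath g g 1 (by simp) _ ((Path.refl x₀).cast (by simp) rfl)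
    (by simp)).trans const_homotopic.symm

theorem between_smul (h g g' k k' : G) (hk : k = h * g) (hk' : k' = h * g')
    (γ : Path (g • x₀) (g' • x₀)) (γ' : Path (k • x₀) (k' • x₀)) (hγ : ∀ s, γ' s = h • γ s) :
    Homotopic (between k k' γ') (between g g' γ) := by
  let α : Path ((g⁻¹ * g')⁻¹ • x₀) x₀ :=
    (γ.map (continuous_const_smul g'⁻¹)).cast (by simp [mul_smul]) (by simp)
  refine (between_homotopic_ofPath k k' (g⁻¹ * g') (by rw [hk, hk']; group) γ' α fun s => ?_).trans
    (between_homotopic_ofPath g g' _ rfl γ α fun s => rfl).symm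
  simp [α, hγ, hk', mul_smul]

end GLoop

section Continuous

variable [ContinuousConstSMul G M]

/-- The translate of a class of paths by a group element. -/
def Path.Homotopic.Quotient.smul (h : G) {x y : M} (p : Path.Homotopic.Quotient x y) :
    Path.Homotopic.Quotient (h • x) (h • y) :=
  p.map ⟨fun z => h • z, continuous_const_smul h⟩

theorem Path.Homotopic.Quotient.smul_trans (h : G) {x y z : M} (p : Path.Homotopic.Quotient x y)
    (q : Path.Homotopic.Quotient y z) : (p.trans q).smul h = (p.smul h).trans (q.smul h) :=
  map_trans _ _ _

theorem Path.Homotopic.Quotient.Lifts.smul {E : Type w} [TopologicalSpace E] [MulAction G E]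
    [ContinuousConstSMul G E] {pr : E → M} (hpr : ∀ (g : G) (e : E), pr (g • e) = g • pr e) (h : G)
    {x y : M} {p : Path.Homotopic.Quotient x y} {e e' : E} (hp : p.Lifts pr e e') :
    (p.smul h).Lifts pr (h • e) (h • e') := by
  obtain ⟨ρ, rfl, c, hc⟩ := hp
  refine ⟨ρ.map (continuous_const_smul h), rfl, c.map (continuous_const_smul h), fun t => ?_⟩
  simp only [Path.map_coe, Function.comp_apply, hpr, hc]


end Continuous

end Frames

/-! ### Frames: differences, transport and translation -/

section Frames

open Set Topology
open scoped unitInterval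

variable {G : Type u} {M : Type v} [Group G] [TopologicalSpace M] [MulAction G M]

namespace OrbifoldFundamentalGroup

variable {x₀ : M}

/-- The class of the `G`-loops `(g⁻¹, γ, g')` for a class of paths from `g • x₀` to `g' • x₀`. -/
noncomputable def between (g g' : G) (p : Path.Homotopic.Quotient (g • x₀) (g' • x₀)) :
    OrbifoldFundamentalGroup G x₀ :=
  Quotient.lift (fun γ => Quot.mk _ (GLoop.between g g' γ))
    (fun _ _ h => Quot.sound (GLoop.between_congr g g' h)) p

theorem lifts_between {E : Type w} [TopologicalSpace E] [MulAction G E] {pr : E → M} {g g' : G}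
    {p : Path.Homotopic.Quotient (g • x₀) (g' • x₀)} {e e' : E}
    (hp : p.Lifts pr (g • e) (g' • e')) : (between g g' p).Lifts pr e e' := by
  obtain ⟨ρ, rfl, c, hc⟩ := hp
  refine ⟨_, rfl, c.extend, c.continuous_extend.continuousOn, fun t ht => ?_, by simp, by
    simp [GPath.Lifts]⟩
  simp only [Function.comp_apply, Path.extend_apply _ ht, hc]

variable [ContinuousConstSMul G M]

theorem exists_between (α : OrbifoldFundamentalGroup G x₀) : ∃ g p, α = between 1 g p := by
  induction α using Quot.ind with
  | mk ξ =>
    obtain ⟨g, γ, h⟩ := GLoop.exists_between ξ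
    exact ⟨g, .mk γ, Quot.sound h⟩

theorem between_mul (g g' g'' : G) (p : Path.Homotopic.Quotient (g • x₀) (g' • x₀))
    (p' : Path.Homotopic.Quotient (g' • x₀) (g'' • x₀)) :
    between g g' p * between g' g'' p' = between g g'' (p.trans p') := by
  induction p using Path.Homotopic.Quotient.ind
  induction p' using Path.Homotopic.Quotient.ind
  exact Quot.sound (GLoop.comp_between ..)

theorem between_self (g : G) : between g g (.refl (g • x₀)) = 1 :=
  Quot.sound (GLoop.between_refl g)

theorem between_smul (h g g' : G) (p : Path.Homotopic.Quotient (g • x₀) (g' • x₀)) :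
    between (h * g) (h * g') ((p.smul h).cast (mul_smul h g x₀) (mul_smul h g' x₀)) =
      between g g' p := by
  induction p using Path.Homotopic.Quotient.ind with
  | mk γ =>
    exact Quot.sound (GLoop.between_smul h g g' _ _ rfl rfl γ
      ((γ.map (continuous_const_smul h)).cast (mul_smul h g x₀) (mul_smul h g' x₀)) fun s => rfl)

end OrbifoldFundamentalGroup

/-- A frame at `z` is a homotopy class of paths from `z` to a translate of the base point. -/
structure OrbifoldFrame (G : Type u) {M : Type v} [Group G] [TopologicalSpace M] [MulAction G M]
    (x₀ z : M) where
  /-- the translate of the base point -/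
  elt : G
  /-- the class of paths -/
  path : Path.Homotopic.Quotient z (elt • x₀)

namespace OrbifoldFrame

variable {x₀ y z w : M}

/-- The difference of two frames. -/
noncomputable def diff (f f' : OrbifoldFrame G x₀ z) : OrbifoldFundamentalGroup G x₀ :=
  .between f.elt f'.elt (f.path.symm.trans f'.path)

/-- The frame obtained by precomposition with a class of paths. -/
noncomputable def transport (p : Path.Homotopic.Quotient y z) (f : OrbifoldFrame G x₀ z) :
    OrbifoldFrame G x₀ y :=
  ⟨f.elt, p.trans f.path⟩

theorem transport_trans (p : Path.Homotopic.Quotient y z) (q : Path.Homotopic.Quotient z w)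
    (f : OrbifoldFrame G x₀ w) : f.transport (p.trans q) = (f.transport q).transport p := by
  simp [transport, Path.Homotopic.Quotient.trans_assoc]

theorem transport_refl (f : OrbifoldFrame G x₀ z) : f.transport (.refl z) = f := by
  simp [transport]

/-- A frame lifts to a path from `e` to a translate of `e'`. -/
def Lifts {E : Type w} [TopologicalSpace E] [MulAction G E] (pr : E → M)
    (f : OrbifoldFrame G x₀ z) (e e' : E) : Prop :=
  f.path.Lifts pr e (f.elt • e')

section Lifts

variable {E : Type w} [TopologicalSpace E] [MulAction G E] {pr : E → M}

theorem Lifts.diff {f f' : OrbifoldFrame G x₀ z} {e e₁ e₂ : E} (h : f.Lifts pr e e₁)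
    (h' : f'.Lifts pr e e₂) : (f.diff f').Lifts pr e₁ e₂ :=
  OrbifoldFundamentalGroup.lifts_between (Path.Homotopic.Quotient.Lifts.trans h.symm h')

theorem Lifts.transport {p : Path.Homotopic.Quotient y z} {f : OrbifoldFrame G x₀ z} {e e₁ e₂ : E}
    (hp : p.Lifts pr e e₁) (h : f.Lifts pr e₁ e₂) : (f.transport p).Lifts pr e e₂ :=
  hp.trans h

end Lifts

/-- Path lifting along a representative of the frame carries the fibre over `z` to the fibre over
the translated base point, and the group element of the frame brings it back to the fibre over `x₀`.
Unique lifting read backwards gives injectivity. -/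
theorem exists_lifts {E : Type w} [TopologicalSpace E] [MulAction G E] {pr : E → M}
    (cov : IsCoveringMap pr) (hpr : ∀ (g : G) (e : E), pr (g • e) = g • pr e)
    (f : OrbifoldFrame G x₀ z) : ∃ φ : {e // pr e = z} → E, Function.Injective φ ∧
      ∀ e : {e // pr e = z}, f.Lifts pr e (φ e) ∧ pr (φ e) = x₀ := by
  obtain ⟨k, p⟩ := f
  induction p using Path.Homotopic.Quotient.ind with
  | mk γ =>
    have h0 : ∀ e : {e // pr e = z}, γ.toContinuousMap 0 = pr e := fun e => by simp [e.2]
    let L := fun e => cov.liftPath γ.toContinuousMap e.1 (h0 e)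
    have hL : ∀ e t, pr (L e t) = γ t := fun e => congr_fun (cov.liftPath_lifts _ _ (h0 e))
    have hL0 : ∀ e, L e 0 = e.1 := fun e => cov.liftPath_zero _ _ (h0 e)
    refine ⟨fun e => k⁻¹ • L e 1, fun e e' h => ?_, fun e => ⟨⟨γ, rfl,
      ⟨L e, hL0 e, (smul_inv_smul _ _).symm⟩, fun t => hL e t⟩, ?_⟩⟩
    · have := cov.eq_of_comp_eq (L e).continuous (L e').continuous
        (funext fun t => (hL e t).trans (hL e' t).symm) 1 (smul_left_cancel _ h)
      exact Subtype.ext (by rw [← hL0, ← hL0, this])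
    · simp [hpr, hL]

/-- The common initial path is run backwards and then forwards, so it cancels. -/
theorem diff_transport (p : Path.Homotopic.Quotient y z) (f f' : OrbifoldFrame G x₀ z) :
    (f.transport p).diff (f'.transport p) = f.diff f' := by
  have : ∀ (a b : M) (q : Path.Homotopic.Quotient z a) (r : Path.Homotopic.Quotient z b),
      (p.trans q).symm.trans (p.trans r) = q.symm.trans r := by
    intro a b q r
    have h : (p.trans q).symm = q.symm.trans p.symm := by
      induction p using Path.Homotopic.Quotient.ind
      induction q using Path.Homotopic.Quotient.ind
      rw [← Path.Homotopic.Quotient.mk_trans, ← Path.Homotopic.Quotient.mk_symm, Path.trans_symm]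
      rfl
    rw [h, Path.Homotopic.Quotient.trans_assoc, ← Path.Homotopic.Quotient.trans_assoc p.symm]
    simp
  simp only [diff, transport, this]

variable [ContinuousConstSMul G M]

/-- The translate of a frame. -/
noncomputable def translate (h : G) (hz : h • z = w) (f : OrbifoldFrame G x₀ z) :
    OrbifoldFrame G x₀ w :=
  ⟨h * f.elt, (f.path.smul h).cast hz.symm (mul_smul h f.elt x₀)⟩

theorem Lifts.translate {E : Type w} [TopologicalSpace E] [MulAction G E] {pr : E → M}
    [ContinuousConstSMul G E] (hpr : ∀ (g : G) (e : E), pr (g • e) = g • pr e) (h : G)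
    {z' : M} (hz : h • z = z') {f : OrbifoldFrame G x₀ z} {e e' : E} (hf : f.Lifts pr e e') :
    (f.translate h hz).Lifts pr (h • e) e' := by
  subst hz
  have key : ∀ (y : M) (hy : y = h • f.elt • x₀) (k : G) (hk : k = h * f.elt),
      ((f.path.smul h).cast rfl hy).Lifts pr (h • e) (k • e') := by
    rintro _ rfl _ rfl
    rw [mul_smul, Path.Homotopic.Quotient.cast_rfl_rfl]
    exact Path.Homotopic.Quotient.Lifts.smul hpr h hf
  exact key _ _ _ rfl

theorem translate_one (f : OrbifoldFrame G x₀ z) : f.translate 1 (one_smul G z) = f := by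
  obtain ⟨k, p⟩ := f
  induction p using Path.Homotopic.Quotient.ind with
  | mk γ =>
    have : ∀ (k' : G) (hk : k' = k) (γ' : Path z (k' • x₀)), (∀ t, γ' t = γ t) →
        (⟨k', .mk γ'⟩ : OrbifoldFrame G x₀ z) = ⟨k, .mk γ⟩ := by
      rintro _ rfl γ' h
      rw [Path.ext (funext h)]
    exact this _ (one_mul k) ((γ.map (continuous_const_smul 1)).cast (one_smul G z).symm
      (mul_smul 1 k x₀)) fun t => one_smul G _

theorem translate_translate (h h' : G) {z' z'' : M} (hz : h • z = z') (hz' : h' • z' = z'')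
    (f : OrbifoldFrame G x₀ z) : (f.translate h hz).translate h' hz' =
      f.translate (h' * h) (by rw [mul_smul, hz, hz']) := by
  subst hz hz'
  obtain ⟨k, p⟩ := f
  induction p using Path.Homotopic.Quotient.ind with
  | mk γ =>
    have : ∀ (a b : G) (hk : a = b) (γ₁ : Path (h' • h • z) (a • x₀))
        (γ₂ : Path (h' • h • z) (b • x₀)), (∀ t, γ₁ t = γ₂ t) →
        (⟨a, .mk γ₁⟩ : OrbifoldFrame G x₀ _) = ⟨b, .mk γ₂⟩ := by
      rintro _ _ rfl γ₁ γ₂ h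
      rw [Path.ext (funext h)]
    exact this _ _ (mul_assoc _ _ _).symm
      ((((γ.map (continuous_const_smul h)).cast rfl (mul_smul h k x₀)).map
        (continuous_const_smul h')).cast rfl (mul_smul h' _ x₀))
      ((γ.map (continuous_const_smul (h' * h))).cast (mul_smul h' h z).symm (mul_smul _ k x₀))
      fun t => (mul_smul h' h _).symm

theorem diff_mul (f f' f'' : OrbifoldFrame G x₀ z) : f.diff f' * f'.diff f'' = f.diff f'' := by
  rw [diff, diff, OrbifoldFundamentalGroup.between_mul, diff]
  congr 1
  rw [Path.Homotopic.Quotient.trans_assoc, ← Path.Homotopic.Quotient.trans_assoc f'.path]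
  simp

theorem diff_self (f : OrbifoldFrame G x₀ z) : f.diff f = 1 := by
  rw [diff, Path.Homotopic.Quotient.symm_trans, OrbifoldFundamentalGroup.between_self]

theorem diff_inv (f f' : OrbifoldFrame G x₀ z) : (f.diff f')⁻¹ = f'.diff f :=
  inv_eq_of_mul_eq_one_right (by rw [diff_mul, diff_self])

theorem diff_translate (h : G) (hz : h • z = w) (f f' : OrbifoldFrame G x₀ z) :
    (f.translate h hz).diff (f'.translate h hz) = f.diff f' := by
  subst hz
  have : ∀ (a b a' b' : M) (ha : a' = h • a) (hb : b' = h • b) (q : Path.Homotopic.Quotient z a)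
      (r : Path.Homotopic.Quotient z b),
      (((q.smul h).cast rfl ha).symm.trans ((r.smul h).cast rfl hb)) =
        ((q.symm.trans r).smul h).cast ha hb := by
    rintro a b _ _ rfl rfl q r
    simp only [Path.Homotopic.Quotient.cast_rfl_rfl]
    rw [Path.Homotopic.Quotient.smul_trans]
    congr 1
    exact (Path.Homotopic.Quotient.map_symm _ _).symm
  exact (congrArg (OrbifoldFundamentalGroup.between _ _) (this _ _ _ _ _ _ _ _)).trans
    (OrbifoldFundamentalGroup.between_smul h _ _ _)

theorem transport_translate (h : G) (p : Path.Homotopic.Quotient y z) (f : OrbifoldFrame G x₀ z) :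
    (f.transport p).translate h rfl = (f.translate h rfl).transport (p.smul h) := by
  have : ∀ (a a' : M) (ha : a' = h • a) (q : Path.Homotopic.Quotient z a),
      ((p.trans q).smul h).cast rfl ha = (p.smul h).trans ((q.smul h).cast rfl ha) := by
    rintro a _ rfl q
    simp only [Path.Homotopic.Quotient.cast_rfl_rfl]
    exact Path.Homotopic.Quotient.smul_trans _ _ _
  exact congrArg (OrbifoldFrame.mk (h * f.elt)) (this _ _ _ _)

/-- Represent `α` by a path starting at `x₀`, translate it by the group element of `f`, and append
it to the path of `f`. -/
theorem exists_diff_eq (f : OrbifoldFrame G x₀ z) (α : OrbifoldFundamentalGroup G x₀) :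
    ∃ f' : OrbifoldFrame G x₀ z, f.diff f' = α := by
  obtain ⟨g, p, hp⟩ := α.exists_between
  have key : ∀ (k : G) (hk : k = f.elt) (g' : G)
      (r : Path.Homotopic.Quotient (k • x₀) (g' • x₀)),
      ∃ f' : OrbifoldFrame G x₀ z, f.diff f' = .between k g' r := by
    rintro _ rfl g' r
    refine ⟨⟨g', f.path.trans r⟩, ?_⟩
    rw [diff, ← Path.Homotopic.Quotient.trans_assoc, Path.Homotopic.Quotient.symm_trans,
      Path.Homotopic.Quotient.refl_trans]
  rw [hp, ← OrbifoldFundamentalGroup.between_smul f.elt]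
  exact key _ (mul_one _) _ _

/-- Translating `f` makes the group elements agree; the two paths then end at the same point, and
the required class goes along one and back along the other. Thus every loop becomes a path between a
point and its translate, ready for subdivision. -/
theorem exists_eq_transport (f : OrbifoldFrame G x₀ z) (f' : OrbifoldFrame G x₀ w) :
    ∃ (g : G) (p : Path.Homotopic.Quotient w (g • z)), f' = (f.translate g rfl).transport p := by
  refine ⟨f'.elt * f.elt⁻¹, ?_⟩
  have key : ∀ (y : M) (k : OrbifoldFrame G x₀ y), k.elt = f'.elt →
      ∃ p : Path.Homotopic.Quotient w y, f' = k.transport p := by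
    rintro y ⟨k, q⟩ hk
    obtain ⟨k', q'⟩ := f'
    obtain rfl : k = k' := hk
    refine ⟨q'.trans q.symm, ?_⟩
    simp only [transport, Path.Homotopic.Quotient.trans_assoc,
      Path.Homotopic.Quotient.symm_trans, Path.Homotopic.Quotient.trans_refl]
  exact key _ _ (inv_mul_cancel_right _ _)

end OrbifoldFrame

end Frames

/-! ### Path classes inside simply connected sets -/

section PathIn

open Set Topology
open scoped unitInterval

variable {X : Type*} [TopologicalSpace X] {U : Set X}

/-- The class of the paths from `x` to `y` inside a simply connected set. -/
noncomputable def IsSimplyConnected.path (hU : IsSimplyConnected U) {x y : X} (hx : x ∈ U)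
    (hy : y ∈ U) : Path.Homotopic.Quotient x y :=
  .mk (hU.isPathConnected.joinedIn x hx y hy).somePath

theorem IsSimplyConnected.mk_eq_path (hU : IsSimplyConnected U) {x y : X} (ρ : Path x y)
    (hρ : ∀ t, ρ t ∈ U) :
    .mk ρ = hU.path (by simpa using hρ 0) (by simpa using hρ 1) := by
  have := hU.simplyConnectedSpace
  have key : ∀ ρ' : Path x y, (∀ t, ρ' t ∈ U) → ρ.Homotopic ρ' := by
    intro ρ' hρ'
    let a : U := ⟨x, by simpa using hρ 0⟩
    let b : U := ⟨y, by simpa using hρ 1⟩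
    let p : Path a b := ⟨⟨fun t => ⟨ρ t, hρ t⟩, by fun_prop⟩, by simp [a], by simp [b]⟩
    let p' : Path a b := ⟨⟨fun t => ⟨ρ' t, hρ' t⟩, by fun_prop⟩, by simp [a], by simp [b]⟩
    exact (SimplyConnectedSpace.paths_homotopic p p').map ⟨_, continuous_subtype_val⟩
  exact Path.Homotopic.Quotient.eq.2 (key _ (JoinedIn.somePath_mem _))

theorem IsSimplyConnected.exists_path (hU : IsSimplyConnected U) {x y : X} (hx : x ∈ U)
    (hy : y ∈ U) : ∃ ρ : Path x y, (∀ t, ρ t ∈ U) ∧ hU.path hx hy = .mk ρ :=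
  ⟨_, JoinedIn.somePath_mem _, rfl⟩

theorem IsSimplyConnected.path_trans (hU : IsSimplyConnected U) {x y z : X} (hx : x ∈ U)
    (hy : y ∈ U) (hz : z ∈ U) : (hU.path hx hy).trans (hU.path hy hz) = hU.path hx hz := by
  obtain ⟨ρ, hρ, h⟩ := hU.exists_path hx hy
  obtain ⟨ρ', hρ', h'⟩ := hU.exists_path hy hz
  rw [h, h', ← Path.Homotopic.Quotient.mk_trans]
  refine hU.mk_eq_path _ fun t => ?_
  rw [Path.trans_apply]
  split_ifs
  exacts [hρ _, hρ' _]

theorem IsSimplyConnected.path_self (hU : IsSimplyConnected U) {x : X} (hx : x ∈ U) :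
    hU.path hx hx = .refl x :=
  (hU.mk_eq_path (Path.refl x) fun _ => hx).symm

/-- A path inside `W` represents both classes. Only connectedness of `W` matters, which is why the
overlaps in an atlas need not be simply connected. -/
theorem IsSimplyConnected.path_congr {V W : Set X} (hU : IsSimplyConnected U)
    (hV : IsSimplyConnected V) (hW : IsPathConnected W) (hWU : W ⊆ U) (hWV : W ⊆ V) {x y : X}
    (hx : x ∈ W) (hy : y ∈ W) :
    hU.path (hWU hx) (hWU hy) = hV.path (hWV hx) (hWV hy) := by
  have h := hW.joinedIn x hx y hy
  exact (hU.mk_eq_path h.somePath fun t => hWU (h.somePath_mem t)).symm.trans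
    (hV.mk_eq_path h.somePath fun t => hWV (h.somePath_mem t))

end PathIn

/-! ### Orbifold atlases whose nerve is a graph -/

section Atlas

open Set Topology Monoid
open scoped unitInterval

/-- The kinds of pieces of an orbifold atlas. -/
inductive OrbifoldAtlas.Piece (J N : Type*)
  | disk
  | cut (j : J)
  | cone (ν : N)

open OrbifoldAtlas (Piece)

/-- An orbifold atlas for the action of a free product `Γ` of groups `A ν` on a space: the
translates of a simply connected set `disk`, of simply connected sets `cut j` that meet `disk` in
two path connected sets, and of simply connected sets `cone ν` that meet `disk` in one path
connected set and are invariant under `A ν`. There are no further intersections outside of the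
translates of `disk`. -/
structure OrbifoldAtlas {N : Type t} (J : Type w) (A : N → Type u) [∀ ν, Group (A ν)] (M : Type v)
    [TopologicalSpace M] [MulAction (CoprodI A) M] where
  /-- the open sets whose translates cover the space -/
  piece : Piece J N → Set M
  isOpen_piece : ∀ p, IsOpen (piece p)
  simplyConnected : ∀ p, IsSimplyConnected (piece p)
  /-- one of the components of the intersection of a cut with the disk -/
  left : J → Set M
  /-- the other component of the intersection of a cut with the disk -/
  right : J → Set M
  isOpen_left : ∀ j, IsOpen (left j)
  isOpen_right : ∀ j, IsOpen (right j)
  isPathConnected_left : ∀ j, IsPathConnected (left j)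
  isPathConnected_right : ∀ j, IsPathConnected (right j)
  disjoint_left_right : ∀ j, Disjoint (left j) (right j)
  cut_inter_disk : ∀ j, piece (.cut j) ∩ piece .disk = left j ∪ right j
  isPathConnected_cone : ∀ ν, IsPathConnected (piece (.cone ν) ∩ piece .disk)
  smul_mem_cone : ∀ ν (a : A ν) x, x ∈ piece (.cone ν) → (CoprodI.of a : CoprodI A) • x ∈ piece (.cone ν)
  /-- the group element of a translate that contains a given point -/
  label : M → CoprodI A
  -- On translates of the disk and of the cuts the label is forced, so translates of any one of
  -- these pieces by different elements are disjoint. On a translate of a cone it is determined only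
  -- up to right multiplication by `A ν`.
  label_disk : ∀ γ x, γ • x ∈ piece .disk → label x = γ⁻¹
  label_cut : ∀ j γ x, γ • x ∈ piece (.cut j) → label x = γ⁻¹
  label_cone : ∀ ν γ x, γ • x ∈ piece (.cone ν) → ∃ a : A ν, label x = γ⁻¹ * CoprodI.of a
  exists_mem_piece : ∀ x, ∃ p, (label x)⁻¹ • x ∈ piece p
  cut_inter_cut : ∀ i j, i ≠ j → piece (.cut i) ∩ piece (.cut j) ⊆ piece .disk
  cut_inter_cone : ∀ j ν, piece (.cut j) ∩ piece (.cone ν) ⊆ piece .disk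
  cone_inter_cone : ∀ ν ν' (γ : CoprodI A) x, x ∈ piece (.cone ν) → γ • x ∈ piece (.cone ν') → ν = ν'

namespace OrbifoldAtlas

variable {N : Type t} {J : Type w} {A : N → Type u} [∀ ν, Group (A ν)] {M : Type v}
  [TopologicalSpace M] [MulAction (CoprodI A) M] (S : OrbifoldAtlas J A M)

/-- The translate of a piece with a given index. -/
def chart (i : CoprodI A × Piece J N) : Set M := {x | i.1⁻¹ • x ∈ S.piece i.2}

theorem smul_mem_chart (g γ : CoprodI A) (p : Piece J N) (x : M) (hx : x ∈ S.chart (γ, p)) :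
    g • x ∈ S.chart (g * γ, p) := by
  simpa [chart, mul_smul] using hx

/-- The factor that compares the coordinates over a chart with those over the translates of the
disk. -/
noncomputable def factor (i : CoprodI A × Piece J N) (x : M) :
    Monoid.Coprod (FreeGroup J) (CoprodI A) :=
  open Classical in
  match i with
  | (_, .disk) => 1
  | (γ, .cut j) => if γ⁻¹ • x ∈ S.right j then Coprod.inl (FreeGroup.of j) else 1
  | (γ, .cone _) => Coprod.inr (γ⁻¹ * S.label x)

/-- The index of a chart that contains a given point. -/
noncomputable def index (x : M) : CoprodI A × Piece J N :=
  (S.label x, (S.exists_mem_piece x).choose)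

theorem mem_chart_index (x : M) : x ∈ S.chart (S.index x) := (S.exists_mem_piece x).choose_spec

/-- The transition function between two charts. -/
noncomputable def transition (i j : CoprodI A × Piece J N) (x : M) :
    Monoid.Coprod (FreeGroup J) (CoprodI A) :=
  S.factor i x * (S.factor j x)⁻¹

/-- A point of two charts that is not in a translate of the disk. -/
theorem eq_or_cone {γ γ' : CoprodI A} {p p' : Piece J N} {x : M} (hx : x ∈ S.chart (γ, p))
    (hx' : x ∈ S.chart (γ', p')) (h : ∀ δ, x ∉ S.chart (δ, .disk)) :
    (γ = γ' ∧ p = p') ∨ ∃ ν, ∃ a : A ν, p = .cone ν ∧ p' = .cone ν ∧ γ' = γ * CoprodI.of a := by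
  simp only [chart, mem_ofPred_eq] at hx hx' h
  cases p with
  | disk => exact absurd hx (h γ)
  | cut j =>
    have hl := S.label_cut _ _ _ hx
    cases p' with
    | disk => exact absurd hx' (h γ')
    | cut j' =>
      have hl' := S.label_cut _ _ _ hx'
      rw [inv_inv] at hl hl'
      have hγ : γ = γ' := hl.symm.trans hl'
      subst hγ
      by_cases hj : j = j'
      · exact Or.inl ⟨rfl, by rw [hj]⟩
      · exact absurd (S.cut_inter_cut _ _ hj ⟨hx, hx'⟩) (h _)
    | cone ν =>
      obtain ⟨a, ha⟩ := S.label_cone _ _ _ hx'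
      rw [hl, inv_inv, inv_inv] at ha
      have : γ⁻¹ • x ∈ S.piece (.cone ν) := by
        have := S.smul_mem_cone ν a⁻¹ _ hx'
        rwa [map_inv, ← mul_smul, ← mul_inv_rev, ← ha] at this
      exact absurd (S.cut_inter_cone _ _ ⟨hx, this⟩) (h _)
  | cone ν =>
    obtain ⟨a, ha⟩ := S.label_cone _ _ _ hx
    cases p' with
    | disk => exact absurd hx' (h γ')
    | cut j =>
      have hl := S.label_cut _ _ _ hx'
      rw [hl, inv_inv, inv_inv] at ha
      have : γ'⁻¹ • x ∈ S.piece (.cone ν) := by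
        have := S.smul_mem_cone ν a⁻¹ _ hx
        rwa [map_inv, ← mul_smul, ← mul_inv_rev, ← ha] at this
      exact absurd (S.cut_inter_cone _ _ ⟨hx', this⟩) (h _)
    | cone ν' =>
      have hν : ν = ν' := S.cone_inter_cone ν ν' (γ'⁻¹ * γ) _ hx (by simpa [mul_smul] using hx')
      subst hν
      obtain ⟨a', ha'⟩ := S.label_cone _ _ _ hx'
      refine Or.inr ⟨ν, a * a'⁻¹, rfl, rfl, ?_⟩
      rw [inv_inv] at ha ha'
      rw [map_mul, ← mul_assoc, ← ha, ha', map_inv, mul_inv_cancel_right]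

/-- The label cancels. This matters off the translates of the disk, where the label may jump within
a coset of `A ν`. -/
theorem transition_cone (γ γ' : CoprodI A) (ν : N) (x : M) :
    S.transition (γ, .cone ν) (γ', .cone ν) x = Coprod.inr (γ⁻¹ * γ') := by
  simp only [transition, factor, ← map_inv, ← map_mul]
  congr 1
  group

theorem transition_self (i : CoprodI A × Piece J N) (x : M) : S.transition i i x = 1 :=
  mul_inv_cancel _

theorem transition_mul (i j k : CoprodI A × Piece J N) (x : M) :
    S.transition i j x * S.transition j k x = S.transition i k x := by
  simp [transition]

/-- Membership in a translate of the disk is needed because only there is the label known to be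
equivariant; elsewhere on a cone it is arbitrary within a coset of `A ν`. -/
theorem factor_smul {δ : CoprodI A} {x : M} (hδ : x ∈ S.chart (δ, .disk)) (g γ : CoprodI A)
    (p : Piece J N) : S.factor (g * γ, p) (g • x) = S.factor (γ, p) x := by
  cases p with
  | disk => rfl
  | cut j =>
    have : (g * γ)⁻¹ • g • x = γ⁻¹ • x := by simp [mul_smul]
    by_cases h : γ⁻¹ • x ∈ S.right j
    · have h' : (g * γ)⁻¹ • g • x ∈ S.right j := by rwa [this]
      simp only [factor, if_pos h, if_pos h']
    · have h' : (g * γ)⁻¹ • g • x ∉ S.right j := by rwa [this]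
      simp only [factor, if_neg h, if_neg h']
  | cone ν =>
    have h1 := S.label_disk _ _ hδ
    have h2 := S.label_disk _ _ (S.smul_mem_chart g _ _ _ hδ)
    simp only [factor]
    simp only at h1 h2
    rw [h1, h2]
    congr 1
    group

/-- This invariance is what lets `Γ` act on the covering space. On translates of the disk each
factor is invariant; elsewhere the two charts are equal or belong to one cone, and no label
survives. -/
theorem transition_smul (g : CoprodI A) {γ γ' : CoprodI A} {p p' : Piece J N} {x : M}
    (hx : x ∈ S.chart (γ, p)) (hx' : x ∈ S.chart (γ', p')) :
    S.transition (g * γ, p) (g * γ', p') (g • x) = S.transition (γ, p) (γ', p') x := by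
  by_cases h : ∃ δ, x ∈ S.chart (δ, .disk)
  · obtain ⟨δ, hδ⟩ := h
    rw [transition, transition, S.factor_smul hδ, S.factor_smul hδ]
  · rcases S.eq_or_cone hx hx' (not_exists.1 h) with ⟨rfl, rfl⟩ | ⟨ν, a, rfl, rfl, rfl⟩
    · rw [transition_self, transition_self]
    · rw [transition_cone, transition_cone]
      congr 1
      group

variable [ContinuousConstSMul (CoprodI A) M]

theorem isOpen_chart (i : CoprodI A × Piece J N) : IsOpen (S.chart i) :=
  (S.isOpen_piece i.2).preimage (continuous_const_smul i.1⁻¹)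

/-- The two sides of a cut are disjoint and open, and the label is constant on the open translate of
the disk. -/
theorem eventually_factor_eq {δ γ : CoprodI A} {p : Piece J N} {x : M}
    (hδ : x ∈ S.chart (δ, .disk)) (hx : x ∈ S.chart (γ, p)) :
    ∀ᶠ y in 𝓝 x, S.factor (γ, p) y = S.factor (γ, p) x := by
  cases p with
  | disk => exact Filter.Eventually.of_forall fun _ => rfl
  | cut j =>
    have h1 : δ = γ := by simpa using (S.label_disk _ _ hδ).symm.trans (S.label_cut _ _ _ hx)
    subst h1
    have hc : Continuous fun y : M => δ⁻¹ • y := continuous_const_smul _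
    have h2 : δ⁻¹ • x ∈ S.left j ∪ S.right j := by
      rw [← S.cut_inter_disk]
      exact ⟨hx, hδ⟩
    have h3 := disjoint_left.1 (S.disjoint_left_right j)
    rcases h2 with h2 | h2
    · filter_upwards [hc.continuousAt.eventually ((S.isOpen_left j).mem_nhds h2)] with y hy
      have hy' : δ⁻¹ • y ∈ S.left j := hy
      simp only [factor, if_neg (h3 h2), if_neg (h3 hy')]
    · filter_upwards [hc.continuousAt.eventually ((S.isOpen_right j).mem_nhds h2)] with y hy
      have hy' : δ⁻¹ • y ∈ S.right j := hy
      simp only [factor, if_pos h2, if_pos hy']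
  | cone ν =>
    filter_upwards [(S.isOpen_chart _).mem_nhds hδ] with y hy
    simp only [factor]
    rw [S.label_disk _ _ hδ, S.label_disk _ _ hy]

theorem eventually_transition_eq {i j : CoprodI A × Piece J N} {x : M}
    (hx : x ∈ S.chart i) (hx' : x ∈ S.chart j) :
    ∀ᶠ y in 𝓝 x, S.transition i j y = S.transition i j x := by
  obtain ⟨γ, p⟩ := i
  obtain ⟨γ', p'⟩ := j
  by_cases h : ∃ δ, x ∈ S.chart (δ, .disk)
  · obtain ⟨δ, hδ⟩ := h
    filter_upwards [S.eventually_factor_eq hδ hx, S.eventually_factor_eq hδ hx'] with y hy hy'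
    rw [transition, transition, hy, hy']
  · rcases S.eq_or_cone hx hx' (not_exists.1 h) with ⟨rfl, rfl⟩ | ⟨ν, a, rfl, rfl, rfl⟩
    · simp [transition_self]
    · simp [transition_cone]

/-! #### The covering space of an orbifold atlas -/

section Covering

variable [TopologicalSpace (Monoid.Coprod (FreeGroup J) (CoprodI A))]
  [DiscreteTopology (Monoid.Coprod (FreeGroup J) (CoprodI A))]

/-- The fiber bundle with the discrete fiber `F * Γ` that is glued by the transition functions. -/
noncomputable def core : FiberBundleCore (CoprodI A × Piece J N) M
    (Monoid.Coprod (FreeGroup J) (CoprodI A)) where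
  baseSet := S.chart
  isOpen_baseSet := S.isOpen_chart
  indexAt := S.index
  mem_baseSet_at := S.mem_chart_index
  -- Coordinates change by multiplication on the right, and this produces the monodromy by right
  -- multiplication.
  coordChange i j x h := h * S.transition i j x
  coordChange_self i x _ h := by rw [transition_self, mul_one]
  continuousOn_coordChange i j := by
    have h1 : ContinuousOn (S.transition i j) (S.chart i ∩ S.chart j) := fun x hx =>
      (tendsto_nhds_of_eventually_eq (S.eventually_transition_eq hx.1 hx.2)).mono_left
        nhdsWithin_le_nhds
    have h2 : Continuous fun q : Monoid.Coprod (FreeGroup J) (CoprodI A) ×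
      Monoid.Coprod (FreeGroup J) (CoprodI A) => q.1 * q.2 := continuous_of_discreteTopology
    exact h2.comp_continuousOn (continuousOn_snd.prodMk
      (h1.comp continuousOn_fst fun q hq => hq.1))
  coordChange_comp i j k x _ h := by rw [mul_assoc, transition_mul]

/-- The point of the covering space with given coordinates. -/
noncomputable def point (i : CoprodI A × Piece J N) (x : M)
    (h : Monoid.Coprod (FreeGroup J) (CoprodI A)) : S.core.TotalSpace :=
  ⟨x, (h * S.transition i (S.index x) x : Monoid.Coprod (FreeGroup J) (CoprodI A))⟩

/-- The coordinate of a point of the covering space with respect to the chart at that point. -/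
def coord (e : S.core.TotalSpace) : Monoid.Coprod (FreeGroup J) (CoprodI A) := e.2

theorem proj_point (i : CoprodI A × Piece J N) (x : M)
    (h : Monoid.Coprod (FreeGroup J) (CoprodI A)) : (S.point i x h).proj = x := rfl

theorem coord_point (i : CoprodI A × Piece J N) (x : M)
    (h : Monoid.Coprod (FreeGroup J) (CoprodI A)) :
    S.coord (S.point i x h) = h * S.transition i (S.index x) x := rfl

theorem point_change (i j : CoprodI A × Piece J N) (x : M)
    (h : Monoid.Coprod (FreeGroup J) (CoprodI A)) :
    S.point i x h = S.point j x (h * S.transition i j x) := by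
  simp only [point, mul_assoc, transition_mul]

theorem point_injective (i : CoprodI A × Piece J N) (x : M) :
    Function.Injective (S.point i x) := by
  intro h h' heq
  have := congrArg S.coord heq
  rw [coord_point, coord_point] at this
  exact mul_right_cancel this

theorem eq_point (e : S.core.TotalSpace) : e = S.point (S.index e.proj) e.proj (S.coord e) := by
  have : S.coord e = S.coord e * S.transition (S.index e.proj) (S.index e.proj) e.proj := by
    rw [transition_self, mul_one]
  exact congrArg (Bundle.TotalSpace.mk e.proj) this

theorem continuousOn_point (i : CoprodI A × Piece J N) :
    ContinuousOn (fun q : M × Monoid.Coprod (FreeGroup J) (CoprodI A) => S.point i q.1 q.2)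
      (S.chart i ×ˢ univ) :=
  (S.core.localTriv i).continuousOn_invFun

/-- An element of `Γ` moves a chart to its translate and keeps the coordinate. The definition uses
the chart selected at the point; `smul_point` shows that every chart gives the same result. -/
noncomputable instance : SMul (CoprodI A) S.core.TotalSpace where
  smul g e := S.point (g * (S.index e.proj).1, (S.index e.proj).2) (g • e.proj) (S.coord e)

theorem smul_def (g : CoprodI A) (e : S.core.TotalSpace) : g • e =
    S.point (g * (S.index e.proj).1, (S.index e.proj).2) (g • e.proj) (S.coord e) := rfl

theorem smul_point (g γ : CoprodI A) (p : Piece J N) {x : M} (hx : x ∈ S.chart (γ, p))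
    (h : Monoid.Coprod (FreeGroup J) (CoprodI A)) :
    g • S.point (γ, p) x h = S.point (g * γ, p) (g • x) h := by
  rw [smul_def, proj_point, coord_point,
    S.point_change (g * γ, p) (g * (S.index x).1, (S.index x).2),
    S.transition_smul g hx (γ' := (S.index x).1) (p' := (S.index x).2) (S.mem_chart_index x)]

noncomputable instance : MulAction (CoprodI A) S.core.TotalSpace where
  one_smul e := by
    have := S.smul_point 1 (S.index e.proj).1 (S.index e.proj).2
      (S.mem_chart_index e.proj) (S.coord e)
    rw [one_mul, one_smul, Prod.mk.eta, ← eq_point] at this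
    exact this
  mul_smul g g' e := by
    rw [S.smul_def g', S.smul_def,
      S.smul_point g (g' * (S.index e.proj).1) (S.index e.proj).2
        (S.smul_mem_chart g' _ _ _ (S.mem_chart_index e.proj)), mul_assoc, mul_smul]

theorem proj_smul (g : CoprodI A) (e : S.core.TotalSpace) :
    S.core.proj (g • e) = g • S.core.proj e := rfl

instance : ContinuousConstSMul (CoprodI A) S.core.TotalSpace where
  continuous_const_smul g := by
    refine continuous_iff_continuousAt.2 fun e => ?_
    obtain ⟨⟨γ, p⟩, he⟩ : ∃ i, e.proj ∈ S.chart i := ⟨_, S.mem_chart_index e.proj⟩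
    have h1 := (S.core.localTriv (γ, p)).continuousOn_toFun
    have h2 : ContinuousOn (fun e' : S.core.TotalSpace => S.point (g * γ, p)
        (g • (S.core.localTriv (γ, p) e').1) (S.core.localTriv (γ, p) e').2)
        (S.core.localTriv (γ, p)).source :=
      (S.continuousOn_point (g * γ, p)).comp
        ((h1.fst.const_smul g).prodMk h1.snd) fun e' he' =>
          ⟨S.smul_mem_chart g _ _ _ he', trivial⟩
    refine (h2.congr fun e' he' => ?_).continuousAt
      ((S.core.localTriv (γ, p)).open_source.mem_nhds he)
    have h3 := S.eq_point e'
    rw [S.point_change _ (γ, p)] at h3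
    conv_lhs => rw [h3]
    exact S.smul_point g γ p he' _

theorem isCoveringMap_proj : IsCoveringMap S.core.proj :=
  FiberBundle.isCoveringMap

theorem lifts_of_mem_chart (i : CoprodI A × Piece J N) {x y : M} (ρ : Path x y)
    (hρ : ∀ t, ρ t ∈ S.chart i) (h : Monoid.Coprod (FreeGroup J) (CoprodI A)) :
    (Path.Homotopic.Quotient.mk ρ).Lifts S.core.proj (S.point i x h) (S.point i y h) := by
  refine ⟨ρ, rfl, ⟨⟨fun t => S.point i (ρ t) h, ?_⟩, by simp, by simp⟩, fun t => rfl⟩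
  exact (S.continuousOn_point i).comp_continuous (f := fun t => (ρ t, h)) (by fun_prop)
    fun t => ⟨hρ t, trivial⟩

end Covering

end OrbifoldAtlas

end Atlas

section Atlas

open Set Topology Monoid
open scoped unitInterval

open OrbifoldAtlas (Piece)

namespace OrbifoldAtlas

variable {N : Type t} {J : Type w} {A : N → Type u} [∀ ν, Group (A ν)] {M : Type v}
  [TopologicalSpace M] [MulAction (CoprodI A) M] (S : OrbifoldAtlas J A M)

/-! #### The fundamental group of an orbifold atlas -/

/-- A point on the left of a cut. -/
noncomputable def leftPt (j : J) : M := (S.isPathConnected_left j).nonempty.some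

/-- A point on the right of a cut. -/
noncomputable def rightPt (j : J) : M := (S.isPathConnected_right j).nonempty.some

/-- A common point of the disk and a cone. -/
noncomputable def conePt (ν : N) : M := (S.isPathConnected_cone ν).nonempty.some

/-- A point of the disk. -/
noncomputable def base : M := (S.simplyConnected .disk).nonempty.some

theorem leftPt_mem (j : J) : S.leftPt j ∈ S.left j := Nonempty.some_mem _

theorem rightPt_mem (j : J) : S.rightPt j ∈ S.right j := Nonempty.some_mem _

theorem conePt_mem (ν : N) : S.conePt ν ∈ S.piece (.cone ν) ∩ S.piece .disk := Nonempty.some_mem _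

theorem base_mem : S.base ∈ S.piece .disk := Nonempty.some_mem _

theorem left_subset (j : J) : S.left j ⊆ S.piece (.cut j) ∩ S.piece .disk :=
  (S.cut_inter_disk j).symm ▸ subset_union_left

theorem right_subset (j : J) : S.right j ⊆ S.piece (.cut j) ∩ S.piece .disk :=
  (S.cut_inter_disk j).symm ▸ subset_union_right

/-- A common point of the disk and a piece. -/
noncomputable def anchor : Piece J N → M
  | .disk => S.base
  | .cut j => S.leftPt j
  | .cone ν => S.conePt ν

theorem anchor_mem (p : Piece J N) : S.anchor p ∈ S.piece p ∩ S.piece .disk := by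
  cases p with
  | disk => exact ⟨S.base_mem, S.base_mem⟩
  | cut j => exact S.left_subset j (S.leftPt_mem j)
  | cone ν => exact S.conePt_mem ν

variable {x₀ : M} (f : OrbifoldFrame (CoprodI A) x₀ S.base)

/-- The frame at a point of the disk that is given by a path in the disk. -/
noncomputable def diskFrame {y : M} (hy : y ∈ S.piece .disk) : OrbifoldFrame (CoprodI A) x₀ y :=
  f.transport ((S.simplyConnected .disk).path hy S.base_mem)

/-- The frame at a point of a piece that is given by a path in that piece and a path in the
disk. -/
noncomputable def frame (p : Piece J N) {y : M} (hy : y ∈ S.piece p) :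
    OrbifoldFrame (CoprodI A) x₀ y :=
  (S.diskFrame f (S.anchor_mem p).2).transport ((S.simplyConnected p).path hy (S.anchor_mem p).1)

theorem diskFrame_transport {y z : M} (hy : y ∈ S.piece .disk) (hz : z ∈ S.piece .disk) :
    (S.diskFrame f hz).transport ((S.simplyConnected .disk).path hy hz) = S.diskFrame f hy := by
  rw [diskFrame, ← OrbifoldFrame.transport_trans, IsSimplyConnected.path_trans, diskFrame]

theorem frame_transport (p : Piece J N) {y z : M} (hy : y ∈ S.piece p) (hz : z ∈ S.piece p) :
    (S.frame f p hz).transport ((S.simplyConnected p).path hy hz) = S.frame f p hy := by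
  rw [frame, ← OrbifoldFrame.transport_trans, IsSimplyConnected.path_trans, frame]

theorem frame_disk {y : M} (hy : y ∈ S.piece .disk) : S.frame f .disk hy = S.diskFrame f hy :=
  S.diskFrame_transport f _ _

/-- Inside the component `W` of the overlap that contains the anchor, the path to the anchor can be
taken in the disk as well as in the piece. The other component of a cut is excluded here and yields
the free generator. -/
theorem frame_eq_diskFrame (p : Piece J N) {W : Set M} (hW : IsPathConnected W)
    (hWp : W ⊆ S.piece p ∩ S.piece .disk) {y : M} (hy : y ∈ W) (ha : S.anchor p ∈ W) :
    S.frame f p (hWp hy).1 = S.diskFrame f (hWp hy).2 := by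
  rw [frame, IsSimplyConnected.path_congr (S.simplyConnected p) (S.simplyConnected .disk) hW
    (hWp.trans inter_subset_left) (hWp.trans inter_subset_right) hy ha, diskFrame_transport]

theorem frame_cut_left (j : J) {y : M} (hy : y ∈ S.left j) :
    S.frame f (.cut j) (S.left_subset j hy).1 = S.diskFrame f (S.left_subset j hy).2 :=
  S.frame_eq_diskFrame f (.cut j) (S.isPathConnected_left j) (S.left_subset j) hy (S.leftPt_mem j)

theorem frame_cone (ν : N) {y : M} (hy : y ∈ S.piece (.cone ν) ∩ S.piece .disk) :
    S.frame f (.cone ν) hy.1 = S.diskFrame f hy.2 :=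
  S.frame_eq_diskFrame f (.cone ν) (S.isPathConnected_cone ν) Subset.rfl hy (S.conePt_mem ν)

/-- The class of the loops around a puncture, which cross the cut once. -/
noncomputable def cutLoop (j : J) : OrbifoldFundamentalGroup (CoprodI A) x₀ :=
  (S.frame f (.cut j) (S.right_subset j (S.rightPt_mem j)).1).diff
    (S.diskFrame f (S.right_subset j (S.rightPt_mem j)).2)

/-- Moving `y` inside the connected right side transports both frames along the same class, which
leaves their difference unchanged. -/
theorem diff_frame_cut (j : J) {y : M} (hy : y ∈ S.right j) :
    (S.frame f (.cut j) (S.right_subset j hy).1).diff (S.diskFrame f (S.right_subset j hy).2) =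
      S.cutLoop f j := by
  have h := IsSimplyConnected.path_congr (S.simplyConnected (.cut j)) (S.simplyConnected .disk)
    (S.isPathConnected_right j) ((S.right_subset j).trans inter_subset_left)
    ((S.right_subset j).trans inter_subset_right) hy (S.rightPt_mem j)
  rw [cutLoop, ← OrbifoldFrame.diff_transport ((S.simplyConnected (.cut j)).path
      (S.right_subset j hy).1 (S.right_subset j (S.rightPt_mem j)).1), frame_transport, h,
    diskFrame_transport]

variable [ContinuousConstSMul (CoprodI A) M]

/-- `A ν` maps paths in the cone to paths in the cone. Hence the frame at `a • y` and the translate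
of the frame at `y` are both transported along the translated path, and the choice of `y` is
irrelevant. -/
theorem diff_frame_cone (ν : N) (a : A ν) {y z : M} (hy : y ∈ S.piece (.cone ν))
    (hz : z ∈ S.piece (.cone ν)) :
    (S.frame f (.cone ν) (S.smul_mem_cone ν a y hy)).diff
        ((S.frame f (.cone ν) hy).translate (CoprodI.of a) rfl) =
      (S.frame f (.cone ν) (S.smul_mem_cone ν a z hz)).diff
        ((S.frame f (.cone ν) hz).translate (CoprodI.of a) rfl) := by
  obtain ⟨ρ, hρ, h⟩ := (S.simplyConnected (.cone ν)).exists_path hy hz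
  have h1 := S.frame_transport f (.cone ν) hy hz
  have h2 := (S.simplyConnected (.cone ν)).mk_eq_path
    (ρ.map (continuous_const_smul (CoprodI.of a : CoprodI A)))
    fun t => S.smul_mem_cone ν a _ (hρ t)
  have h3 := S.frame_transport f (.cone ν) (S.smul_mem_cone ν a y hy) (S.smul_mem_cone ν a z hz)
  rw [← h1, OrbifoldFrame.transport_translate, h, ← h3, ← h2]
  exact OrbifoldFrame.diff_transport _ _ _

/-- The classes of the loops around a cone point. -/
noncomputable def coneHom (ν : N) : A ν →* OrbifoldFundamentalGroup (CoprodI A) x₀ :=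
  MonoidHom.mk' (fun a => (S.frame f (.cone ν) (S.smul_mem_cone ν a _ (S.conePt_mem ν).1)).diff
    ((S.frame f (.cone ν) (S.conePt_mem ν).1).translate (CoprodI.of a) rfl)) (by
    intro a b
    have h := S.smul_mem_cone ν b _ (S.conePt_mem ν).1
    have h1 : CoprodI.of a • CoprodI.of b • S.conePt ν = CoprodI.of (a * b) • S.conePt ν := by
      rw [map_mul, mul_smul]
    -- The factor for `a` is computed at `b • conePt` instead of `conePt`, and the factor for `b` is
    -- translated by `a`; then the middle frames agree and the product telescopes.
    rw [← S.diff_frame_cone f ν a h (S.conePt_mem ν).1,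
      ← OrbifoldFrame.diff_translate (CoprodI.of a) rfl (S.frame f (.cone ν) h),
      OrbifoldFrame.diff_mul, OrbifoldFrame.translate_translate]
    have key : ∀ (z : M) (hz : z = CoprodI.of (a * b) • S.conePt ν) (hzm : z ∈ S.piece (.cone ν))
        (k : CoprodI A) (hk : k = CoprodI.of (a * b)) (hkz : k • S.conePt ν = z),
        (S.frame f (.cone ν) (S.smul_mem_cone ν (a * b) _ (S.conePt_mem ν).1)).diff
          ((S.frame f (.cone ν) (S.conePt_mem ν).1).translate (CoprodI.of (a * b)) rfl) =
        (S.frame f (.cone ν) hzm).diff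
          ((S.frame f (.cone ν) (S.conePt_mem ν).1).translate k hkz) := by
      rintro _ rfl _ _ rfl _
      rfl
    exact key _ h1 _ _ (map_mul _ _ _).symm _)

theorem diff_frame_cone_eq (ν : N) (a : A ν) {y : M} (hy : y ∈ S.piece (.cone ν)) :
    (S.frame f (.cone ν) (S.smul_mem_cone ν a y hy)).diff
        ((S.frame f (.cone ν) hy).translate (CoprodI.of a) rfl) = S.coneHom f ν a :=
  S.diff_frame_cone f ν a hy _

/-- The homomorphism from the free product of a free group and `Γ` to the orbifold fundamental
group. -/
noncomputable def hom :
    Monoid.Coprod (FreeGroup J) (CoprodI A) →* OrbifoldFundamentalGroup (CoprodI A) x₀ :=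
  Coprod.lift (FreeGroup.lift (S.cutLoop f)) (CoprodI.lift (S.coneHom f))

theorem cutLoop_mem_range (j : J) : S.cutLoop f j ∈ (S.hom f).range :=
  ⟨Coprod.inl (FreeGroup.of j), by simp [hom]⟩

theorem coneHom_mem_range (ν : N) (a : A ν) : S.coneHom f ν a ∈ (S.hom f).range :=
  ⟨Coprod.inr (CoprodI.of a), by simp [hom]⟩

/-- The translates of the frames of the pieces. -/
def IsStandard {z : M} (k : OrbifoldFrame (CoprodI A) x₀ z) : Prop :=
  ∃ (γ : CoprodI A) (p : Piece J N) (y : M) (hy : y ∈ S.piece p) (h : γ • y = z),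
    k = (S.frame f p hy).translate γ h

theorem exists_isStandard (z : M) : ∃ k : OrbifoldFrame (CoprodI A) x₀ z, S.IsStandard f k := by
  obtain ⟨p, hp⟩ := S.exists_mem_piece z
  exact ⟨_, S.label z, p, _, hp, smul_inv_smul _ _, rfl⟩

variable {S f}

theorem IsStandard.translate {z w : M} {k : OrbifoldFrame (CoprodI A) x₀ z}
    (hk : S.IsStandard f k) (γ : CoprodI A) (h : γ • z = w) :
    S.IsStandard f (k.translate γ h) := by
  obtain ⟨γ', p, y, hy, hz, rfl⟩ := hk
  exact ⟨γ * γ', p, y, hy, _, OrbifoldFrame.translate_translate ..⟩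

/-- Standard frames of pieces and of the disk. -/
theorem diff_translate_diskFrame_mem (p : Piece J N) {y z : M} {δ : CoprodI A} (h : δ • y = z)
    (hy : y ∈ S.piece .disk) (hz : z ∈ S.piece p) :
    ((S.diskFrame f hy).translate δ h).diff (S.frame f p hz) ∈ (S.hom f).range := by
  have hl : S.label z = δ := by
    simpa using S.label_disk δ⁻¹ z (by rwa [← h, inv_smul_smul])
  cases p with
  | disk =>
    have h1 : δ = 1 := by
      rw [← hl]
      simpa using S.label_disk 1 z (by rwa [one_smul])
    subst h1
    obtain rfl : y = z := by rw [← h, one_smul]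
    rw [OrbifoldFrame.translate_one, frame_disk, OrbifoldFrame.diff_self]
    exact one_mem _
  | cut j =>
    have h1 : δ = 1 := by
      rw [← hl]
      simpa using S.label_cut j 1 z (by rwa [one_smul])
    subst h1
    obtain rfl : y = z := by rw [← h, one_smul]
    rw [OrbifoldFrame.translate_one]
    have h2 : y ∈ S.left j ∪ S.right j := by
      rw [← S.cut_inter_disk]
      exact ⟨hz, hy⟩
    rcases h2 with h2 | h2
    · rw [S.frame_cut_left f j h2, OrbifoldFrame.diff_self]
      exact one_mem _
    · rw [← OrbifoldFrame.diff_inv, S.diff_frame_cut f j h2]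
      exact inv_mem (S.cutLoop_mem_range f j)
  | cone ν =>
    obtain ⟨a, ha⟩ := S.label_cone ν 1 z (by rwa [one_smul])
    rw [hl, inv_one, one_mul] at ha
    subst ha
    subst h
    have hy' : y ∈ S.piece (.cone ν) := by
      have := S.smul_mem_cone ν a⁻¹ _ hz
      rwa [map_inv, inv_smul_smul] at this
    rw [← S.frame_cone f ν ⟨hy', hy⟩, ← OrbifoldFrame.diff_inv, S.diff_frame_cone_eq f ν a hy']
    exact inv_mem (S.coneHom_mem_range f ν a)

/-- At a point of a translate of the disk both frames are compared with the disk frame there. At any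
other point the two pieces coincide, or they are translates of one cone and the difference is a
value of `coneHom`. -/
theorem IsStandard.diff_frame_mem {z : M} {k : OrbifoldFrame (CoprodI A) x₀ z}
    (hk : S.IsStandard f k) (p : Piece J N) (hz : z ∈ S.piece p) :
    (S.frame f p hz).diff k ∈ (S.hom f).range := by
  obtain ⟨γ, p', y, hy, h, rfl⟩ := hk
  by_cases hd : ∃ δ, z ∈ S.chart (δ, .disk)
  · obtain ⟨δ, hδ⟩ := hd
    have hδ' : δ⁻¹ • z ∈ S.piece .disk := hδ
    rw [← OrbifoldFrame.diff_mul _ ((S.diskFrame f hδ').translate δ (smul_inv_smul _ _))]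
    refine mul_mem ?_ ?_
    · rw [← OrbifoldFrame.diff_inv]
      exact inv_mem (diff_translate_diskFrame_mem p _ hδ' hz)
    · have h1 : γ⁻¹ • z = y := by rw [← h, inv_smul_smul]
      have h2 := OrbifoldFrame.diff_translate γ⁻¹ h1
        ((S.diskFrame f hδ').translate δ (smul_inv_smul _ _)) ((S.frame f p' hy).translate γ h)
      rw [OrbifoldFrame.translate_translate, OrbifoldFrame.translate_translate] at h2
      have h3 : ∀ (g : CoprodI A) (hg : g = 1) (hgy : g • y = y),
          (S.frame f p' hy).translate g hgy = S.frame f p' hy := by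
        rintro _ rfl _
        exact OrbifoldFrame.translate_one _
      rw [h3 _ (inv_mul_cancel γ)] at h2
      rw [← h2]
      exact diff_translate_diskFrame_mem p' _ hδ' hy
  · have hy' : z ∈ S.chart (γ, p') := by
      rw [← h, chart, mem_ofPred_eq, inv_smul_smul]
      exact hy
    have hz' : z ∈ S.chart (1, p) := by
      rw [chart, mem_ofPred_eq, inv_one, one_smul]
      exact hz
    rcases S.eq_or_cone hz' hy' (not_exists.1 hd) with ⟨rfl, rfl⟩ | ⟨ν, a, rfl, rfl, rfl⟩
    · obtain rfl : y = z := by rw [← h, one_smul]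
      rw [OrbifoldFrame.translate_one, OrbifoldFrame.diff_self]
      exact one_mem _
    · have key : ∀ (g : CoprodI A) (hg : g = CoprodI.of a) (hgz : g • y = z),
          (S.frame f (.cone ν) hz).diff ((S.frame f (.cone ν) hy).translate g hgz) ∈
            (S.hom f).range := by
        rintro _ rfl rfl
        rw [S.diff_frame_cone_eq f ν a hy]
        exact S.coneHom_mem_range f ν a
      exact key _ (one_mul _) _

variable (S f)

/-- The property is multiplicative under concatenation, by inserting a standard frame at the middle
point. For a path inside one chart, translate back to the piece: its frame is transported to itself,
so only comparisons at the two endpoints remain. -/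
theorem diff_transport_mem {z w : M} (p : Path.Homotopic.Quotient z w) :
    ∀ (k : OrbifoldFrame (CoprodI A) x₀ z) (k' : OrbifoldFrame (CoprodI A) x₀ w),
      S.IsStandard f k → S.IsStandard f k' → k.diff (k'.transport p) ∈ (S.hom f).range := by
  refine Path.Homotopic.Quotient.induction_of_openCover (U := S.chart)
    (P := fun {z w} p => ∀ (k : OrbifoldFrame (CoprodI A) x₀ z)
      (k' : OrbifoldFrame (CoprodI A) x₀ w), S.IsStandard f k → S.IsStandard f k' →
        k.diff (k'.transport p) ∈ (S.hom f).range) S.isOpen_chart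
    (fun x => ⟨_, S.mem_chart_index x⟩) ?_ ?_ p
  · rintro ⟨γ, p⟩ x y ρ hρ k k' hk hk'
    have hx : γ⁻¹ • x ∈ S.piece p := by simpa [chart] using hρ 0
    have hy : γ⁻¹ • y ∈ S.piece p := by simpa [chart] using hρ 1
    have h1 := (S.simplyConnected p).mk_eq_path (ρ.map (continuous_const_smul γ⁻¹)) hρ
    have h2 := S.frame_transport f p hx hy
    rw [← h1] at h2
    have h3 : γ⁻¹ • x = γ⁻¹ • x := rfl
    have h4 := OrbifoldFrame.diff_translate γ⁻¹ h3 k (k'.transport (.mk ρ))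
    rw [OrbifoldFrame.transport_translate] at h4
    rw [← h4, ← OrbifoldFrame.diff_mul _ (S.frame f p hx)]
    refine mul_mem ?_ ?_
    · rw [← OrbifoldFrame.diff_inv]
      exact inv_mem ((hk.translate _ _).diff_frame_mem p hx)
    · rw [← h2]
      refine (congrArg (· ∈ (S.hom f).range) (OrbifoldFrame.diff_transport _ _ _)).mpr ?_
      exact (hk'.translate _ _).diff_frame_mem p hy
  · intro x y z p q hp hq k k' hk hk'
    obtain ⟨m, hm⟩ := S.exists_isStandard f y
    rw [OrbifoldFrame.transport_trans, ← OrbifoldFrame.diff_mul _ (m.transport p),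
      OrbifoldFrame.diff_transport]
    exact mul_mem (hp k m hk hm) (hq m k' hm hk')

/-- An arbitrary element is the difference between `f` and a transported translate of `f`. Both `f`
and its translate are standard. -/
theorem hom_surjective : Function.Surjective (S.hom f) := by
  intro α
  obtain ⟨f', rfl⟩ := f.exists_diff_eq α
  obtain ⟨g, p, rfl⟩ := f.exists_eq_transport f'
  have hf : S.IsStandard f f := by
    refine ⟨1, .disk, S.base, S.base_mem, one_smul _ _, ?_⟩
    rw [OrbifoldFrame.translate_one, frame_disk, diskFrame, IsSimplyConnected.path_self,
      OrbifoldFrame.transport_refl]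
  exact S.diff_transport_mem f p _ _ hf (hf.translate g rfl)

section Covering

variable [TopologicalSpace (Monoid.Coprod (FreeGroup J) (CoprodI A))]
  [DiscreteTopology (Monoid.Coprod (FreeGroup J) (CoprodI A))]

theorem lifts_path (p : Piece J N) {x y : M} (hx : x ∈ S.piece p) (hy : y ∈ S.piece p)
    (h : Monoid.Coprod (FreeGroup J) (CoprodI A)) :
    ((S.simplyConnected p).path hx hy).Lifts S.core.proj (S.point (1, p) x h)
      (S.point (1, p) y h) := by
  obtain ⟨ρ, hρ, h⟩ := (S.simplyConnected p).exists_path hx hy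
  rw [h]
  refine S.lifts_of_mem_chart _ _ (fun t => ?_) _
  simpa [chart] using hρ t

variable {S f} in
theorem lifts_diskFrame {k : Monoid.Coprod (FreeGroup J) (CoprodI A)} {e : S.core.TotalSpace}
    (he : f.Lifts S.core.proj (S.point (1, .disk) S.base k) e) {y : M} (hy : y ∈ S.piece .disk) :
    (S.diskFrame f hy).Lifts S.core.proj (S.point (1, .disk) y k) e :=
  OrbifoldFrame.Lifts.transport (S.lifts_path .disk hy S.base_mem k) he

-- On the right of the cut the cut coordinate `k` is the disk coordinate `k * j`, while on the left
-- both coordinates are `k`. So the two frames forming `cutLoop` have lifts starting at the same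
-- point over `rightPt`, and these lead to sheets that differ by the generator.
variable {S f} in
theorem lifts_cutLoop {j : J} {k : Monoid.Coprod (FreeGroup J) (CoprodI A)}
    {e e' : S.core.TotalSpace} (he : f.Lifts S.core.proj (S.point (1, .disk) S.base k) e)
    (he' : f.Lifts S.core.proj
      (S.point (1, .disk) S.base (k * Coprod.inl (FreeGroup.of j))) e') :
    (S.cutLoop f j).Lifts S.core.proj e e' := by
  have hl := S.left_subset j (S.leftPt_mem j)
  have hr := S.right_subset j (S.rightPt_mem j)
  have h1 := lifts_diskFrame he' hr.2
  have h2 := lifts_diskFrame he hl.2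
  have hl' : S.leftPt j ∉ S.right j :=
    disjoint_left.1 (S.disjoint_left_right j) (S.leftPt_mem j)
  have h3 : S.point (1, .disk) (S.leftPt j) k = S.point (1, .cut j) (S.leftPt j) k := by
    rw [S.point_change _ (1, .cut j)]
    simp [transition, factor, hl']
  have h4 : S.point (1, .disk) (S.rightPt j) (k * Coprod.inl (FreeGroup.of j)) =
      S.point (1, .cut j) (S.rightPt j) k := by
    rw [S.point_change _ (1, .cut j)]
    simp [transition, factor, S.rightPt_mem j]
  rw [h4] at h1
  rw [h3] at h2
  exact OrbifoldFrame.Lifts.diff (OrbifoldFrame.Lifts.transport (S.lifts_path (.cut j) hr.1 hl.1 k) h2) h1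

-- Over the translate of the cone's anchor by `a`, the coordinate `k * a` in the translated disk is
-- the coordinate `k` in the cone, since the label there is `a`. Hence the two frames in `coneHom`
-- lift from a common point.
variable {S f} in
theorem lifts_coneHom {ν : N} {a : A ν} {k : Monoid.Coprod (FreeGroup J) (CoprodI A)}
    {e e' : S.core.TotalSpace} (he : f.Lifts S.core.proj (S.point (1, .disk) S.base k) e)
    (he' : f.Lifts S.core.proj
      (S.point (1, .disk) S.base (k * Coprod.inr (CoprodI.of a))) e') :
    (S.coneHom f ν a).Lifts S.core.proj e e' := by
  have hc := S.conePt_mem ν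
  have ha := S.smul_mem_cone ν a _ hc.1
  have h1 := OrbifoldFrame.Lifts.translate S.proj_smul (CoprodI.of a) rfl
    (lifts_diskFrame he' hc.2)
  have h2 := lifts_diskFrame he hc.2
  have hcd : S.conePt ν ∈ S.chart (1, .disk) := by simpa [chart] using hc.2
  rw [S.smul_point _ _ _ hcd, mul_one, S.point_change _ (1, .cone ν)] at h1
  rw [S.point_change _ (1, .cone ν)] at h2
  have hla : S.label ((CoprodI.of a : CoprodI A) • S.conePt ν) = CoprodI.of a := by
    simpa using S.label_disk (CoprodI.of a)⁻¹ _ (by simpa using hc.2)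
  have hlc : S.label (S.conePt ν) = 1 := by simpa using S.label_disk 1 _ (by simpa using hc.2)
  have h3 : k * Coprod.inr (CoprodI.of a) * S.transition (CoprodI.of a, .disk) (1, .cone ν)
      ((CoprodI.of a : CoprodI A) • S.conePt ν) = k := by
    simp [transition, factor, hla, mul_assoc]
  have h4 : k * S.transition (1, .disk) (1, .cone ν) (S.conePt ν) = k := by
    simp [transition, factor, hlc]
  rw [h3, ← S.frame_cone f ν hc] at h1
  rw [h4] at h2
  rw [← S.diff_frame_cone_eq f ν a hc.1]
  exact OrbifoldFrame.Lifts.diff (OrbifoldFrame.Lifts.transport (S.lifts_path _ ha hc.1 k)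
    h2) h1

end Covering

theorem hom_injective : Function.Injective (S.hom f) := by
  let H := Monoid.Coprod (FreeGroup J) (CoprodI A)
  let _ : TopologicalSpace H := ⊥
  have _ : DiscreteTopology H := ⟨rfl⟩
  obtain ⟨φ, hφ, hφ'⟩ := f.exists_lifts S.isCoveringMap_proj S.proj_smul
  let ψ : H → S.core.TotalSpace := fun k => φ ⟨S.point (1, .disk) S.base k, rfl⟩
  have hψ : ∀ k, f.Lifts S.core.proj (S.point (1, .disk) S.base k) (ψ k) := fun k => (hφ' ⟨_, rfl⟩).1
  have hψ' : ∀ k, S.core.proj (ψ k) = x₀ := fun k => (hφ' ⟨_, rfl⟩).2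
  have hψi : Function.Injective ψ := fun k k' h =>
    S.point_injective _ _ (Subtype.ext_iff.1 (hφ h))
  -- The elements whose image has right multiplication as monodromy. All sheets `k` are required at
  -- once, because products and inverses are checked on shifted sheets. It then suffices to treat
  -- generators.
  let K : Subgroup H :=
    { carrier := {h | ∀ k, (S.hom f h).Lifts S.core.proj (ψ k) (ψ (k * h))}
      one_mem' := fun k => by
        rw [map_one, mul_one]
        exact OrbifoldFundamentalGroup.lifts_one (hψ' k)
      mul_mem' := fun {h h'} hh hh' k => by
        rw [map_mul, ← mul_assoc]
        exact (hh k).mul (hh' _)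
      inv_mem' := fun {h} hh k => by
        have := (hh (k * h⁻¹)).inv S.isCoveringMap_proj S.proj_smul (hψ' _) (hψ' _)
        rwa [inv_mul_cancel_right, ← map_inv] at this }
  have hK : ∀ h, h ∈ K := by
    intro h
    induction h using Coprod.induction_on with
    | inl x =>
      induction x using FreeGroup.induction_on with
      | C1 => rw [map_one]; exact one_mem _
      | of j =>
        intro k
        have : S.hom f (Coprod.inl (FreeGroup.of j)) = S.cutLoop f j := by simp [hom]
        rw [this]
        exact lifts_cutLoop (hψ _) (hψ _)
      | inv_of j h => rw [map_inv]; exact inv_mem h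
      | mul x y hx hy => rw [map_mul]; exact mul_mem hx hy
    | inr x =>
      induction x using CoprodI.induction_on with
      | one => rw [map_one]; exact one_mem _
      | of ν a =>
        intro k
        have : S.hom f (Coprod.inr (CoprodI.of a)) = S.coneHom f ν a := by simp [hom]
        rw [this]
        exact lifts_coneHom (hψ _) (hψ _)
      | mul x y hx hy => rw [map_mul]; exact mul_mem hx hy
    | mul x y hx hy => exact mul_mem hx hy
  refine (injective_iff_map_eq_one _).2 fun h hh => ?_
  have h1 := hK h 1
  rw [hh, one_mul] at h1
  exact hψi (h1.unique S.isCoveringMap_proj S.proj_smul (hψ' 1)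
    (OrbifoldFundamentalGroup.lifts_one (hψ' 1)))

theorem nonempty_mulEquiv (S : OrbifoldAtlas J A M) (x₀ : M) :
    Nonempty (OrbifoldFundamentalGroup (CoprodI A) x₀ ≃*
    Monoid.Coprod (FreeGroup J) (CoprodI A)) := by
  obtain ⟨p, hp⟩ := S.exists_mem_piece x₀
  -- `x₀` may lie outside all the chosen pieces; its translate by the inverse label lies in one of
  -- them and is reached from the disk.
  let f : OrbifoldFrame (CoprodI A) x₀ S.base := ⟨(S.label x₀)⁻¹,
    ((S.simplyConnected .disk).path S.base_mem (S.anchor_mem p).2).trans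
      ((S.simplyConnected p).path (S.anchor_mem p).1 hp)⟩
  exact ⟨(MulEquiv.ofBijective (S.hom f) ⟨S.hom_injective f, S.hom_surjective f⟩).symm⟩

end OrbifoldAtlas

end Atlas

/-! ### The cells of the fundamental domain -/

section Cells

open Set Topology

/-- The real part of `conj p * w`. -/
noncomputable def planarDot (p : ℂ) : ℂ →ₗ[ℝ] ℝ := p.re • Complex.reLm + p.im • Complex.imLm

/-- The imaginary part of `conj p * w`. -/
noncomputable def planarCross (p : ℂ) : ℂ →ₗ[ℝ] ℝ := p.re • Complex.imLm - p.im • Complex.reLm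

theorem planarDot_apply (p w : ℂ) : planarDot p w = p.re * w.re + p.im * w.im := by
  simp [planarDot]

theorem planarCross_apply (p w : ℂ) : planarCross p w = p.re * w.im - p.im * w.re := by
  simp [planarCross]

theorem planarDot_self_pos {p : ℂ} (hp : p ≠ 0) : 0 < planarDot p p := by
  rw [planarDot_apply]
  have := Complex.normSq_pos.2 hp
  rwa [Complex.normSq_apply] at this

theorem planarCross_self (p : ℂ) : planarCross p p = 0 := by
  rw [planarCross_apply]; ring

theorem continuous_planar (φ : ℂ →ₗ[ℝ] ℝ) : Continuous φ := φ.continuous_of_finiteDimensional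

theorem convex_lt_linear (φ : ℂ →ₗ[ℝ] ℝ) (o : ℂ) (c : ℝ) : Convex ℝ {z | c < φ (z - o)} := by
  have : {z | c < φ (z - o)} = {z | c + φ o < φ z} := by
    ext z
    simp [lt_sub_iff_add_lt]
  rw [this]
  exact convex_halfSpace_gt φ.isLinear _

variable {J : Type w}

/-- A point of the interior of the fundamental domain that lies above all punctures and is not on a
line with two of them. -/
structure IsCenter (N : ℕ) (q : J → ℂ) (o : ℂ) : Prop where
  mem_interior : o ∈ interior (domainDisk N)
  im_lt : ∀ j, (q j).im < o.im
  cross_ne_zero : ∀ i j, i ≠ j → planarCross (q j - o) (q i - o) ≠ 0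

theorem interior_domainDisk (N : ℕ) :
    interior (domainDisk N) = Ioo (0 : ℝ) (N + 1) ×ℂ Ioo (0 : ℝ) 1 := by
  rw [domainDisk, Complex.interior_reProdIm, interior_Icc, interior_Icc]

theorem convex_domainDisk (N : ℕ) : Convex ℝ (domainDisk N) :=
  ((convex_Icc (0 : ℝ) (N + 1)).linear_preimage Complex.reLm).inter
    ((convex_Icc (0 : ℝ) 1).linear_preimage Complex.imLm)

/-- Fix a height below `1` and above all punctures. On that horizontal line every pair of punctures
excludes at most one abscissa, and an interval is infinite. -/
theorem exists_isCenter {N : ℕ} [Finite J] (q : J → ℂ)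
    (hq : ∀ j, q j ∈ interior (domainDisk N)) (hq' : Function.Injective q) :
    ∃ o, IsCenter N q o := by
  have := Fintype.ofFinite J
  rw [interior_domainDisk] at hq
  -- The inserted `0` makes the set nonempty when there are no punctures and keeps `y` positive.
  obtain ⟨y, hy, hy1⟩ : ∃ y : ℝ, (∀ r ∈ insert 0 (range fun j => (q j).im), r < y) ∧ y < 1 := by
    have hfin : (insert 0 (range fun j => (q j).im)).Finite := (finite_range _).insert _
    obtain ⟨m, hm, hmax⟩ := exists_max_image _ id hfin (insert_nonempty _ _)
    have hm1 : m < 1 := by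
      rcases hm with rfl | ⟨j, rfl⟩
      · exact one_pos
      · exact (hq j).2.2
    obtain ⟨y, h1, h2⟩ := exists_between hm1
    exact ⟨y, fun r hr => (hmax r hr).trans_lt h1, h2⟩
  have hy0 : 0 < y := hy 0 (mem_insert _ _)
  have hyq : ∀ j, (q j).im < y := fun j => hy _ (mem_insert_of_mem _ ⟨j, rfl⟩)
  let bad : J × J → Set ℝ := fun ij =>
    {x | ij.1 ≠ ij.2 ∧ planarCross (q ij.2 - ⟨x, y⟩) (q ij.1 - ⟨x, y⟩) = 0}
  have hbad : ∀ ij, (bad ij).Finite := by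
    rintro ⟨i, j⟩
    refine Subsingleton.finite ?_
    rintro x ⟨hij, hx⟩ x' ⟨-, hx'⟩
    simp only [planarCross_apply, Complex.sub_re, Complex.sub_im] at hx hx' hij
    -- Two distinct bad abscissas would force equal heights for the punctures; as `y` differs from
    -- that height, collinearity then makes the punctures equal.
    have h1 : (x - x') * ((q j).im - (q i).im) = 0 := by linear_combination hx - hx'
    rcases mul_eq_zero.1 h1 with h | h
    · linarith
    · exfalso
      have h2 : ((q i).im - y) * ((q j).re - (q i).re) = 0 := by
        linear_combination hx + h * (q i).re - h * x
      rcases mul_eq_zero.1 h2 with h3 | h3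
      · linarith [hyq i]
      · exact hij (hq' (Complex.ext (by linarith) (by linarith)))
  obtain ⟨x, hx, hxb⟩ := ((Ioo_infinite (show (0 : ℝ) < N + 1 by positivity)).sdiff
    (finite_iUnion hbad)).nonempty
  refine ⟨⟨x, y⟩, ?_, hyq, fun i j hij h => hxb (mem_iUnion.2 ⟨(i, j), hij, h⟩)⟩
  rw [interior_domainDisk]
  exact ⟨hx, hy0, hy1⟩

/-- The part of the ray from `o` through `p` that starts at `p`. -/
def rayCut (o p : ℂ) : Set ℂ :=
  {z | planarCross (p - o) (z - o) = 0 ∧ planarDot (p - o) (p - o) ≤ planarDot (p - o) (z - o)}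

theorem mem_rayCut_iff {o p : ℂ} (hp : p ≠ o) {z : ℂ} :
    z ∈ rayCut o p ↔ ∃ s : ℝ, 1 ≤ s ∧ z - o = s • (p - o) := by
  have hpos := planarDot_self_pos (sub_ne_zero.2 hp)
  constructor
  · rintro ⟨h1, h2⟩
    refine ⟨planarDot (p - o) (z - o) / planarDot (p - o) (p - o), (one_le_div hpos).2 h2, ?_⟩
    have hne := hpos.ne'
    generalize p - o = a at *
    generalize z - o = b at *
    rw [planarCross_apply] at h1
    have h3 : b.re = planarDot a b / planarDot a a * a.re := by
      rw [div_mul_eq_mul_div, eq_div_iff hne, planarDot_apply, planarDot_apply]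
      linear_combination -a.im * h1
    have h4 : b.im = planarDot a b / planarDot a a * a.im := by
      rw [div_mul_eq_mul_div, eq_div_iff hne, planarDot_apply, planarDot_apply]
      linear_combination a.re * h1
    exact Complex.ext (by simpa using h3) (by simpa using h4)
  · rintro ⟨s, hs, hz⟩
    rw [rayCut, mem_ofPred_eq, hz, map_smul, map_smul, planarCross_self, smul_zero, smul_eq_mul]
    exact ⟨rfl, by nlinarith⟩

theorem isClosed_rayCut (o p : ℂ) : IsClosed (rayCut o p) := by
  have h1 : Continuous fun z => planarCross (p - o) (z - o) :=
    (continuous_planar _).comp (by fun_prop)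
  have h2 : Continuous fun z => planarDot (p - o) (z - o) :=
    (continuous_planar _).comp (by fun_prop)
  exact (isClosed_eq h1 continuous_const).inter (isClosed_le continuous_const h2)

/-- The arcs at a cone point. -/
def arcSet (ν : ℕ) : Set ℂ := {z | z.im = 1 ∧ |z.re - (ν + 1)| ≤ 1 / 4}

theorem isClosed_arcSet (ν : ℕ) : IsClosed (arcSet ν) :=
  (isClosed_eq Complex.continuous_im continuous_const).inter
    (isClosed_le (f := fun z : ℂ => |z.re - ((ν : ℝ) + 1)|)
      (Complex.continuous_re.sub continuous_const).abs continuous_const)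

open OrbifoldAtlas (Piece)

variable (N : ℕ) (q : J → ℂ) (o : ℂ)

/-- The intersections of the pieces of the atlas with the fundamental domain. -/
def cell : Piece J (Fin N) → Set ℂ
  | .disk => {z | (∀ ν : Fin N, z ∉ arcSet ν) ∧ ∀ j, z ∉ rayCut o (q j)}
  -- Besides lying beyond `q j` in the direction of the ray and below `o`, a point must make a
  -- smaller angle with the ray than the line through `o` and any other puncture does. Stated with
  -- products, this needs no division and no angles, and splits into linear inequalities.
  | .cut j => {z | planarDot (q j - o) (q j - o) < planarDot (q j - o) (z - o) ∧ z.im < o.im ∧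
      ∀ i, i ≠ j → |planarCross (q j - o) (z - o)| * |planarDot (q j - o) (q i - o)| <
        |planarCross (q j - o) (q i - o)| * planarDot (q j - o) (z - o)}
  -- Half-width `1/2` contains the arcs of half-width `1/4` and keeps different cones disjoint.
  -- Lying above `o` avoids all rays and wedges.
  | .cone ν => {z | |z.re - ((ν : ℕ) + 1)| < 1 / 2 ∧ o.im < z.im}

/-- The left part of a cut. -/
def leftCell (j : J) : Set ℂ := cell N q o (.cut j) ∩ {z | 0 < planarCross (q j - o) (z - o)}

/-- The right part of a cut. -/
def rightCell (j : J) : Set ℂ := cell N q o (.cut j) ∩ {z | 0 < -planarCross (q j - o) (z - o)}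

theorem isOpen_cell [Finite J] (p : Piece J (Fin N)) : IsOpen (cell N q o p) := by
  have h : ∀ (φ : ℂ →ₗ[ℝ] ℝ), Continuous fun z => φ (z - o) := fun φ =>
    (continuous_planar φ).comp (by fun_prop)
  cases p with
  | disk =>
    have h1 : IsOpen (⋂ ν : Fin N, (arcSet ν)ᶜ) :=
      isOpen_iInter_of_finite fun ν => (isClosed_arcSet ν).isOpen_compl
    have h2 : IsOpen (⋂ j, (rayCut o (q j))ᶜ) :=
      isOpen_iInter_of_finite fun j => (isClosed_rayCut o (q j)).isOpen_compl
    convert h1.inter h2 using 1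
    ext z
    simp [cell]
  | cut j =>
    have h1 : IsOpen (⋂ i, {z | i ≠ j → |planarCross (q j - o) (z - o)| *
        |planarDot (q j - o) (q i - o)| <
        |planarCross (q j - o) (q i - o)| * planarDot (q j - o) (z - o)}) := by
      refine isOpen_iInter_of_finite fun i => ?_
      by_cases hi : i = j
      · simp [hi]
      · simp only [ne_eq, hi, not_false_eq_true, forall_const]
        exact isOpen_lt ((h _).abs.mul continuous_const) (continuous_const.mul (h _))
    have h2 : IsOpen {z | planarDot (q j - o) (q j - o) < planarDot (q j - o) (z - o)} :=
      isOpen_lt continuous_const (h _)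
    have h3 : IsOpen {z : ℂ | z.im < o.im} := isOpen_lt Complex.continuous_im continuous_const
    convert h2.inter (h3.inter h1) using 1
    ext z
    simp only [cell, mem_ofPred_eq, mem_inter_iff, mem_iInter]
  | cone ν =>
    exact (isOpen_lt (f := fun z : ℂ => |z.re - (((ν : ℕ) : ℝ) + 1)|)
      (Complex.continuous_re.sub continuous_const).abs continuous_const).inter
      (isOpen_lt continuous_const Complex.continuous_im)

theorem isOpen_leftCell [Finite J] (j : J) : IsOpen (leftCell N q o j) :=
  (isOpen_cell N q o _).inter
    (isOpen_lt continuous_const ((continuous_planar _).comp (by fun_prop)))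

theorem isOpen_rightCell [Finite J] (j : J) : IsOpen (rightCell N q o j) :=
  (isOpen_cell N q o _).inter
    (isOpen_lt continuous_const ((continuous_planar _).comp (by fun_prop)).neg)

theorem convex_cell_cut (j : J) : Convex ℝ (cell N q o (.cut j)) := by
  have h1 := convex_lt_linear (planarDot (q j - o)) o (planarDot (q j - o) (q j - o))
  have h2 := convex_lt_linear (-Complex.imLm) o 0
  have h3 : Convex ℝ (⋂ (i) (_ : i ≠ j),
      {z | 0 < (|planarCross (q j - o) (q i - o)| • planarDot (q j - o) -
        |planarDot (q j - o) (q i - o)| • planarCross (q j - o)) (z - o)} ∩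
      {z | 0 < (|planarCross (q j - o) (q i - o)| • planarDot (q j - o) +
        |planarDot (q j - o) (q i - o)| • planarCross (q j - o)) (z - o)}) :=
    convex_iInter₂ fun i _ => (convex_lt_linear _ o 0).inter (convex_lt_linear _ o 0)
  convert (h1.inter h2).inter h3 using 1
  ext z
  simp only [cell, mem_ofPred_eq, mem_inter_iff, mem_iInter, LinearMap.neg_apply, Complex.imLm_coe,
    Complex.sub_im, LinearMap.sub_apply, LinearMap.add_apply, LinearMap.smul_apply, smul_eq_mul,
    and_assoc]
  refine and_congr_right fun _ => and_congr (by constructor <;> intro h <;> linarith) ?_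
  refine forall₂_congr fun i _ => ?_
  generalize planarCross (q j - o) (z - o) = a
  have hb := abs_nonneg (planarDot (q j - o) (q i - o))
  generalize |planarDot (q j - o) (q i - o)| = b at hb
  rw [← abs_of_nonneg hb, ← abs_mul, abs_lt, abs_of_nonneg hb]
  constructor <;> rintro ⟨h1, h2⟩ <;> constructor <;> linarith

theorem convex_cell_cone (ν : Fin N) : Convex ℝ (cell N q o (.cone ν)) := by
  have h1 : Convex ℝ (Complex.reLm ⁻¹' Ioo ((ν : ℕ) + 1 / 2 : ℝ) ((ν : ℕ) + 3 / 2)) :=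
    (convex_Ioo _ _).linear_preimage _
  have h2 : Convex ℝ (Complex.imLm ⁻¹' Ioi o.im) := (convex_Ioi _).linear_preimage _
  convert h1.inter h2 using 1
  ext z
  simp only [cell, mem_ofPred_eq, mem_inter_iff, mem_preimage, Complex.reLm_coe, Complex.imLm_coe,
    mem_Ioo, mem_Ioi, abs_lt]
  refine and_congr_left fun _ => ?_
  constructor <;> rintro ⟨h1, h2⟩ <;> constructor <;> linarith

theorem convex_leftCell (j : J) : Convex ℝ (leftCell N q o j) :=
  (convex_cell_cut N q o j).inter (convex_lt_linear _ o 0)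

theorem convex_rightCell (j : J) : Convex ℝ (rightCell N q o j) :=
  (convex_cell_cut N q o j).inter (convex_lt_linear (-planarCross (q j - o)) o 0)

variable {N q o}

theorem IsCenter.ne (ho : IsCenter N q o) (j : J) : q j ≠ o := fun h =>
  (ho.im_lt j).ne (by rw [h])

theorem IsCenter.im_lt_one (ho : IsCenter N q o) : o.im < 1 := by
  have := ho.mem_interior
  rw [interior_domainDisk] at this
  exact this.2.2

theorem IsCenter.im_lt_of_mem_rayCut (ho : IsCenter N q o) {j : J} {z : ℂ}
    (hz : z ∈ rayCut o (q j)) : z.im < o.im := by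
  obtain ⟨s, hs, h⟩ := (mem_rayCut_iff (ho.ne j)).1 hz
  have := congrArg Complex.im h
  simp only [Complex.sub_im, Complex.smul_im, smul_eq_mul] at this
  nlinarith [ho.im_lt j]

/-- A cut only meets its own ray. -/
theorem IsCenter.notMem_rayCut (ho : IsCenter N q o) {i j : J} (hij : i ≠ j) {z : ℂ}
    (hz : z ∈ cell N q o (.cut j)) : z ∉ rayCut o (q i) := by
  intro h
  obtain ⟨s, hs, h⟩ := (mem_rayCut_iff (ho.ne i)).1 h
  obtain ⟨h1, -, h2⟩ := hz
  have h3 := h2 i hij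
  have hpos := planarDot_self_pos (sub_ne_zero.2 (ho.ne j))
  rw [h, map_smul, map_smul, smul_eq_mul, smul_eq_mul] at h3
  rw [h, map_smul, smul_eq_mul] at h1
  rw [abs_mul, abs_of_nonneg (by linarith : (0 : ℝ) ≤ s)] at h3
  -- A point of the ray through `q i` lies in the half-plane of the wedge, so `q i` does too. The
  -- absolute value can then be dropped, and the angle inequality compares a number with itself.
  have h4 : 0 < planarDot (q j - o) (q i - o) := by
    by_contra h5
    nlinarith
  rw [abs_of_pos h4] at h3
  linarith

theorem IsCenter.mem_cut (ho : IsCenter N q o) {j : J} {z : ℂ} (hz : z ∈ rayCut o (q j))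
    (hne : z ≠ q j) : z ∈ cell N q o (.cut j) := by
  have h0 := ho.im_lt_of_mem_rayCut hz
  obtain ⟨s, hs, h⟩ := (mem_rayCut_iff (ho.ne j)).1 hz
  have hs' : 1 < s := by
    refine lt_of_le_of_ne hs fun hs' => hne ?_
    rw [← hs', one_smul] at h
    exact sub_left_injective h
  have hpos := planarDot_self_pos (sub_ne_zero.2 (ho.ne j))
  refine ⟨?_, h0, fun i hi => ?_⟩
  · rw [h, map_smul, smul_eq_mul]
    nlinarith
  · rw [hz.1, abs_zero, zero_mul, h, map_smul, smul_eq_mul]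
    have := abs_pos.2 (ho.cross_ne_zero i j hi)
    positivity

theorem IsCenter.notMem_arcSet (ho : IsCenter N q o) {j : J} {z : ℂ}
    (hz : z ∈ cell N q o (.cut j)) (ν : ℕ) : z ∉ arcSet ν := fun h => by
  have := hz.2.1
  rw [h.1] at this
  linarith [ho.im_lt_one]

/-- A wedge meets no arc and no ray but its own, so removing the disk's boundary just removes the
line where the cross product vanishes. -/
theorem IsCenter.cut_inter_disk (ho : IsCenter N q o) (j : J) :
    cell N q o (.cut j) ∩ cell N q o .disk = leftCell N q o j ∪ rightCell N q o j := by
  ext z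
  simp only [leftCell, rightCell, ← inter_union_distrib_left, mem_inter_iff]
  refine and_congr_right fun hz => ?_
  have h1 : z ∈ cell N q o .disk ↔ planarCross (q j - o) (z - o) ≠ 0 := by
    constructor
    · intro h h0
      exact h.2 j ⟨h0, hz.1.le⟩
    · intro h
      refine ⟨fun ν => ho.notMem_arcSet hz ν, fun i hi => ?_⟩
      by_cases hij : i = j
      · subst hij
        exact h hi.1
      · exact ho.notMem_rayCut hij hz hi
  rw [h1, ne_iff_lt_or_gt, or_comm]
  simp

theorem IsCenter.notMem_cell (ho : IsCenter N q o) (j : J) (p : Piece J (Fin N)) :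
    q j ∉ cell N q o p := by
  have hj : q j ∈ rayCut o (q j) := ⟨planarCross_self _, le_rfl⟩
  cases p with
  | disk => exact fun h => h.2 j hj
  | cut i =>
    by_cases hij : j = i
    · subst hij
      exact fun h => lt_irrefl _ h.1
    · exact fun h => ho.notMem_rayCut hij h hj
  | cone ν => exact fun h => (ho.im_lt j).not_gt h.2

theorem IsCenter.exists_mem_cell (ho : IsCenter N q o) {z : ℂ} (hz : ∀ j, z ≠ q j) :
    ∃ p, z ∈ cell N q o p := by
  by_cases h1 : ∃ ν : Fin N, z ∈ arcSet ν
  · obtain ⟨ν, h⟩ := h1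
    exact ⟨.cone ν, h.2.trans_lt (by norm_num), by rw [h.1]; exact ho.im_lt_one⟩
  by_cases h2 : ∃ j, z ∈ rayCut o (q j)
  · obtain ⟨j, h⟩ := h2
    exact ⟨.cut j, ho.mem_cut h (hz j)⟩
  exact ⟨.disk, not_exists.1 h1, not_exists.1 h2⟩

/-- The upper side is extreme in `F`: a segment from a point below height `1` reaches that height
only at its other end. Thus contractions towards such a point cannot run into the arcs. -/
theorem combo_eq_of_im_eq_one {N : ℕ} {y z : ℂ} (hy : y.im < 1) (hz : z ∈ domainDisk N) {a b : ℝ}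
    (ha : 0 ≤ a) (hab : a + b = 1) (hb : 0 ≤ b) (h : (a • y + b • z).im = 1) :
    a • y + b • z = z := by
  have h1 : z.im ≤ 1 := hz.2.2
  simp only [Complex.add_im, Complex.smul_im, smul_eq_mul] at h
  have ha0 : a = 0 := by
    by_contra hne
    have : 0 < a := lt_of_le_of_ne ha (Ne.symm hne)
    nlinarith
  obtain rfl : b = 1 := by linarith
  rw [ha0, zero_smul, one_smul, zero_add]

/-- The removed rays are radial from `o` and extend outwards, so a segment from `o` meeting one
would have its endpoint on it. -/
theorem IsCenter.starConvex_disk (ho : IsCenter N q o) :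
    StarConvex ℝ o (cell N q o .disk ∩ domainDisk N) := by
  rintro z ⟨⟨hz1, hz2⟩, hz⟩ a b ha hb hab
  refine ⟨⟨fun ν h => ?_, fun j h => ?_⟩,
    convex_domainDisk N (interior_subset ho.mem_interior) hz ha hb hab⟩
  · rw [combo_eq_of_im_eq_one ho.im_lt_one hz ha hab hb h.1] at h
    exact hz1 ν h
  · have h3 : a • o + b • z - o = b • (z - o) := by
      rw [smul_sub]
      obtain rfl : a = 1 - b := by linarith
      rw [sub_smul, one_smul]
      abel
    have hpos := planarDot_self_pos (sub_ne_zero.2 (ho.ne j))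
    rw [rayCut, mem_ofPred_eq, h3, map_smul, map_smul, smul_eq_mul, smul_eq_mul] at h
    have hb0 : b ≠ 0 := by
      rintro rfl
      rw [zero_mul] at h
      linarith [h.2]
    have hb1 : 0 < b := lt_of_le_of_ne hb hb0.symm
    refine hz2 j ⟨(mul_eq_zero.1 h.1).resolve_left hb0, ?_⟩
    nlinarith [h.2]

/-- The cone points. -/
def conePoint (ν : ℕ) : ℂ := ⟨ν + 1, 1⟩

theorem conePoint_mem (ν : Fin N) : conePoint ν ∈ domainDisk N := by
  have h1 : ((ν : ℕ) : ℝ) + 1 ≤ N := by exact_mod_cast ν.2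
  have h2 : (0 : ℝ) ≤ ((ν : ℕ) : ℝ) := Nat.cast_nonneg _
  refine ⟨⟨?_, ?_⟩, ?_, ?_⟩ <;> simp only [conePoint] <;> linarith

theorem IsCenter.conePoint_mem_cell (ho : IsCenter N q o) (ν : Fin N) :
    conePoint ν ∈ cell N q o (.cone ν) :=
  ⟨by simp [conePoint], ho.im_lt_one⟩

/-- The intersection need not be convex, since the arcs are removed from the upper side; it is
star-shaped about a point directly below the cone point, halfway between the heights `o.im` and `1`.
-/
theorem IsCenter.exists_starConvex_cone (ho : IsCenter N q o) (ν : Fin N) :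
    ∃ b ∈ cell N q o (.cone ν) ∩ cell N q o .disk ∩ domainDisk N,
      StarConvex ℝ b (cell N q o (.cone ν) ∩ cell N q o .disk ∩ domainDisk N) := by
  have h1 := ho.im_lt_one
  have h0 : 0 < o.im := by
    have := ho.mem_interior
    rw [interior_domainDisk] at this
    exact this.2.1
  let b : ℂ := ⟨(ν : ℕ) + 1, (o.im + 1) / 2⟩
  have hb1 : b.im < 1 := by simp only [b]; linarith
  have hbc : b ∈ cell N q o (.cone ν) := ⟨by simp [b], by simp only [b]; linarith⟩
  have hbF : b ∈ domainDisk N := by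
    have h := conePoint_mem ν
    exact ⟨h.1, by simp only [b]; linarith, by simp only [b]; linarith⟩
  have hray : ∀ z ∈ cell N q o (.cone ν), ∀ j, z ∉ rayCut o (q j) := fun z hz j h =>
    (ho.im_lt_of_mem_rayCut h).not_gt hz.2
  refine ⟨b, ⟨⟨hbc, fun ν' h => ?_, hray b hbc⟩, hbF⟩, ?_⟩
  · exact hb1.ne h.1
  · rintro z ⟨⟨hz1, hz2⟩, hz⟩ s r hs hr hsr
    have h3 := convex_cell_cone N q o ν hbc hz1 hs hr hsr
    refine ⟨⟨h3, fun ν' h => ?_, hray _ h3⟩, convex_domainDisk N hbF hz hs hr hsr⟩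
    rw [combo_eq_of_im_eq_one hb1 hz hs hsr hr h.1] at h
    exact hz2.1 ν' h

theorem IsCenter.exists_mem_cut (ho : IsCenter N q o) (j : J)
    (hq : q j ∈ interior (domainDisk N)) :
    ∃ z ∈ cell N q o (.cut j) ∩ interior (domainDisk N), z ∈ rayCut o (q j) := by
  have hc : ContinuousAt (fun s : ℝ => o + s • (q j - o)) 1 := by fun_prop
  have h1 : ∀ᶠ s : ℝ in 𝓝 1, o + s • (q j - o) ∈ interior (domainDisk N) := by
    refine hc.eventually (isOpen_interior.mem_nhds ?_)
    simpa using hq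
  obtain ⟨s, hs, hs1⟩ := ((h1.filter_mono nhdsWithin_le_nhds).and
    (self_mem_nhdsWithin (a := (1 : ℝ)) (s := Ioi 1))).exists
  have hs1' : (1 : ℝ) < s := hs1
  have hr : o + s • (q j - o) ∈ rayCut o (q j) :=
    (mem_rayCut_iff (ho.ne j)).2 ⟨s, hs1'.le, by simp⟩
  refine ⟨_, ⟨ho.mem_cut hr fun h => ?_, hs⟩, hr⟩
  have h2 : (s - 1) • (q j - o) = 0 := by
    rw [sub_smul, one_smul, ← sub_eq_zero.2 h]
    abel
  rcases smul_eq_zero.1 h2 with h3 | h3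
  · linarith
  · exact ho.ne j (sub_eq_zero.1 h3)

/-- From a point of the ray slightly beyond the puncture, small steps perpendicular to the ray stay
in the open wedge and in `F`, and they change the cross product to either sign. -/
theorem IsCenter.nonempty_sides [Finite J] (ho : IsCenter N q o) (j : J)
    (hq : q j ∈ interior (domainDisk N)) :
    (leftCell N q o j ∩ domainDisk N).Nonempty ∧ (rightCell N q o j ∩ domainDisk N).Nonempty := by
  obtain ⟨z, hz, hzr⟩ := ho.exists_mem_cut j hq
  have hc : ContinuousAt (fun s : ℝ => z + s • (Complex.I * (q j - o))) 0 := by fun_prop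
  have h1 : ∀ᶠ s : ℝ in 𝓝 0, z + s • (Complex.I * (q j - o)) ∈
      cell N q o (.cut j) ∩ interior (domainDisk N) := by
    refine hc.eventually (((isOpen_cell N q o _).inter isOpen_interior).mem_nhds ?_)
    simpa using hz
  obtain ⟨ε, hε, h2⟩ := Metric.eventually_nhds_iff.1 h1
  have hpos := planarDot_self_pos (sub_ne_zero.2 (ho.ne j))
  have h3 : ∀ s : ℝ, planarCross (q j - o) (z + s • (Complex.I * (q j - o)) - o) =
      s * planarDot (q j - o) (q j - o) := by
    intro s
    rw [add_sub_right_comm, map_add, hzr.1, zero_add, map_smul, smul_eq_mul]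
    congr 1
    rw [planarCross_apply, planarDot_apply]
    simp only [Complex.mul_re, Complex.mul_im, Complex.I_re, Complex.I_im]
    ring
  have h4 := h2 (y := ε / 2) (by rw [Real.dist_eq, sub_zero, abs_of_pos] <;> linarith)
  have h5 := h2 (y := -(ε / 2)) (by rw [Real.dist_eq, sub_zero, abs_neg, abs_of_pos] <;> linarith)
  refine ⟨⟨_, ⟨h4.1, ?_⟩, interior_subset h4.2⟩, ⟨_, ⟨h5.1, ?_⟩, interior_subset h5.2⟩⟩
  · rw [mem_ofPred_eq, h3]
    positivity
  · rw [mem_ofPred_eq, h3, neg_mul, neg_neg]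
    positivity

end Cells

/-! ### The atlas of the punctured thick tree -/

section PuncturedThickTree

open Set Topology Monoid
open scoped unitInterval
open OrbifoldAtlas (Piece)

variable {N : ℕ} {A : Fin N → Type u} [∀ ν, Group (A ν)] {g : ∀ ν, A ν}

/-- The contraction of the fundamental domain to a point `c` along segments. -/
noncomputable def domainContract (c z : domainDisk N) (t : I) : domainDisk N :=
  ⟨(1 - (t : ℝ)) • (z : ℂ) + (t : ℝ) • (c : ℂ),
    convex_domainDisk N z.2 c.2 (sub_nonneg.2 t.2.2) t.2.1 (by ring)⟩

theorem continuous_domainContract (c : domainDisk N) :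
    Continuous fun zt : domainDisk N × I => domainContract c zt.1 zt.2 := by
  refine Continuous.subtype_mk ?_ _
  fun_prop

theorem domainContract_zero (c z : domainDisk N) : domainContract c z 0 = z :=
  Subtype.ext (by simp [domainContract])

theorem domainContract_one (c z : domainDisk N) : domainContract c z 1 = c :=
  Subtype.ext (by simp [domainContract])

theorem domainContract_mem {C : Set ℂ} {c z : domainDisk N}
    (hC : StarConvex ℝ (c : ℂ) (C ∩ domainDisk N)) (hz : (z : ℂ) ∈ C) (t : I) :
    (domainContract c z t : ℂ) ∈ C := by
  have := hC ⟨hz, z.2⟩ t.2.1 (sub_nonneg.2 t.2.2) (by ring)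
  rw [add_comm] at this
  exact this.1

theorem coe_arcPoint_mem (ν : Fin N) (s : ℝ) (hs : |s| ≤ 1 / 4) :
    (arcPoint ν s hs : ℂ) ∈ arcSet ν :=
  ⟨rfl, by simpa [arcPoint] using hs⟩

theorem Glue.exists_mem_arcSet {a b : (_ : CoprodI A) × domainDisk N} (h : Glue A g a b) :
    ∃ ν : Fin N, (a.2 : ℂ) ∈ arcSet ν ∧ (b.2 : ℂ) ∈ arcSet ν := by
  obtain ⟨γ, ν, s, hs₀, hs⟩ := h
  exact ⟨ν, coe_arcPoint_mem ν s (abs_le.2 ⟨by linarith, hs⟩),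
    coe_arcPoint_mem ν (-s) (abs_le.2 ⟨by linarith, by linarith⟩)⟩

namespace ThickTree

/-- A set of points of the copies of the fundamental domain that is a union of classes. -/
def IsSaturated (g : ∀ ν, A ν) (S : Set ((_ : CoprodI A) × domainDisk N)) : Prop :=
  ∀ ⦃a b⦄, Glue A g a b → (a ∈ S ↔ b ∈ S)

variable {S : Set ((_ : CoprodI A) × domainDisk N)}

theorem IsSaturated.mem_iff (hS : IsSaturated g S) {a b : (_ : CoprodI A) × domainDisk N}
    (h : Quot.mk (Glue A g) a = Quot.mk _ b) : a ∈ S ↔ b ∈ S :=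
  iff_of_eq (congrArg (Quot.lift (· ∈ S) fun _ _ h => propext (hS h)) h)

theorem IsSaturated.mk_mem_image (hS : IsSaturated g S) (a : (_ : CoprodI A) × domainDisk N) :
    (Quot.mk _ a : ThickTree A g) ∈ (Quot.mk _ '' S : Set (ThickTree A g)) ↔ a ∈ S :=
  ⟨fun ⟨_, hb, h⟩ => (hS.mem_iff h).1 hb, fun h => ⟨a, h, rfl⟩⟩

theorem IsSaturated.isOpen_image (hS : IsSaturated g S) (h : IsOpen S) :
    IsOpen (Quot.mk _ '' S : Set (ThickTree A g)) := by
  have hq : IsQuotientMap (Quot.mk (Glue A g)) := isQuotientMap_quot_mk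
  refine hq.isOpen_preimage.1 ?_
  convert h using 1
  exact Set.ext hS.mk_mem_image

theorem continuous_mk (γ : CoprodI A) : Continuous (mk A g γ) :=
  continuous_quot_mk.comp
    (continuous_sigmaMk (i := γ))

/-- Currying turns the claim into continuity of a map out of a disjoint union, which is checked on
each copy. -/
theorem continuous_mk_domainContract (c : domainDisk N) :
    Continuous fun p : ((_ : CoprodI A) × domainDisk N) × I =>
      mk A g p.1.1 (domainContract c p.1.2 p.2) := by
  let f : ∀ γ : CoprodI A, C(domainDisk N × I, ThickTree A g) := fun γ =>
    ⟨fun zt => mk A g γ (domainContract c zt.1 zt.2), (continuous_mk γ).comp (continuous_domainContract c)⟩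
  let F : C((_ : CoprodI A) × domainDisk N, C(I, ThickTree A g)) :=
    ⟨fun p => (f p.1).curry p.2, continuous_sigma fun γ => (f γ).curry.continuous⟩
  exact ContinuousMap.continuous_uncurry_of_continuous F

/-- The segment contractions of the copies towards `c` agree on glued points, and the copies of `c`
coincide, so the image is contractible. Openness of `S` makes the restricted map a quotient map, and
the homotopy is checked for continuity before passing to the quotient. -/
theorem isSimplyConnected_image (hS : IsSaturated g S) (hSo : IsOpen S) {γ₀ : CoprodI A}
    {c : domainDisk N} (hc : (⟨γ₀, c⟩ : (_ : CoprodI A) × domainDisk N) ∈ S)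
    (hstar : ∀ p ∈ S, ∀ t, (⟨p.1, domainContract c p.2 t⟩ : (_ : CoprodI A) × domainDisk N) ∈ S)
    (hglue : ∀ a b, Glue A g a b → a ∈ S → ∀ t,
      mk A g a.1 (domainContract c a.2 t) = mk A g b.1 (domainContract c b.2 t))
    (hcenter : ∀ p ∈ S, mk A g p.1 c = mk A g γ₀ c) :
    IsSimplyConnected (Quot.mk _ '' S : Set (ThickTree A g)) := by
  classical
  let T : Set (ThickTree A g) := Quot.mk _ '' S
  have hT : ∀ a, (Quot.mk _ a : ThickTree A g) ∈ T ↔ a ∈ S := hS.mk_mem_image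
  have hq : IsQuotientMap (Quot.mk (Glue A g)) := isQuotientMap_quot_mk
  have hq' := hq.restrictPreimage_isOpen (hS.isOpen_image hSo)
  have hwd : ∀ a b, Quot.mk (Glue A g) a = Quot.mk _ b → a ∈ S → ∀ t,
      mk A g a.1 (domainContract c a.2 t) = mk A g b.1 (domainContract c b.2 t) := by
    intro a b hab ha t
    -- Compatibility with the gluing is known only on `S`. A constant value off `S` gives a function
    -- that descends to the whole quotient.
    have key := congrArg (Quot.lift (fun p : (_ : CoprodI A) × domainDisk N =>
      if p ∈ S then mk A g p.1 (domainContract c p.2 t) else mk A g γ₀ c) fun p p' h => by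
        by_cases hp : p ∈ S
        · rw [if_pos hp, if_pos ((hS h).1 hp), hglue p p' h hp t]
        · rw [if_neg hp, if_neg fun h' => hp ((hS h).2 h')]) hab
    simpa only [if_pos ha, if_pos ((hS.mem_iff hab).1 ha)] using key
  have hout : ∀ x : T, (Quot.out x.1 : (_ : CoprodI A) × domainDisk N) ∈ S := fun x =>
    (hT _).1 ((congrArg (· ∈ T) (Quot.out_eq x.1)).mpr x.2)
  let H : T × I → T := fun x => ⟨mk A g (Quot.out x.1.1).1 (domainContract c (Quot.out x.1.1).2 x.2),
    (hT _).2 (hstar _ (hout x.1) x.2)⟩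
  have hH : Continuous H := by
    refine hq'.continuous_lift_prod_left ?_
    refine Continuous.subtype_mk ?_ _
    have h1 := (continuous_mk_domainContract (A := A) (g := g) c).comp
      (continuous_subtype_val.prodMap continuous_id :
        Continuous (Prod.map (Subtype.val : (Quot.mk _ ⁻¹' T : Set _) → _) (id : I → I)))
    refine h1.congr fun p => ?_
    exact hwd _ _ (Quot.out_eq _).symm ((hT _).1 p.1.2) p.2
  have : ContractibleSpace T := by
    refine (contractible_iff_id_nullhomotopic _).2 ⟨⟨mk A g γ₀ c, (hT _).2 hc⟩, ⟨?_⟩⟩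
    refine ⟨⟨fun p => H (p.2, p.1), by fun_prop⟩, fun x => Subtype.ext ?_, fun x => Subtype.ext ?_⟩
    · change mk A g _ (domainContract c _ 0) = x.1
      rw [domainContract_zero]
      exact Quot.out_eq x.1
    · change mk A g _ (domainContract c _ 1) = mk A g γ₀ c
      rw [domainContract_one]
      exact hcenter _ (hout x)
  exact (inferInstance : SimplyConnectedSpace T)

/-- The points of a set `C` in the copies of the fundamental domain with index in `K`. -/
def cellSet (K : Subgroup (CoprodI A)) (C : Set ℂ) : Set ((_ : CoprodI A) × domainDisk N) :=
  {p | p.1 ∈ K ∧ (p.2 : ℂ) ∈ C}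

theorem isOpen_cellSet (K : Subgroup (CoprodI A)) {C : Set ℂ} (hC : IsOpen C) :
    IsOpen (cellSet (N := N) K C) := by
  refine isOpen_sigma_iff.2 fun γ => ?_
  by_cases h : γ ∈ K
  · convert hC.preimage (continuous_subtype_val (p := (· ∈ domainDisk N))) using 1
    ext z
    simp [cellSet, h]
  · convert isOpen_empty using 1
    ext z
    simp [cellSet, h]

theorem isSaturated_cellSet (K : Subgroup (CoprodI A)) {C : Set ℂ}
    (hC : ∀ ν : Fin N, ∀ z ∈ arcSet ν, z ∉ C) : IsSaturated g (cellSet (N := N) K C) := by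
  intro a b h
  obtain ⟨ν, ha, hb⟩ := h.exists_mem_arcSet
  exact iff_of_false (fun h => hC ν _ ha h.2) (fun h => hC ν _ hb h.2)

end ThickTree

variable {J : Type w} {q : J → ℂ} {o : ℂ}

/-- The indices of the copies of the fundamental domain that meet a piece of the atlas. -/
def pieceSubgroup (A : Fin N → Type u) [∀ ν, Group (A ν)] : Piece J (Fin N) → Subgroup (CoprodI A)
  | .disk => ⊥
  | .cut _ => ⊥
  | .cone ν => (CoprodI.of : A ν →* CoprodI A).range

theorem mem_cell_cone_of_mem_arcSet (ho : IsCenter N q o) {ν ν' : Fin N} {z : ℂ}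
    (hz : z ∈ arcSet ν) : z ∈ cell N q o (.cone ν') ↔ ν = ν' := by
  constructor
  · rintro ⟨h, -⟩
    have h1 := abs_le.1 hz.2
    have h2 := abs_lt.1 h
    have h3 : ((ν : ℕ) : ℝ) < (ν' : ℕ) + 1 := by linarith
    have h4 : ((ν' : ℕ) : ℝ) < (ν : ℕ) + 1 := by linarith
    norm_cast at h3 h4
    exact Fin.ext (by omega)
  · rintro rfl
    exact ⟨hz.2.trans_lt (by norm_num), by rw [hz.1]; exact ho.im_lt_one⟩

/-- Disks and cuts avoid the arcs. On a cone the gluing multiplies the index by `g ν`, which stays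
in the image of `A ν`, and arcs at other cone points do not meet the cone. -/
theorem IsCenter.isSaturated_cellSet (ho : IsCenter N q o) (p : Piece J (Fin N)) :
    ThickTree.IsSaturated g (ThickTree.cellSet (pieceSubgroup A p) (cell N q o p)) := by
  cases p with
  | disk => exact ThickTree.isSaturated_cellSet _ fun ν z hz h => h.1 ν hz
  | cut j => exact ThickTree.isSaturated_cellSet _ fun ν z hz h => ho.notMem_arcSet h ν hz
  | cone ν' =>
    rintro _ _ ⟨γ, ν, s, hs₀, hs⟩
    simp only [ThickTree.cellSet, mem_ofPred_eq,
      mem_cell_cone_of_mem_arcSet ho (coe_arcPoint_mem ν _ _)]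
    refine and_congr_left fun h => ?_
    subst h
    exact (Subgroup.mul_mem_cancel_right _ (MonoidHom.mem_range.2 ⟨g ν, rfl⟩)).symm

theorem IsCenter.mem_cell_disk (ho : IsCenter N q o) : o ∈ cell N q o .disk :=
  ⟨fun _ h => ho.im_lt_one.ne h.1, fun _ h => (ho.im_lt_of_mem_rayCut h).false⟩

/-- The gluing with parameter `s = 0` identifies the cone points of the copies `γ` and `γ * g ν`;
since `g ν` generates `A ν`, all copies indexed by `A ν` share this point. -/
theorem mk_conePoint (hg : ∀ ν, Subgroup.zpowers (g ν) = ⊤) (ν : Fin N) (a : A ν) :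
    ThickTree.mk A g (CoprodI.of a) ⟨conePoint ν, conePoint_mem ν⟩ =
      ThickTree.mk A g 1 ⟨conePoint ν, conePoint_mem ν⟩ := by
  have hc : ∀ h, arcPoint ν 0 h = ⟨conePoint ν, conePoint_mem ν⟩ := fun h =>
    Subtype.ext (by simp [arcPoint, conePoint])
  have hc' : ∀ h, arcPoint ν (-0) h = ⟨conePoint ν, conePoint_mem ν⟩ := fun h =>
    Subtype.ext (by simp [arcPoint, conePoint])
  have hstep : ∀ γ : CoprodI A, ThickTree.mk A g (γ * CoprodI.of (g ν))
      ⟨conePoint ν, conePoint_mem ν⟩ = ThickTree.mk A g γ ⟨conePoint ν, conePoint_mem ν⟩ := by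
    intro γ
    have h : Quot.mk (Glue A g) _ = Quot.mk _ _ :=
      Quot.sound (Glue.arc γ ν 0 le_rfl (by norm_num))
    rw [hc, hc'] at h
    exact h.symm
  obtain ⟨k, rfl⟩ : a ∈ Subgroup.zpowers (g ν) := by rw [hg]; trivial
  induction k with
  | zero => simp
  | succ k ih =>
    simp only [zpow_add_one, map_mul] at ih ⊢
    rw [hstep, ih]
  | pred k ih =>
    simp only [zpow_sub_one, map_mul, map_inv] at ih ⊢
    rw [← hstep, inv_mul_cancel_right, ih]

/-- Disks contract to `o`, wedges to a point on their ray, and cones to the cone point. In the last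
case the contraction rescales both glued arcs by the same factor `1 - t`, so it respects the gluing.
-/
theorem IsCenter.isSimplyConnected_piece [Finite J] (ho : IsCenter N q o)
    (hg : ∀ ν, Subgroup.zpowers (g ν) = ⊤) (hq : ∀ j, q j ∈ interior (domainDisk N))
    (p : Piece J (Fin N)) :
    IsSimplyConnected (Quot.mk _ '' ThickTree.cellSet (pieceSubgroup A p) (cell N q o p) :
      Set (ThickTree A g)) := by
  have hS := ho.isSaturated_cellSet (g := g) p
  have hSo := ThickTree.isOpen_cellSet (N := N) (pieceSubgroup A p) (isOpen_cell N q o p)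
  have key : ∀ c : domainDisk N, StarConvex ℝ (c : ℂ) (cell N q o p ∩ domainDisk N) →
      ∀ p' ∈ ThickTree.cellSet (pieceSubgroup A p) (cell N q o p), ∀ t,
      (⟨p'.1, domainContract c p'.2 t⟩ : (_ : CoprodI A) × domainDisk N) ∈
        ThickTree.cellSet (pieceSubgroup A p) (cell N q o p) := fun c hc p' hp' t =>
    ⟨hp'.1, domainContract_mem hc hp'.2 t⟩
  cases p with
  | disk =>
    refine ThickTree.isSimplyConnected_image hS hSo (γ₀ := 1)
      (c := ⟨o, interior_subset ho.mem_interior⟩) ⟨one_mem _, ho.mem_cell_disk⟩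
      (key _ ho.starConvex_disk) ?_ fun p' hp' => ?_
    · intro a b h ha
      obtain ⟨ν, hν, -⟩ := h.exists_mem_arcSet
      exact absurd hν (ha.2.1 ν)
    · rw [Subgroup.mem_bot.1 hp'.1]
  | cut j =>
    obtain ⟨c, hc, -⟩ := ho.exists_mem_cut j (hq j)
    refine ThickTree.isSimplyConnected_image hS hSo (γ₀ := 1)
      (c := ⟨c, interior_subset hc.2⟩) ⟨one_mem _, hc.1⟩
      (key _ (((convex_cell_cut N q o j).inter (convex_domainDisk N)).starConvex
        ⟨hc.1, interior_subset hc.2⟩)) ?_ fun p' hp' => ?_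
    · intro a b h ha
      obtain ⟨ν, hν, -⟩ := h.exists_mem_arcSet
      exact absurd hν (ho.notMem_arcSet ha.2 ν)
    · rw [Subgroup.mem_bot.1 hp'.1]
  | cone ν =>
    refine ThickTree.isSimplyConnected_image hS hSo (γ₀ := 1)
      (c := ⟨conePoint ν, conePoint_mem ν⟩) ⟨one_mem _, ho.conePoint_mem_cell ν⟩
      (key _ (((convex_cell_cone N q o ν).inter (convex_domainDisk N)).starConvex
        ⟨ho.conePoint_mem_cell ν, conePoint_mem ν⟩)) ?_ fun p' hp' => ?_
    · rintro _ _ ⟨γ, ν', s, hs₀, hs⟩ h t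
      obtain rfl := (mem_cell_cone_of_mem_arcSet ho (coe_arcPoint_mem ν' s
        (abs_le.2 ⟨by linarith, hs⟩))).1 h.2
      have h0 : 0 ≤ (1 - (t : ℝ)) * s := mul_nonneg (sub_nonneg.2 t.2.2) hs₀
      have h1 : (1 - (t : ℝ)) * s ≤ 1 / 4 := by nlinarith [t.2.1]
      have hc : ∀ r hr hr', domainContract ⟨conePoint ν', conePoint_mem ν'⟩ (arcPoint ν' r hr) t =
          arcPoint ν' ((1 - t) * r) hr' := by
        intro r hr hr'
        refine Subtype.ext ?_
        refine Complex.ext ?_ ?_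
        · simp only [domainContract, arcPoint, conePoint, Complex.add_re, Complex.smul_re, smul_eq_mul]
          ring
        · simp only [domainContract, arcPoint, conePoint, Complex.add_im, Complex.smul_im, smul_eq_mul]
          ring
      have h2 : ((1 - (t : ℝ)) * -s) = -((1 - t) * s) := by ring
      have h3 : |(1 - (t : ℝ)) * s| ≤ 1 / 4 := abs_le.2 ⟨by linarith, h1⟩
      have h4 : |(1 - (t : ℝ)) * -s| ≤ 1 / 4 := by rwa [h2, abs_neg]
      rw [hc s _ h3, hc (-s) _ h4]
      simp only [h2]
      exact Quot.sound (Glue.arc γ ν' _ h0 h1)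
    · obtain ⟨a, ha⟩ := hp'.1
      rw [← ha]
      exact mk_conePoint hg ν a

end PuncturedThickTree

/-! ### Pieces in the punctured quotient and verification of the atlas axioms -/

section PuncturedThickTreeAtlas

open Set Topology Monoid
open OrbifoldAtlas (Piece)

namespace PuncturedThickTree

variable {N : ℕ} {A : Fin N → Type u} [∀ ν, Group (A ν)] {g : ∀ ν, A ν} {k : ℕ}
  {q : Fin k → domainDisk N}

theorem notMem_arcSet_of_mem_interior {z : ℂ} (hz : z ∈ interior (domainDisk N)) (ν : ℕ) :
    z ∉ arcSet ν := fun h => by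
  rw [interior_domainDisk] at hz
  exact hz.2.2.ne h.1

/-- Interior points are not glued to anything, so the orbit of a puncture meets each copy of `F` in
that puncture only. -/
theorem mk_mem_iff (hq : ∀ j, (q j : ℂ) ∈ interior (domainDisk N)) (γ : CoprodI A)
    (z : domainDisk N) : ThickTree.mk A g γ z ∈ PuncturedThickTree A g q ↔ ∀ j, z ≠ q j := by
  refine forall_congr' fun j => not_congr ⟨?_, ?_⟩
  · rintro ⟨δ, hδ⟩
    have hS : ThickTree.IsSaturated g (ThickTree.cellSet (N := N) (A := A) ⊤ {(q j : ℂ)}) := by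
      refine ThickTree.isSaturated_cellSet _ ?_
      rintro ν _ h rfl
      exact notMem_arcSet_of_mem_interior (hq j) ν h
    have h := (hS.mem_iff (a := ⟨δ * 1, q j⟩) (b := ⟨γ, z⟩) hδ).1 ⟨trivial, rfl⟩
    exact Subtype.ext h.2
  · rintro rfl
    exact ⟨γ, congrArg (fun δ => ThickTree.mk A g δ (q j)) (mul_one γ)⟩

variable (g q) in
/-- The image in the punctured surface of a set `C` in the copies of the fundamental domain with
index in `K`. -/
def part (K : Subgroup (CoprodI A)) (C : Set ℂ) : Set (PuncturedThickTree A g q) :=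
  Subtype.val ⁻¹' (Quot.mk _ '' ThickTree.cellSet K C : Set (ThickTree A g))

/-- A representative of a point. -/
noncomputable def rep (x : PuncturedThickTree A g q) : (_ : CoprodI A) × domainDisk N :=
  Quot.out x.1

theorem mk_rep (x : PuncturedThickTree A g q) : ThickTree.mk A g (rep x).1 (rep x).2 = x.1 :=
  Quot.out_eq x.1

variable {K : Subgroup (CoprodI A)} {C : Set ℂ}

theorem smul_mem_part_iff (hS : ThickTree.IsSaturated g (ThickTree.cellSet (N := N) K C))
    (γ : CoprodI A) (x : PuncturedThickTree A g q) :
    γ • x ∈ part g q K C ↔ γ * (rep x).1 ∈ K ∧ ((rep x).2 : ℂ) ∈ C := by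
  have h : (γ • x).1 = Quot.mk (Glue A g) ⟨γ * (rep x).1, (rep x).2⟩ :=
    (congrArg (γ • ·) (mk_rep x)).symm
  rw [part, mem_preimage, h]
  exact hS.mk_mem_image _

theorem mem_part_iff (hS : ThickTree.IsSaturated g (ThickTree.cellSet (N := N) K C))
    (x : PuncturedThickTree A g q) :
    x ∈ part g q K C ↔ (rep x).1 ∈ K ∧ ((rep x).2 : ℂ) ∈ C := by
  have := smul_mem_part_iff hS 1 x
  rwa [one_smul, one_mul] at this

theorem isOpen_part (hS : ThickTree.IsSaturated g (ThickTree.cellSet (N := N) K C))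
    (hC : IsOpen C) : IsOpen (part g q K C) :=
  (hS.isOpen_image (ThickTree.isOpen_cellSet K hC)).preimage continuous_subtype_val

theorem image_subset (hq : ∀ j, (q j : ℂ) ∈ interior (domainDisk N))
    (hC : ∀ j, (q j : ℂ) ∉ C) :
    (Quot.mk _ '' ThickTree.cellSet K C : Set (ThickTree A g)) ⊆
      (PuncturedThickTree A g q : Set (ThickTree A g)) := by
  rintro _ ⟨⟨γ, z⟩, hz, rfl⟩
  refine (mk_mem_iff hq γ z).2 ?_
  rintro j rfl
  exact hC j hz.2

theorem isSimplyConnected_part (hq : ∀ j, (q j : ℂ) ∈ interior (domainDisk N))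
    (hC : ∀ j, (q j : ℂ) ∉ C) (h : IsSimplyConnected
      (Quot.mk _ '' ThickTree.cellSet K C : Set (ThickTree A g))) :
    IsSimplyConnected (part g q K C) := by
  refine (IsEmbedding.subtypeVal (p := (· ∈ PuncturedThickTree A g q))).isSimplyConnected_image.1 ?_
  rw [part, image_preimage_eq_of_subset]
  · exact h
  · rw [Subtype.range_coe_subtype]
    exact image_subset hq hC

theorem isPathConnected_part_bot (hq : ∀ j, (q j : ℂ) ∈ interior (domainDisk N))
    (hC : ∀ j, (q j : ℂ) ∉ C) (h : IsPathConnected (C ∩ domainDisk N)) :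
    IsPathConnected (part g q ⊥ C) := by
  refine IsPathConnected.preimage_coe (U := (PuncturedThickTree A g q : Set (ThickTree A g))) ?_
    (image_subset hq hC)
  have h1 := (h.preimage_coe inter_subset_right).image (ThickTree.continuous_mk (g := g) (1 : CoprodI A))
  convert h1 using 1
  ext x
  constructor
  · rintro ⟨⟨γ, z⟩, ⟨hγ, hz⟩, rfl⟩
    obtain rfl := Subgroup.mem_bot.1 hγ
    exact ⟨z, ⟨hz, z.2⟩, rfl⟩
  · rintro ⟨z, hz, rfl⟩
    exact ⟨⟨1, z⟩, ⟨one_mem _, hz.1⟩, rfl⟩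

variable {o : ℂ}

/-- The atlas of the punctured surface given by a point from which the fundamental domain is cut. -/
noncomputable def atlas (hg : ∀ ν, Subgroup.zpowers (g ν) = ⊤)
    (hq : ∀ j, (q j : ℂ) ∈ interior (domainDisk N)) (ho : IsCenter N (fun j => (q j : ℂ)) o) :
    OrbifoldAtlas (Fin k) A (PuncturedThickTree A g q) :=
  let Q : Fin k → ℂ := fun j => q j
  have hS : ∀ p, ThickTree.IsSaturated g (ThickTree.cellSet (pieceSubgroup A p) (cell N Q o p)) :=
    fun p => ho.isSaturated_cellSet p
  have hl : ∀ j, ThickTree.IsSaturated g (ThickTree.cellSet (A := A) ⊥ (leftCell N Q o j)) :=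
    fun j => ThickTree.isSaturated_cellSet _ fun ν z hz h => ho.notMem_arcSet h.1 ν hz
  have hr : ∀ j, ThickTree.IsSaturated g (ThickTree.cellSet (A := A) ⊥ (rightCell N Q o j)) :=
    fun j => ThickTree.isSaturated_cellSet _ fun ν z hz h => ho.notMem_arcSet h.1 ν hz
  have hd : ∀ ν, ThickTree.IsSaturated g (ThickTree.cellSet (A := A) ⊥
      (cell N Q o (.cone ν) ∩ cell N Q o .disk)) :=
    fun ν => ThickTree.isSaturated_cellSet _ fun ν z hz h => h.2.1 ν hz
  { piece := fun p => part g q (pieceSubgroup A p) (cell N Q o p)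
    isOpen_piece := fun p => isOpen_part (hS p) (isOpen_cell N Q o p)
    simplyConnected := fun p => isSimplyConnected_part hq (fun j => ho.notMem_cell j p)
      (ho.isSimplyConnected_piece hg hq p)
    left := fun j => part g q ⊥ (leftCell N Q o j)
    right := fun j => part g q ⊥ (rightCell N Q o j)
    isOpen_left := fun j => isOpen_part (hl j) (isOpen_leftCell N Q o j)
    isOpen_right := fun j => isOpen_part (hr j) (isOpen_rightCell N Q o j)
    isPathConnected_left := fun j => isPathConnected_part_bot hq
      (fun i h => ho.notMem_cell i _ h.1)
      (((convex_leftCell N Q o j).inter (convex_domainDisk N)).isPathConnected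
        (ho.nonempty_sides j (hq j)).1)
    isPathConnected_right := fun j => isPathConnected_part_bot hq
      (fun i h => ho.notMem_cell i _ h.1)
      (((convex_rightCell N Q o j).inter (convex_domainDisk N)).isPathConnected
        (ho.nonempty_sides j (hq j)).2)
    disjoint_left_right := fun j => by
      refine disjoint_left.2 fun x h h' => ?_
      have h1 := ((mem_part_iff (hl j) x).1 h).2.2
      have h2 := ((mem_part_iff (hr j) x).1 h').2.2
      simp only [mem_ofPred_eq] at h1 h2
      linarith
    cut_inter_disk := fun j => by
      ext x
      have h := Set.ext_iff.1 (ho.cut_inter_disk j) ((rep x).2 : ℂ)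
      rw [mem_inter_iff, mem_union, mem_part_iff (hS _), mem_part_iff (hS _),
        mem_part_iff (hl j), mem_part_iff (hr j), ← and_or_left]
      exact and_and_left.symm.trans (and_congr_right fun _ => h)
    isPathConnected_cone := fun ν => by
      obtain ⟨b, hb, hstar⟩ := ho.exists_starConvex_cone ν
      convert isPathConnected_part_bot (g := g) hq (fun i h => ho.notMem_cell i _ h.1)
        (hstar.isPathConnected hb) using 1
      ext x
      rw [mem_inter_iff, mem_part_iff (hS _), mem_part_iff (hS _), mem_part_iff (hd ν)]
      -- The disk allows only the trivial index, so one copy of `F` carries the whole intersection,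
      -- although the cone meets all copies indexed by `A ν`.
      refine ⟨fun h => ⟨h.2.1, h.1.2, h.2.2⟩, fun h => ⟨⟨?_, h.2.1⟩, h.1, h.2.2⟩⟩
      rw [Subgroup.mem_bot.1 h.1]
      exact one_mem _
    smul_mem_cone := fun ν a x hx => by
      rw [mem_part_iff (hS _)] at hx
      rw [smul_mem_part_iff (hS _)]
      exact ⟨mul_mem (MonoidHom.mem_range.2 ⟨a, rfl⟩) hx.1, hx.2⟩
    -- The index of the chosen representative. The choice matters only for points on arcs, where it
    -- stays within a coset of `A ν`.
    label := fun x => (rep x).1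
    label_disk := fun γ x hx =>
      eq_inv_of_mul_eq_one_right (Subgroup.mem_bot.1 ((smul_mem_part_iff (hS _) γ x).1 hx).1)
    label_cut := fun j γ x hx =>
      eq_inv_of_mul_eq_one_right (Subgroup.mem_bot.1 ((smul_mem_part_iff (hS _) γ x).1 hx).1)
    label_cone := fun ν γ x hx => by
      obtain ⟨a, ha⟩ := ((smul_mem_part_iff (hS _) γ x).1 hx).1
      exact ⟨a, eq_inv_mul_of_mul_eq ha.symm⟩
    exists_mem_piece := fun x => by
      have h1 : ∀ j, (rep x).2 ≠ q j := (mk_mem_iff hq _ _).1 ((mk_rep x).symm ▸ x.2)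
      obtain ⟨p, hp⟩ := ho.exists_mem_cell fun j h => h1 j (Subtype.ext h)
      refine ⟨p, (smul_mem_part_iff (hS p) _ x).2 ⟨?_, hp⟩⟩
      rw [inv_mul_cancel]
      exact one_mem _
    -- Each wedge meets no ray but its own, so a point of two different wedges lies on no ray and
    -- hence in the disk.
    cut_inter_cut := fun i j hij x hx => by
      rw [mem_inter_iff, mem_part_iff (hS _), mem_part_iff (hS _)] at hx
      refine (mem_part_iff (hS _) x).2 ⟨hx.1.1, fun ν => ho.notMem_arcSet hx.1.2 ν, fun l => ?_⟩
      by_cases hl : l = i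
      · exact ho.notMem_rayCut (hl.trans_ne hij) hx.2.2
      · exact ho.notMem_rayCut hl hx.1.2
    cut_inter_cone := fun j ν x hx => by
      rw [mem_inter_iff, mem_part_iff (hS _), mem_part_iff (hS _)] at hx
      exact absurd hx.1.2.2.1 hx.2.2.2.not_gt
    cone_inter_cone := fun ν ν' γ x hx hx' => by
      have h1 := abs_lt.1 ((mem_part_iff (hS _) x).1 hx).2.1
      have h2 := abs_lt.1 ((smul_mem_part_iff (hS _) γ x).1 hx').2.1
      have h3 : ((ν : ℕ) : ℝ) < (ν' : ℕ) + 1 := by linarith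
      have h4 : ((ν' : ℕ) : ℝ) < (ν : ℕ) + 1 := by linarith
      norm_cast at h3 h4
      exact Fin.ext (by omega) }

end PuncturedThickTree

end PuncturedThickTreeAtlas

theorem mainTheorem8 {N : ℕ} (A : Fin N → Type u) [∀ ν, Group (A ν)] [∀ ν, Finite (A ν)]
    (g : ∀ ν, A ν) (hg : ∀ ν, Subgroup.zpowers (g ν) = ⊤)
    (n L : ℕ) (hn : 1 ≤ n)
    (q : Fin (n - 1 + L) → domainDisk N)
    (hq : ∀ j, (q j : ℂ) ∈ interior (domainDisk N))
    (hq' : Function.Injective q)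
    (x₀ : PuncturedThickTree A g q) :
    Nonempty (OrbifoldFundamentalGroup (Monoid.CoprodI A) x₀ ≃*
      Monoid.Coprod (FreeGroup (Fin (n - 1 + L))) (Monoid.CoprodI A)) := by
  obtain ⟨o, ho⟩ := exists_isCenter (fun j => (q j : ℂ)) hq (Subtype.val_injective.comp hq')
  exact (PuncturedThickTree.atlas hg hq ho).nonempty_mulEquiv x₀
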